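/- **Conventions.** Let $V$ be a real vector space and $P\subset V$ a polytope (convex hull of a finite set of points) of dimension $n$; $\mathrm{ver}(P)$ is its set of extreme points and $c(S)$ is the convex hull of $S$. A *triangulation* of $P$ is a finite set of $n$-dimensional simplices with vertices in $\mathrm{ver}(P)$ whose union is $P$ and any two of which meet in a (possibly empty) common face; it is *regular* if there is a concave function on $P$ that is affine on each of these simplices and whose domains of linearity are exactly these simplices. A *circuit* is a minimal affinely dependent set of points $Z=\{z_1,\dots,z_p\}$. If $Z\subset\mathrm{ver}(P)$, then $c(Z)$ has exactly two triangulations; the maximal simplices of each are of the form $c(Z-\omega)$, $\omega\in Z$. A triangulation $T_2$ is obtained from $T_1$ by a *flip along* $Z\subset \mathrm{ver}(P)$ if $T_1$ induces one of the two triangulations of $c(Z)$, say $T_+$, if for all maximal simplices $I,I'$ of $T_+$ and all finite sets $F\subset V$ with $F\cap Z=\emptyset$ one has $c(I\cup F)\in T_1\Leftrightarrow c(I'\cup F)\in T_1$, and if $T_2$ arises from $T_1$ by replacing all simplices $c(I\cup F)\in T_1$ ($I\in T_+$, $F\cap Z=\emptyset$) by all the simplices $c(J\cup F)$, with $J$ in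 the other triangulation $T_-$ of $c(Z)$ and the same sets $F$. Let $A_r$ be the free abelian group on symbols $(a_1,\dots,a_r)$, $a_i\in V$, modulo $(a_{\sigma(1)},\dots,a_{\sigma(r)})=\mathrm{sign}(\sigma)(a_1,\dots,a_r)$ for $\sigma\in S_r$. For an oriented $(r-1)$-simplex $s$, $s^*\in A_r$ is the symbol of its vertices listed in an order inducing the orientation of $s$. **Theorem.** Let $T_1,T_2$ be regular triangulations of an $n$-dimensional polytope $P$. (1) Suppose $T_2$ is obtained from $T_1$ by a flip along the circuit $Z=\{z_1,\dots,z_p\}$ (the $z_i$ distinct). Let $s_1,\dots,s_k$ be the maximal simplices of the triangulation of $c(Z)$ induced by $T_1$, and $u_1,\dots,u_l$ those of the one induced by $T_2$. Then these are distinct, $\{s_1,\dots,s_k,u_1,\dots,u_l\}=\{c(z_1,\dots,\widehat{z_i},\dots,z_p) : 1\le i\le p\}$ and, if $p=n+2$, the $s_i$ are exactly the simplices of $T_1$ removed by the flip and the $u_i$ exactly those added. If all of them are given the orientation induced from an orientation of the affine hull of $Z$, then in $A_{p-1}$ $$e\sum_{i=1}^p(-1)^i(z_1,\dots,\widehat{z_i},\dots,z_p)=(s_1^*+\dots+s_k^*)-(u_1^*+\dots+u_l^*)$$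 for some $e\in\{1,-1\}$. (2) In the situation of (1), orient the affine hull of $P$. Let $s_0\in T_1\setminus T_2$ and let $x_{p+1},\dots,x_{n+2}$ be an enumeration without repetition of the vertices of $s_0$ that are not in $Z$. Then in $A_{n+1}$ $$e\sum_{i=1}^p(-1)^i(z_1,\dots,\widehat{z_i},\dots,z_p,x_{p+1},\dots,x_{n+2})=\sum_w w^*-\sum_y y^*$$ for some $e\in\{1,-1\}$, where $w$ (respectively $y$) runs over the simplices removed (respectively added) by the flip whose set of vertices outside $Z$ is $\{x_{p+1},\dots,x_{n+2}\}$. (3) (No flip is assumed between $T_1$ and $T_2$.) Orient the affine hull of $P$. There are $k\ge 0$ and, for $1\le\alpha\le k$, distinct vertices $z_1^\alpha,\dots,z^\alpha_{p(\alpha)},x^\alpha_{p(\alpha)+1},\dots,x^\alpha_{n+2}$ of $P$ such that $\{z_1^\alpha,\dots,z_{p(\alpha)}^\alpha\}$ is a circuit for each $\alpha$, and in $A_{n+1}$ $$\sum_{\alpha}\sum_{i=1}^{p(\alpha)}(-1)^i(z_1^\alpha,\dots,\widehat{z_i^\alpha},\dots,z_{p(\alpha)}^\alpha,x_{p(\alpha)+1}^\alpha,\dots,x_{n+2}^\alpha)=\sum_{w\in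 T_1}w^*-\sum_{y\in T_2}y^*.$$ (4) Let $n\ge2$ and let $Y$ be the space of real symmetric $n\times n$ matrices, $d=\dim Y=n(n+1)/2$. For $0\ne v\in\mathbb Q^n$ put $v'=v\,{}^tv$. A *tile* is the closed convex cone generated by the $v'$ with $v$ a minimal vector (over $\mathbb Z^n\setminus\{0\}$) of a perfect form $Q$, i.e. of a positive definite form for which these $v'$ span $Y$; a *facet* $F$ is a codimension-one face of a tile. Let $H=\{\ell=1\}$ be a hyperplane, $\ell$ linear with $\ell(v')>0$ for all $0\ne v\in\mathbb Q^n$, and $v''=v'/\ell(v')\in H$. A *regular triangulation* of $F$ is a set of simplicial cones whose intersection with $H$ is a regular triangulation of the polytope $F\cap H$. The space of *sharblies* on $r$ vectors is the $\mathbb Q$-vector space on symbols $[v_1,\dots,v_r]$, $0\neq v_i\in\mathbb Q^n$, modulo antisymmetry, $[v_1,\dots,v_r]=0$ if the $v_i$ do not span $\mathbb Q^n$, and $[av_1,v_2,\dots,v_r]=[v_1,\dots,v_r]$ for $a\in\mathbb Q^\times$. A *flipon* is a symbol $[v_1,\dots,v_d]$ such that some $(d-2)$-dimensional affine subspace of $Y$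 contains all the $v_i'$. Fix an orientation of the linear span of $F$; for a $(d-1)$-dimensional simplicial cone $s\subset F$ generated by $v_1',\dots,v_{d-1}'$ let $[s]=[v_1,\dots,v_{d-1}]$, with the $v_i$ ordered so that $v'_1,\dots,v_{d-1}'$ is positively oriented. Then for any two regular triangulations $\{w\}$, $\{y\}$ of $F$ there are finitely many (possibly no) flipons $[v_1^\alpha,\dots,v_d^\alpha]$ and integers $3\le p(\alpha)\le d$ such that $$\sum_\alpha\sum_{i=1}^{p(\alpha)}(-1)^i[v_1^\alpha,\dots,\widehat{v_i^\alpha},\dots,v_d^\alpha]=\sum[w]-\sum[y],$$ and for each $\alpha$ the points $(v_1^\alpha)'',\dots,(v_d^\alpha)''$ are distinct vertices of $F\cap H$, the first $p(\alpha)$ of which form a circuit. -/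

import Mathlib

open Module

/-! ## Polytopes, regular triangulations, circuits and flips -/

section Polytopes

variable {V : Type*} [AddCommGroup V] [Module ℝ V]

/-- A polytope is the convex hull of a finite set of points. Its vertices are its extreme points
`P.extremePoints ℝ`. -/
def IsPolytope (P : Set V) : Prop :=
  ∃ S : Finset V, P = convexHull ℝ (S : Set V)

/-- A triangulation of `P`, given by the vertex sets of its maximal simplices: each of them is an
affinely independent set of `dim P + 1` vertices of `P`, the simplices cover `P`, and two of them
meet in their (possibly empty) common face. -/
structure IsTriangulation (P : Set V) (T : Finset (Finset V)) : Prop where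
  vertices : ∀ σ ∈ T, (σ : Set V) ⊆ P.extremePoints ℝ
  indep : ∀ σ ∈ T, AffineIndependent ℝ (Subtype.val : {x : V // x ∈ σ} → V)
  card_eq : ∀ σ ∈ T, σ.card = finrank ℝ (vectorSpan ℝ P) + 1
  cover : (⋃ σ ∈ T, convexHull ℝ (σ : Set V)) = P
  inter : ∀ σ ∈ T, ∀ τ ∈ T, σ ≠ τ →
    convexHull ℝ (σ : Set V) ∩ convexHull ℝ (τ : Set V) = convexHull ℝ ((σ : Set V) ∩ (τ : Set V))

/-- A triangulation of `P` is regular (coherent) if there is a concave function on `P` that is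
affine on each maximal simplex and whose domains of linearity are exactly the maximal simplices. -/
def IsRegularTriangulation (P : Set V) (T : Finset (Finset V)) : Prop :=
  IsTriangulation P T ∧ ∃ g : V → ℝ, ConcaveOn ℝ P g ∧
    ∀ σ ∈ T, ∃ l : V →ᵃ[ℝ] ℝ, ∀ x ∈ P, g x = l x ↔ x ∈ convexHull ℝ (σ : Set V)

/-- A circuit is a minimal affinely dependent set of points. -/
def IsCircuit (Z : Set V) : Prop :=
  ¬ AffineIndependent ℝ (Subtype.val : {x : V // x ∈ Z} → V) ∧
    ∀ z ∈ Z, AffineIndependent ℝ (Subtype.val : {x : V // x ∈ Z \ {z}} → V)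

/-- `T₂` is obtained from the triangulation `T₁` of `P` by a flip along the circuit `Z`:
`T₁` induces one (`Tp`) of the two triangulations of the convex hull of `Z`, all maximal simplices
of `Tp` have the same link in `T₁`, and every maximal simplex `I ∪ F` of `T₁` with `I` in `Tp` is
removed while the simplices `J ∪ F` with `J` in the other triangulation `Tm` are added. -/
structure IsFlip [DecidableEq V] (P : Set V) (T₁ T₂ : Finset (Finset V)) (Z : Finset V) :
    Prop where
  circuit : IsCircuit (Z : Set V)
  vertices : (Z : Set V) ⊆ P.extremePoints ℝ
  exchange : ∃ Tp Tm : Finset (Finset V),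
    IsTriangulation (convexHull ℝ (Z : Set V)) Tp ∧
    IsTriangulation (convexHull ℝ (Z : Set V)) Tm ∧
    Tp ≠ Tm ∧
    (∀ I ∈ Tp, ∃ σ ∈ T₁, I ⊆ σ) ∧
    (∀ I ∈ Tp, ∀ I' ∈ Tp, ∀ F : Finset V, Disjoint F Z → I ∪ F ∈ T₁ → I' ∪ F ∈ T₁) ∧
    ∀ σ : Finset V, σ ∈ T₂ ↔
      (σ ∈ T₁ ∧ ∀ I ∈ Tp, ¬ I ⊆ σ) ∨
      (∃ J ∈ Tm, ∃ F : Finset V, Disjoint F Z ∧ σ = J ∪ F ∧ ∃ I ∈ Tp, I ∪ F ∈ T₁)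

/-- The simplices `Z - ω` (`ω ∈ Z`) that are faces of the triangulation `T`: the maximal simplices
of the triangulation that `T` induces on the convex hull of the circuit `Z`. -/
def circuitSimplices [DecidableEq V] (Z : Finset V) (T : Finset (Finset V)) :
    Finset (Finset V) :=
  (Z.image fun w => Z.erase w).filter fun σ => ∃ τ ∈ T, σ ⊆ τ

end Polytopes

/-! ## The antisymmetrized chain groups -/

section Chains

variable (V : Type*)

/-- The relations `(a_{π(1)}, …, a_{π(r)}) = sign(π) (a_1, …, a_r)`. -/
noncomputable def antisymRelations (r : ℕ) : Submodule ℤ ((Fin r → V) →₀ ℤ) :=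
  Submodule.span ℤ {x | ∃ (a : Fin r → V) (π : Equiv.Perm (Fin r)),
    x = Finsupp.single (a ∘ π) 1 - Finsupp.single a (Equiv.Perm.sign π : ℤ)}

/-- The group `A_r`: the free abelian group on symbols `(a_1, …, a_r)` modulo antisymmetry. -/
abbrev AntisymChains (r : ℕ) : Type _ :=
  ((Fin r → V) →₀ ℤ) ⧸ antisymRelations V r

variable {V}

/-- The symbol `(a_1, …, a_r)` in `A_r`. -/
noncomputable def chainSymbol {r : ℕ} (a : Fin r → V) : AntisymChains V r :=
  (antisymRelations V r).mkQ (Finsupp.single a 1)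

/-- `∑_{i=1}^{p} (-1)^i (v_1, …, v̂_i, …, v_{r+1})`; the index `i : Fin (r + 1)` counts from `0`. -/
noncomputable def partialBoundary {r : ℕ} (p : ℕ) (v : Fin (r + 1) → V) : AntisymChains V r :=
  ∑ i ∈ Finset.univ.filter (fun i : Fin (r + 1) => (i : ℕ) < p),
    (-1 : ℤ) ^ ((i : ℕ) + 1) • chainSymbol (v ∘ i.succAbove)

variable [AddCommGroup V] [Module ℝ V]

/-- The order `a_0, …, a_m` of the vertices of an `m`-simplex induces the orientation `o`: the
vectors `a_1 - a_0, …, a_m - a_0` form a positively oriented basis of the direction `W` of the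
affine hull. -/
def InducesOrientation {W : Submodule ℝ V} {m : ℕ} (o : Orientation ℝ W (Fin m))
    (a : Fin (m + 1) → V) : Prop :=
  ∃ b : Basis (Fin m) ℝ W, b.orientation = o ∧ ∀ i, (b i : V) = a i.succ - a 0

open Classical in
/-- The symbol `σ^*` of a simplex with vertex set `σ`: the symbol of the vertices of `σ` in any
order that induces the orientation `o`. Two such orders differ by an even permutation. -/
noncomputable def orientedSymbol {W : Submodule ℝ V} {m : ℕ} (o : Orientation ℝ W (Fin m))
    (σ : Finset V) : AntisymChains V (m + 1) :=
  if h : ∃ a : Fin (m + 1) → V, Set.range a = (σ : Set V) ∧ InducesOrientation o a then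
    chainSymbol h.choose
  else 0

end Chains

/-! ## Sharblies -/

section Sharblies

/-- Nonzero column vectors in `ℚ^n`. -/
abbrev QVec (n : ℕ) : Type := {v : Fin n → ℚ // v ≠ 0}

/-- The relations defining the sharblies on `r` vectors in `ℚ^n`: antisymmetry, vanishing of
symbols whose entries do not span `ℚ^n`, and invariance under scaling the first entry. -/
noncomputable def sharblyRelations (n r : ℕ) : Submodule ℚ ((Fin r → QVec n) →₀ ℚ) :=
  Submodule.span ℚ
    ({x | ∃ (v : Fin r → QVec n) (π : Equiv.Perm (Fin r)),
        x = Finsupp.single (v ∘ π) 1 - Finsupp.single v ((Equiv.Perm.sign π : ℤ) : ℚ)} ∪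
     {x | ∃ v : Fin r → QVec n,
        Submodule.span ℚ (Set.range fun i => (v i : Fin n → ℚ)) ≠ ⊤ ∧ x = Finsupp.single v 1} ∪
     {x | ∃ (v w : Fin r → QVec n) (c : ℚ), c ≠ 0 ∧
        (∀ i : Fin r, (i : ℕ) = 0 → (w i : Fin n → ℚ) = c • (v i : Fin n → ℚ)) ∧
        (∀ i : Fin r, (i : ℕ) ≠ 0 → w i = v i) ∧
        x = Finsupp.single v 1 - Finsupp.single w 1})

/-- The `ℚ`-vector space of sharblies on `r` vectors in `ℚ^n`, that is, `Sh_{r-n}`. -/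
abbrev Sharbly (n r : ℕ) : Type :=
  ((Fin r → QVec n) →₀ ℚ) ⧸ sharblyRelations n r

/-- The basic sharbly `[v_1, …, v_r]`. -/
noncomputable def basicSharbly {n r : ℕ} (v : Fin r → QVec n) : Sharbly n r :=
  (sharblyRelations n r).mkQ (Finsupp.single v 1)

/-- `∑_{i=1}^{p} (-1)^i [v_1, …, v̂_i, …, v_{r+1}]`; the index `i : Fin (r + 1)` counts
from `0`. -/
noncomputable def partialSharblyBoundary {n r : ℕ} (p : ℕ) (v : Fin (r + 1) → QVec n) :
    Sharbly n r :=
  ∑ i ∈ Finset.univ.filter (fun i : Fin (r + 1) => (i : ℕ) < p),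
    (-1 : ℤ) ^ ((i : ℕ) + 1) • basicSharbly (v ∘ i.succAbove)

end Sharblies

/-! ## The perfect Voronoi cellulation -/

section Voronoi

variable {n : ℕ}

/-- The space `Y` of real symmetric `n × n` matrices. -/
def symmetricMatrices (n : ℕ) : Submodule ℝ (Matrix (Fin n) (Fin n) ℝ) where
  carrier := {A | A.IsSymm}
  add_mem' := fun ha hb => ha.add hb
  zero_mem' := Matrix.isSymm_zero
  smul_mem' := fun c _ h => h.smul c

/-- The rank one matrix `v' = v vᵗ` of a nonzero rational vector. -/
def rankOne (v : QVec n) : Matrix (Fin n) (Fin n) ℝ :=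
  Matrix.vecMulVec (fun i => (v.1 i : ℝ)) (fun i => (v.1 i : ℝ))

/-- The closed convex cone generated by `S`. -/
def coneHull (S : Set (Matrix (Fin n) (Fin n) ℝ)) : Set (Matrix (Fin n) (Fin n) ℝ) :=
  (Submodule.span NNReal S : Set (Matrix (Fin n) (Fin n) ℝ))

/-- The value of the quadratic form `Q` at a vector. -/
def quadValue (Q : Matrix (Fin n) (Fin n) ℝ) (v : Fin n → ℚ) : ℝ :=
  (fun i => (v i : ℝ)) ⬝ᵥ Q.mulVec (fun i => (v i : ℝ))

/-- The vector has integer coordinates. -/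
def HasIntCoords (v : QVec n) : Prop :=
  ∀ i, ∃ a : ℤ, v.1 i = a

/-- The minimal vectors of `Q`: the nonzero integral vectors at which `Q` attains its minimum over
the nonzero integral vectors. -/
def minimalVectors (Q : Matrix (Fin n) (Fin n) ℝ) : Set (QVec n) :=
  {v | HasIntCoords v ∧ ∀ w : QVec n, HasIntCoords w → quadValue Q v.1 ≤ quadValue Q w.1}

/-- A perfect form is a positive definite form whose minimal vectors `v` are such that the
matrices `v'` span `Y`. -/
def IsPerfect (Q : Matrix (Fin n) (Fin n) ℝ) : Prop :=
  Q.PosDef ∧ Submodule.span ℝ (rankOne '' minimalVectors Q) = symmetricMatrices n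

/-- The tile (top-dimensional Voronoi cone) of a perfect form. -/
def voronoiTile (Q : Matrix (Fin n) (Fin n) ℝ) : Set (Matrix (Fin n) (Fin n) ℝ) :=
  coneHull (rankOne '' minimalVectors Q)

/-- A facet of a tile: a face, cut out by a supporting hyperplane, of codimension one in `Y`. -/
def IsTileFacet (F : Set (Matrix (Fin n) (Fin n) ℝ)) : Prop :=
  ∃ Q : Matrix (Fin n) (Fin n) ℝ, IsPerfect Q ∧
    ∃ φ : Matrix (Fin n) (Fin n) ℝ →ₗ[ℝ] ℝ,
      (∀ A ∈ voronoiTile Q, 0 ≤ φ A) ∧ F = {A ∈ voronoiTile Q | φ A = 0} ∧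
      finrank ℝ (Submodule.span ℝ F) + 1 = finrank ℝ (symmetricMatrices n)

/-- The hyperplane `H = {l = 1}` meets every ray generated by a rank one matrix `v'`, `v ∈ ℚ^n`;
as an example, `l` may be the trace. -/
def IsTransversal (l : Matrix (Fin n) (Fin n) ℝ →ₗ[ℝ] ℝ) : Prop :=
  ∀ v : QVec n, 0 < l (rankOne v)

/-- The point `v''` where the ray through `v'` meets the hyperplane `{l = 1}`. -/
noncomputable def sectionPoint (l : Matrix (Fin n) (Fin n) ℝ →ₗ[ℝ] ℝ) (v : QVec n) :
    Matrix (Fin n) (Fin n) ℝ :=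
  (l (rankOne v))⁻¹ • rankOne v

/-- A finite set of simplicial cones is a regular triangulation of the cone `X` if its
intersection with the hyperplane `{l = 1}` is a regular triangulation of the polytope
`X ∩ {l = 1}`; the cones are then the cones over the simplices of that triangulation. -/
def IsRegularConeTriangulation (l : Matrix (Fin n) (Fin n) ℝ →ₗ[ℝ] ℝ)
    (X : Set (Matrix (Fin n) (Fin n) ℝ)) (𝒯 : Finset (Set (Matrix (Fin n) (Fin n) ℝ))) : Prop :=
  ∃ T : Finset (Finset (Matrix (Fin n) (Fin n) ℝ)),
    IsRegularTriangulation (X ∩ {A | l A = 1}) T ∧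
    (𝒯 : Set (Set (Matrix (Fin n) (Fin n) ℝ))) =
      (fun σ : Finset (Matrix (Fin n) (Fin n) ℝ) => coneHull (σ : Set _)) '' T

open Classical in
/-- The basic sharbly `[s] = [v_1, …, v_k]` of a `k`-dimensional simplicial cone
`s = s(v_1, …, v_k)` with linear span `W`, the `v_i` being listed in an order for which
`v_1', …, v_k'` is a basis of `W` that is positive for the orientation `o`. -/
noncomputable def coneSharbly {k : ℕ} {W : Submodule ℝ (Matrix (Fin n) (Fin n) ℝ)}
    (o : Orientation ℝ W (Fin k)) (s : Set (Matrix (Fin n) (Fin n) ℝ)) : Sharbly n k :=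
  if h : ∃ v : Fin k → QVec n, s = coneHull (Set.range fun i => rankOne (v i)) ∧
      ∃ b : Basis (Fin k) ℝ W, b.orientation = o ∧
        ∀ i, (b i : Matrix (Fin n) (Fin n) ℝ) = rankOne (v i) then
    basicSharbly h.choose
  else 0

/-- A flipon: a basic sharbly `[v_1, …, v_d]` on `d` vectors such that some affine subspace of `Y`
of dimension `d - 2` contains all the `v_i'`. -/
def IsFlipon {d : ℕ} (v : Fin d → QVec n) : Prop :=
  ∃ E : AffineSubspace ℝ (Matrix (Fin n) (Fin n) ℝ),
    (E : Set (Matrix (Fin n) (Fin n) ℝ)) ⊆ symmetricMatrices n ∧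
    finrank ℝ E.direction + 2 = d ∧ ∀ i, rankOne (v i) ∈ E

end Voronoi

/-!
In homogeneous coordinates, the cone over a simplex `a` of `P` has Laplace transform
`|D(a)| / ∏ i, ξ(a_i)`, where `D` is the determinant. By additivity of the integral, the rational
function of `ξ` attached in this way to `∑ w* - ∑ y*` is zero. A chain of simplices with this
property is a combination of degenerate symbols, where `D(a) = 0`, and of boundaries of tuples of
distinct points: the part of the chain at a vertex `v` is detected by the coefficient of `1 / ξ(v)`,
which satisfies the same relation in one dimension less, so that `v` can be eliminated. Modulo
degenerate symbols, the boundary of a tuple of `n + 2` points that affinely spans `P` only retains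
the terms which omit a point of the unique circuit in the tuple.

For a flip, the two triangulations of a circuit consist of the simplices opposite to the points with
positive and with negative coefficient in its affine dependency, and by Cramer's rule these
coefficients are up to sign the determinants of the simplices in the boundary.
-/

section AntisymmetricChains

variable {X M : Type*} [AddCommGroup M] {r d : ℕ}

theorem chainSymbol_comp_perm (a : Fin r → X) (π : Equiv.Perm (Fin r)) :
    chainSymbol (a ∘ π) = Equiv.Perm.sign π • chainSymbol a := by
  rw [Units.smul_def, chainSymbol, chainSymbol, ← map_smul, Finsupp.smul_single, smul_eq_mul,
    mul_one]
  exact (Submodule.Quotient.eq _).2 (Submodule.subset_span ⟨a, π, rfl⟩)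

/-- The homomorphism out of the chain group determined by an antisymmetric function of the
vertices. -/
noncomputable def chainLift (φ : (Fin r → X) → M)
    (hφ : ∀ a (π : Equiv.Perm (Fin r)), φ (a ∘ π) = Equiv.Perm.sign π • φ a) :
    AntisymChains X r →ₗ[ℤ] M :=
  (antisymRelations X r).liftQ (Finsupp.linearCombination ℤ φ) <| by
    rw [antisymRelations, Submodule.span_le]
    rintro _ ⟨a, π, rfl⟩
    simp [hφ, Units.smul_def]

@[simp]
theorem chainLift_chainSymbol (φ : (Fin r → X) → M)
    (hφ : ∀ a (π : Equiv.Perm (Fin r)), φ (a ∘ π) = Equiv.Perm.sign π • φ a) (a : Fin r → X) :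
    chainLift φ hφ (chainSymbol a) = φ a := by
  simp [chainLift, chainSymbol]

theorem chainHom_ext {g h : AntisymChains X r →ₗ[ℤ] M}
    (hgh : ∀ a, g (chainSymbol a) = h (chainSymbol a)) : g = h := by
  refine Submodule.linearMap_qext _ (Finsupp.lhom_ext' fun a => LinearMap.ext_ring ?_)
  exact hgh a

/-- The chains with all vertices in `S`. -/
noncomputable def chainsOn (S : Set X) (r : ℕ) : Submodule ℤ (AntisymChains X r) :=
  Submodule.span ℤ (chainSymbol '' {a | ∀ i, a i ∈ S})

theorem chainSymbol_mem_chainsOn {S : Set X} {a : Fin r → X} (ha : ∀ i, a i ∈ S) :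
    chainSymbol a ∈ chainsOn S r :=
  Submodule.subset_span ⟨a, ha, rfl⟩

theorem chainsOn_le_iff {S : Set X} {N : Submodule ℤ (AntisymChains X r)} :
    chainsOn S r ≤ N ↔ ∀ a : Fin r → X, (∀ i, a i ∈ S) → chainSymbol a ∈ N := by
  rw [chainsOn, Submodule.span_le, Set.image_subset_iff]
  rfl

/-- The cone with apex `v` over a chain. -/
noncomputable def coneChain (v : X) : AntisymChains X d →ₗ[ℤ] AntisymChains X (d + 1) :=
  chainLift (fun a => chainSymbol (Fin.cons v a : Fin (d + 1) → X)) fun a π => by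
    have hcons : (Fin.cons v (a ∘ π) : Fin (d + 1) → X) =
        (Fin.cons v a : Fin (d + 1) → X) ∘ Equiv.Perm.decomposeFin.symm (0, π) := by
      funext i
      refine Fin.cases ?_ (fun j => ?_) i <;> simp [Equiv.Perm.decomposeFin_symm_apply_succ]
    rw [hcons, chainSymbol_comp_perm, Equiv.Perm.decomposeFin.symm_sign, if_pos rfl, one_mul]

@[simp]
theorem coneChain_chainSymbol (v : X) (a : Fin d → X) :
    coneChain v (chainSymbol a) = chainSymbol (Fin.cons v a : Fin (d + 1) → X) :=
  chainLift_chainSymbol _ _ a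

/-- The term of the boundary of a tuple `w` that omits the `i`-th vertex; the sign is the one for
vertices counted from `1`. -/
noncomputable def signedFace (w : Fin (r + 1) → X) (i : Fin (r + 1)) : AntisymChains X r :=
  (-1 : ℤ) ^ ((i : ℕ) + 1) • chainSymbol (w ∘ i.succAbove)

/-- The boundary of a tuple. -/
noncomputable def boundary (w : Fin (r + 1) → X) : AntisymChains X r :=
  ∑ i, signedFace w i

theorem cons_comp_succ_succAbove (v : X) (w : Fin (d + 1) → X) (i : Fin (d + 1)) :
    (Fin.cons v w : Fin (d + 2) → X) ∘ i.succ.succAbove =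
      (Fin.cons v (w ∘ i.succAbove) : Fin (d + 1) → X) := by
  funext j
  refine Fin.cases ?_ (fun j => ?_) j <;> simp

theorem signedFace_cons_zero (v : X) (w : Fin d → X) :
    signedFace (Fin.cons v w : Fin (d + 1) → X) 0 = -chainSymbol w := by
  simp [signedFace]

theorem signedFace_cons_succ (v : X) (w : Fin (d + 1) → X) (i : Fin (d + 1)) :
    signedFace (Fin.cons v w : Fin (d + 2) → X) i.succ = -coneChain v (signedFace w i) := by
  rw [signedFace, signedFace, cons_comp_succ_succAbove, map_smul, coneChain_chainSymbol,
    Fin.val_succ, pow_succ, mul_neg_one, neg_smul]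

theorem boundary_cons (v : X) (w : Fin (d + 1) → X) :
    boundary (Fin.cons v w : Fin (d + 2) → X) = -chainSymbol w - coneChain v (boundary w) := by
  simp only [boundary, Fin.sum_univ_succ (n := d + 1), signedFace_cons_zero, signedFace_cons_succ,
    map_sum, Finset.sum_neg_distrib, sub_eq_add_neg]

theorem exists_perm_succAbove (τ : Equiv.Perm (Fin (r + 1))) (i : Fin (r + 1)) :
    ∃ ρ : Equiv.Perm (Fin r), (∀ j, τ (i.succAbove j) = (τ i).succAbove (ρ j)) ∧
      Equiv.Perm.sign ρ = (-1) ^ ((i : ℕ) + (τ i : ℕ)) * Equiv.Perm.sign τ := by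
  let μ : Equiv.Perm (Fin (r + 1)) := (τ i).cycleRange * τ * i.cycleRange⁻¹
  obtain ⟨⟨k, ρ⟩, hμ⟩ := Equiv.Perm.decomposeFin.symm.surjective μ
  obtain rfl : k = 0 := by
    have h := congrArg (fun ν : Equiv.Perm (Fin (r + 1)) => ν 0) hμ
    simpa [μ, Equiv.Perm.inv_def] using h
  refine ⟨ρ, fun j => ?_, ?_⟩
  · have h := congrArg (fun ν : Equiv.Perm (Fin (r + 1)) => (τ i).cycleRange.symm (ν j.succ)) hμ
    simpa [μ, Equiv.Perm.inv_def, Equiv.Perm.decomposeFin_symm_apply_succ] using h.symm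
  · have h := congrArg Equiv.Perm.sign hμ
    rw [Equiv.Perm.decomposeFin.symm_sign, if_pos rfl, one_mul] at h
    rw [h, map_mul, map_mul, map_inv, Fin.sign_cycleRange, Fin.sign_cycleRange,
      Int.units_inv_eq_self, pow_add, mul_comm ((-1) ^ (i : ℕ)), mul_right_comm]

theorem signedFace_comp_perm (w : Fin (r + 1) → X) (τ : Equiv.Perm (Fin (r + 1)))
    (i : Fin (r + 1)) :
    signedFace (w ∘ τ) i = Equiv.Perm.sign τ • signedFace w (τ i) := by
  obtain ⟨ρ, hρ, hsign⟩ := exists_perm_succAbove τ i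
  have hface : (w ∘ τ) ∘ i.succAbove = (w ∘ (τ i).succAbove) ∘ ρ := by
    funext j; simp [hρ j]
  have hpow : ((-1 : ℤ) ^ (i : ℕ)) * (-1) ^ (i : ℕ) = 1 := by
    rw [← mul_pow, neg_one_mul, neg_neg, one_pow]
  rw [signedFace, signedFace, hface, chainSymbol_comp_perm, hsign, Units.smul_def, Units.smul_def,
    smul_smul, smul_smul]
  congr 1
  push_cast
  linear_combination (-(-1 : ℤ) ^ (τ i : ℕ) * (Equiv.Perm.sign τ : ℤ)) * hpow

theorem partialBoundary_eq_sum_signedFace (p : ℕ) (w : Fin (r + 1) → X) :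
    partialBoundary p w = ∑ i with (i : Fin (r + 1)).val < p, signedFace w i := rfl

theorem partialBoundary_comp_perm (w : Fin (r + 1) → X) {A : Finset (Fin (r + 1))}
    {τ : Equiv.Perm (Fin (r + 1))} {p : ℕ} (hτ : ∀ i, τ i ∈ A ↔ (i : ℕ) < p) :
    partialBoundary p (w ∘ τ) = Equiv.Perm.sign τ • ∑ i ∈ A, signedFace w i := by
  rw [partialBoundary_eq_sum_signedFace, Finset.smul_sum]
  exact Finset.sum_equiv τ (by simp [hτ]) fun i _ => signedFace_comp_perm w τ i

theorem exists_perm_mem_iff_lt_card (A : Finset (Fin (r + 1))) :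
    ∃ τ : Equiv.Perm (Fin (r + 1)), ∀ i, τ i ∈ A ↔ (i : ℕ) < A.card := by
  classical
  have hcard : Fintype.card {i : Fin (r + 1) // (i : ℕ) < A.card} = Fintype.card {i // i ∈ A} := by
    rw [Fintype.card_coe, Fintype.card_subtype]
    exact (Fin.card_filter_val_lt ..).trans (min_eq_right (by simpa using A.card_le_univ))
  let e := Fintype.equivOfCardEq hcard
  exact ⟨e.extendSubtype, fun i => ⟨not_imp_not.1 (e.extendSubtype_not_mem i),
    e.extendSubtype_mem i⟩⟩

end AntisymmetricChains

section TopForms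

variable {W : Type*} [AddCommGroup W] [Module ℝ W] {d : ℕ} {U : Submodule ℝ W}

/-- An alternating `d`-form `D` on `W` that comes from `W ⧸ U` and behaves there as a form of top
degree does: its wedge product with every linear form vanishes. -/
structure IsTopForm (U : Submodule ℝ W) (D : W [⋀^Fin d]→ₗ[ℝ] ℝ) : Prop where
  map_eq_zero : ∀ (w : Fin d → W) (i : Fin d), w i ∈ U → D w = 0
  wedge_eq_zero : ∀ ξ : W →ₗ[ℝ] ℝ, U ≤ LinearMap.ker ξ → ∀ w : Fin (d + 1) → W,
    ∑ i : Fin (d + 1), (-1 : ℝ) ^ (i : ℕ) * D (w ∘ i.succAbove) * ξ (w i) = 0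

theorem IsTopForm.exists_map_eq_smul_map_update {D : W [⋀^Fin d]→ₗ[ℝ] ℝ} (hD : IsTopForm U D)
    {y : W} {w : Fin d → W} {i : Fin d} (hi : w i ∈ U ⊔ Submodule.span ℝ {y}) :
    ∃ t : ℝ, D w = t * D (Function.update w i y) := by
  obtain ⟨u, hu, z, hz, hsum⟩ := Submodule.mem_sup.1 hi
  obtain ⟨t, rfl⟩ := Submodule.mem_span_singleton.1 hz
  refine ⟨t, ?_⟩
  rw [← Function.update_eq_self i w, ← hsum, D.map_update_add, D.map_update_smul,
    hD.map_eq_zero _ i (by simpa using hu), zero_add, smul_eq_mul, Function.update_idem]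

theorem IsTopForm.map_eq_zero_of_mem_sup {D : W [⋀^Fin d]→ₗ[ℝ] ℝ} (hD : IsTopForm U D) {y : W}
    {w : Fin d → W} {i j : Fin d} (hij : i ≠ j) (hi : w i ∈ U ⊔ Submodule.span ℝ {y})
    (hj : w j ∈ U ⊔ Submodule.span ℝ {y}) : D w = 0 := by
  obtain ⟨t, ht⟩ := hD.exists_map_eq_smul_map_update hi
  obtain ⟨s, hs⟩ := hD.exists_map_eq_smul_map_update (w := Function.update w i y) (i := j)
    (by rwa [Function.update_of_ne hij.symm])
  rw [ht, hs, D.map_eq_zero_of_eq _ (by simp [Function.update_of_ne hij]) hij, mul_zero, mul_zero]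

theorem IsTopForm.curryLeft {D : W [⋀^Fin (d + 1)]→ₗ[ℝ] ℝ} (hD : IsTopForm U D) (v : W) :
    IsTopForm (U ⊔ Submodule.span ℝ {v}) (D.curryLeft v) where
  map_eq_zero w i hi :=
    hD.map_eq_zero_of_mem_sup (i := 0) (j := i.succ) (Fin.succ_ne_zero i).symm
      (Submodule.mem_sup_right (Submodule.mem_span_singleton_self v)) hi
  wedge_eq_zero ξ hξ w := by
    have hv : ξ v = 0 := hξ (Submodule.mem_sup_right (Submodule.mem_span_singleton_self v))
    have hw := hD.wedge_eq_zero ξ (le_sup_left.trans hξ) (Matrix.vecCons v w)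
    have hcons : ∀ i : Fin (d + 1), Matrix.vecCons v w ∘ i.succ.succAbove =
      Matrix.vecCons v (w ∘ i.succAbove) := cons_comp_succ_succAbove v w
    rw [Fin.sum_univ_succ] at hw
    simp only [Matrix.cons_val_zero, hv, mul_zero, zero_add, hcons, Matrix.cons_val_succ,
      Fin.val_succ, pow_succ, ← AlternatingMap.curryLeft_apply_apply] at hw
    simpa [Finset.sum_neg_distrib] using hw

/-- This is Cramer's rule: the left-hand side is alternating in the `d + 1` vectors `w`. -/
theorem sum_det_succAbove_smul_eq_zero (w : Fin (d + 1) → Fin d → ℝ) :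
    ∑ i : Fin (d + 1), ((-1 : ℝ) ^ (i : ℕ) * Matrix.detRowAlternating (w ∘ i.succAbove)) • w i =
      0 := by
  let g : (Fin d → ℝ) →ₗ[ℝ] (Fin d → ℝ) [⋀^Fin d]→ₗ[ℝ] (Fin d → ℝ) :=
    { toFun := fun x =>
        (LinearMap.toSpanSingleton ℝ (Fin d → ℝ) x).compAlternatingMap Matrix.detRowAlternating
      map_add' := fun x y => by ext; simp [mul_add]
      map_smul' := fun x y => by ext; simp; ring }
  have hg := (AlternatingMap.alternatizeUncurryFin g).map_linearDependent w fun h => by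
    simpa using h.fintype_card_le_finrank
  rw [AlternatingMap.alternatizeUncurryFin_apply] at hg
  rw [← hg]
  refine Finset.sum_congr rfl fun i _ => ?_
  change _ = (-1 : ℤ) ^ (i : ℕ) • (Matrix.detRowAlternating (i.removeNth w) • w i)
  rw [← Int.cast_smul_eq_zsmul ℝ, smul_smul]
  push_cast
  rfl

theorem isTopForm_det : IsTopForm ⊥ (Matrix.detRowAlternating : (Fin d → ℝ) [⋀^Fin d]→ₗ[ℝ] ℝ) where
  map_eq_zero _ i hi := AlternatingMap.map_coord_zero _ i ((Submodule.mem_bot ℝ).1 hi)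
  wedge_eq_zero ξ _ w := by
    simpa [map_sum] using congrArg ξ (sum_det_succAbove_smul_eq_zero w)

end TopForms

section SimplexRatio

theorem comp_cons {X W : Type*} {d : ℕ} (f : X → W) (v : X) (a : Fin d → X) :
    f ∘ (Fin.cons v a : Fin (d + 1) → X) = Matrix.vecCons (f v) (f ∘ a) := by
  funext i
  refine Fin.cases ?_ (fun j => ?_) i <;> simp

variable {X W : Type*} [AddCommGroup W] [Module ℝ W] {d : ℕ} {f : X → W}

/-- The Laplace transform at `ξ` of the cone over the simplex `a`, which is `D(a) / ∏ i, ξ(a_i)`,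
extended linearly to chains; the vertices are placed in `W` by `f`. -/
noncomputable def simplexRatio (f : X → W) (D : W [⋀^Fin d]→ₗ[ℝ] ℝ) (ξ : W →ₗ[ℝ] ℝ) :
    AntisymChains X d →ₗ[ℤ] ℝ :=
  chainLift (fun a => D (f ∘ a) / ∏ i, ξ (f (a i))) fun a π => by
    rw [← Function.comp_assoc, D.map_perm, ← Equiv.prod_comp π fun i => ξ (f (a i)),
      Units.smul_def, Units.smul_def, smul_div_assoc]
    rfl

@[simp]
theorem simplexRatio_chainSymbol (D : W [⋀^Fin d]→ₗ[ℝ] ℝ) (ξ : W →ₗ[ℝ] ℝ) (a : Fin d → X) :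
    simplexRatio f D ξ (chainSymbol a) = D (f ∘ a) / ∏ i, ξ (f (a i)) :=
  chainLift_chainSymbol _ _ a

theorem simplexRatio_coneChain (D : W [⋀^Fin (d + 1)]→ₗ[ℝ] ℝ) (ξ : W →ₗ[ℝ] ℝ) (v : X)
    (c : AntisymChains X d) :
    simplexRatio f D ξ (coneChain v c) =
      (ξ (f v))⁻¹ * simplexRatio f (D.curryLeft (f v)) ξ c := by
  suffices h : simplexRatio f D ξ ∘ₗ coneChain v =
      (ξ (f v))⁻¹ • simplexRatio f (D.curryLeft (f v)) ξ by
    simpa using LinearMap.congr_fun h c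
  refine chainHom_ext fun a => ?_
  rw [LinearMap.comp_apply, coneChain_chainSymbol, simplexRatio_chainSymbol, comp_cons,
    LinearMap.smul_apply, simplexRatio_chainSymbol, AlternatingMap.curryLeft_apply_apply,
    Fin.prod_univ_succ, smul_eq_mul, ← div_eq_inv_mul, div_div, mul_comm]
  simp only [Fin.cons_zero, Fin.cons_succ]

theorem simplexRatio_boundary {U : Submodule ℝ W} {D : W [⋀^Fin d]→ₗ[ℝ] ℝ} (hD : IsTopForm U D)
    {ξ : W →ₗ[ℝ] ℝ} (hU : U ≤ LinearMap.ker ξ) {w : Fin (d + 1) → X}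
    (hw : ∀ i, ξ (f (w i)) ≠ 0) : simplexRatio f D ξ (boundary w) = 0 := by
  have hface : ∀ i : Fin (d + 1), simplexRatio f D ξ (signedFace w i) =
      -(((-1 : ℝ) ^ (i : ℕ) * D ((f ∘ w) ∘ i.succAbove) * ξ ((f ∘ w) i)) / ∏ j, ξ (f (w j))) := by
    intro i
    have hprod : ∏ j, ξ (f ((w ∘ i.succAbove) j)) ≠ 0 :=
      Finset.prod_ne_zero_iff.2 fun j _ => hw _
    have hi := hw i
    rw [signedFace, map_smul, simplexRatio_chainSymbol, zsmul_eq_mul,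
      Fin.prod_univ_succAbove _ i]
    simp only [Function.comp_apply] at hprod ⊢
    push_cast
    field_simp
    rw [pow_succ, mul_neg_one, neg_mul]
    rfl
  rw [boundary, map_sum, Finset.sum_congr rfl fun i _ => hface i, Finset.sum_neg_distrib,
    ← Finset.sum_div, hD.wedge_eq_zero ξ hU, zero_div, neg_zero]

end SimplexRatio

section SimplexRelations

variable {X W : Type*} [AddCommGroup W] [Module ℝ W] {d : ℕ} {f : X → W} {S S₁ : Set X}
  {U : Submodule ℝ W}

/-- The relations between simplices with vertices in `S`, generated by the simplices on which `D`
vanishes and by the boundaries of tuples of distinct points. -/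
noncomputable def simplexRelations (S : Set X) (f : X → W) (D : W [⋀^Fin d]→ₗ[ℝ] ℝ) :
    Submodule ℤ (AntisymChains X d) :=
  Submodule.span ℤ
    (chainSymbol '' {a | (∀ i, a i ∈ S) ∧ D (f ∘ a) = 0} ∪
      boundary '' {w | (∀ i, w i ∈ S) ∧ Function.Injective w})

theorem chainSymbol_mem_simplexRelations {D : W [⋀^Fin d]→ₗ[ℝ] ℝ} {a : Fin d → X}
    (ha : ∀ i, a i ∈ S) (h : D (f ∘ a) = 0) : chainSymbol a ∈ simplexRelations S f D :=
  Submodule.subset_span (Or.inl ⟨a, ⟨ha, h⟩, rfl⟩)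

theorem boundary_mem_simplexRelations {D : W [⋀^Fin d]→ₗ[ℝ] ℝ} {w : Fin (d + 1) → X}
    (hw : ∀ i, w i ∈ S) (hinj : Function.Injective w) : boundary w ∈ simplexRelations S f D :=
  Submodule.subset_span (Or.inr ⟨w, ⟨hw, hinj⟩, rfl⟩)

theorem simplexRelations_le_iff {D : W [⋀^Fin d]→ₗ[ℝ] ℝ} {N : Submodule ℤ (AntisymChains X d)} :
    simplexRelations S f D ≤ N ↔
      (∀ a : Fin d → X, (∀ i, a i ∈ S) → D (f ∘ a) = 0 → chainSymbol a ∈ N) ∧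
      ∀ w : Fin (d + 1) → X, (∀ i, w i ∈ S) → Function.Injective w → boundary w ∈ N := by
  rw [simplexRelations, Submodule.span_le, Set.union_subset_iff, Set.image_subset_iff,
    Set.image_subset_iff]
  exact and_congr ⟨fun h a ha h0 => h ⟨ha, h0⟩, fun h a ha => h a ha.1 ha.2⟩
    ⟨fun h w hw hi => h ⟨hw, hi⟩, fun h w hw => h w hw.1 hw.2⟩

theorem simplexRelations_mono (h : S₁ ⊆ S) (D : W [⋀^Fin d]→ₗ[ℝ] ℝ) :
    simplexRelations S₁ f D ≤ simplexRelations S f D :=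
  simplexRelations_le_iff.2
    ⟨fun _ ha h0 => chainSymbol_mem_simplexRelations (fun i => h (ha i)) h0,
      fun _ hw hi => boundary_mem_simplexRelations (fun i => h (hw i)) hi⟩

theorem simplexRatio_eq_zero_of_mem_simplexRelations {D : W [⋀^Fin d]→ₗ[ℝ] ℝ}
    (hD : IsTopForm U D) {ξ : W →ₗ[ℝ] ℝ} (hU : U ≤ LinearMap.ker ξ)
    (hξ : ∀ s ∈ S, ξ (f s) ≠ 0) {c : AntisymChains X d} (hc : c ∈ simplexRelations S f D) :
    simplexRatio f D ξ c = 0 := by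
  suffices h : simplexRelations S f D ≤ LinearMap.ker (simplexRatio f D ξ) from h hc
  refine simplexRelations_le_iff.2 ⟨fun a _ h0 => ?_, fun w hw _ => ?_⟩
  · rw [LinearMap.mem_ker, simplexRatio_chainSymbol, h0, zero_div]
  · exact simplexRatio_boundary hD hU fun i => hξ _ (hw i)

theorem cons_mem {v : X} (hv : v ∈ S) {a : Fin d → X} (ha : ∀ i, a i ∈ S) (i : Fin (d + 1)) :
    (Fin.cons v a : Fin (d + 1) → X) i ∈ S := by
  refine Fin.cases ?_ (fun j => ?_) i
  · simpa using hv
  · simpa using ha j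

theorem map_coneChain_simplexRelations_le (h : S₁ ⊆ S) {v : X} (hv : v ∈ S) (hv₁ : v ∉ S₁)
    (D : W [⋀^Fin (d + 1)]→ₗ[ℝ] ℝ) :
    (simplexRelations S₁ f (D.curryLeft (f v))).map (coneChain v) ≤
      simplexRelations S f D ⊔ chainsOn S₁ (d + 1) := by
  refine Submodule.map_le_iff_le_comap.2 (simplexRelations_le_iff.2
    ⟨fun a ha h0 => ?_, fun w hw hinj => ?_⟩)
  · refine Submodule.mem_sup_left ?_
    rw [coneChain_chainSymbol]
    refine chainSymbol_mem_simplexRelations (cons_mem hv fun i => h (ha i)) ?_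
    rwa [comp_cons, ← AlternatingMap.curryLeft_apply_apply]
  · have hcons : boundary (Fin.cons v w : Fin (d + 2) → X) ∈ simplexRelations S f D :=
      boundary_mem_simplexRelations (cons_mem hv fun i => h (hw i))
        (Fin.cons_injective_iff.2 ⟨fun ⟨j, hj⟩ => hv₁ (hj ▸ hw j), hinj⟩)
    have hw' := chainSymbol_mem_chainsOn hw
    rw [Submodule.mem_comap, show coneChain v (boundary w) =
      -boundary (Fin.cons v w : Fin (d + 2) → X) + -chainSymbol w by rw [boundary_cons]; abel]
    exact Submodule.add_mem_sup (neg_mem hcons) (neg_mem hw')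

theorem chainSymbol_cons_sub_mem_simplexRelations {D : W [⋀^Fin (d + 1)]→ₗ[ℝ] ℝ}
    (hD : IsTopForm U D) {v s : X} (hv : v ∈ S) (hs : s ∈ S)
    (hsv : f s ∈ U ⊔ Submodule.span ℝ {f v}) {u : Fin d → X} (hu : ∀ i, u i ∈ S)
    (huv : ∀ i, f (u i) ∉ U ⊔ Submodule.span ℝ {f v}) (hinj : Function.Injective u) :
    chainSymbol (Fin.cons s u : Fin (d + 1) → X) - chainSymbol (Fin.cons v u : Fin (d + 1) → X) ∈
      simplexRelations S f D := by
  have hvv : f v ∈ U ⊔ Submodule.span ℝ {f v} :=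
    Submodule.mem_sup_right (Submodule.mem_span_singleton_self _)
  rcases eq_or_ne s v with rfl | hne
  · simp
  have hcons : boundary (Fin.cons v (Fin.cons s u : Fin (d + 1) → X) : Fin (d + 2) → X) ∈
      simplexRelations S f D := by
    refine boundary_mem_simplexRelations (cons_mem hv (cons_mem hs hu))
      (Fin.cons_injective_iff.2 ⟨?_, Fin.cons_injective_iff.2 ⟨?_, hinj⟩⟩)
    · rintro ⟨j, hj⟩
      refine Fin.cases (fun h => hne (by simpa using h)) (fun j h => huv j ?_) j hj
      rw [Fin.cons_succ] at h
      rwa [h]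
    · rintro ⟨j, rfl⟩
      exact huv j hsv
  have hdeg : ∑ i : Fin d, coneChain v (signedFace (Fin.cons s u : Fin (d + 1) → X) i.succ) ∈
      simplexRelations S f D := by
    refine Submodule.sum_mem _ fun i _ => ?_
    obtain ⟨e, rfl⟩ : ∃ e, d = e + 1 := Nat.exists_eq_add_one.2 i.pos
    rw [signedFace, map_smul, coneChain_chainSymbol, cons_comp_succ_succAbove]
    refine Submodule.smul_mem _ _ (chainSymbol_mem_simplexRelations
      (cons_mem hv (cons_mem hs fun j => hu _)) ?_)
    exact hD.map_eq_zero_of_mem_sup (i := 0) (j := 1) (y := f v) (by simp) hvv hsv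
  convert neg_mem (add_mem hcons hdeg) using 1
  rw [boundary_cons, boundary, Fin.sum_univ_succ, signedFace_cons_zero, map_add, map_sum, map_neg,
    coneChain_chainSymbol]
  abel

theorem chainSymbol_cons_mem_sup {D : W [⋀^Fin (d + 1)]→ₗ[ℝ] ℝ} (hD : IsTopForm U D) {v s : X}
    (hv : v ∈ S) (hs : s ∈ S) (hsv : f s ∈ U ⊔ Submodule.span ℝ {f v}) {u : Fin d → X}
    (hu : ∀ i, u i ∈ S) :
    chainSymbol (Fin.cons s u : Fin (d + 1) → X) ∈ simplexRelations S f D ⊔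
      (chainsOn {x ∈ S | f x ∉ U ⊔ Submodule.span ℝ {f v}} d).map (coneChain v) := by
  by_cases h0 : D (f ∘ (Fin.cons s u : Fin (d + 1) → X)) = 0
  · exact Submodule.mem_sup_left (chainSymbol_mem_simplexRelations (cons_mem hs hu) h0)
  have huv : ∀ i, f (u i) ∉ U ⊔ Submodule.span ℝ {f v} := fun i hi =>
    h0 (hD.map_eq_zero_of_mem_sup (i := 0) (j := i.succ) (Fin.succ_ne_zero i).symm hsv hi)
  have hinj : Function.Injective u := fun i j hij => by
    by_contra hne
    exact h0 (D.map_eq_zero_of_eq (i := i.succ) (j := j.succ) _ (by simp [hij]) (by simpa))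
  rw [← sub_add_cancel (chainSymbol _) (chainSymbol (Fin.cons v u : Fin (d + 1) → X))]
  refine Submodule.add_mem_sup (chainSymbol_cons_sub_mem_simplexRelations hD hv hs hsv hu huv hinj)
    ⟨chainSymbol u, chainSymbol_mem_chainsOn fun i => ⟨hu i, huv i⟩, coneChain_chainSymbol v u⟩

/-- Contraction of a vertex `v`: a simplex with a vertex on the line of `v` may be given the
vertex `v` instead. -/
theorem chainsOn_le_sup {D : W [⋀^Fin (d + 1)]→ₗ[ℝ] ℝ} (hD : IsTopForm U D) {v : X} (hv : v ∈ S) :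
    chainsOn S (d + 1) ≤ chainsOn {x ∈ S | f x ∉ U ⊔ Submodule.span ℝ {f v}} (d + 1) ⊔
      (simplexRelations S f D ⊔
        (chainsOn {x ∈ S | f x ∉ U ⊔ Submodule.span ℝ {f v}} d).map (coneChain v)) := by
  refine chainsOn_le_iff.2 fun a ha => ?_
  by_cases hall : ∀ i, f (a i) ∉ U ⊔ Submodule.span ℝ {f v}
  · exact Submodule.mem_sup_left (chainSymbol_mem_chainsOn fun i => ⟨ha i, hall i⟩)
  push Not at hall
  obtain ⟨i, hi⟩ := hall
  have hswap : (Fin.cons (a i) (fun j => a (Equiv.swap 0 i j.succ)) : Fin (d + 1) → X) =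
      a ∘ Equiv.swap 0 i := by
    funext j
    refine Fin.cases ?_ (fun j => ?_) j <;> simp
  have hmem := chainSymbol_cons_mem_sup hD hv (ha i) hi
    (u := fun j => a (Equiv.swap 0 i j.succ)) fun j => ha _
  rw [hswap, chainSymbol_comp_perm] at hmem
  refine Submodule.mem_sup_right ?_
  rcases Int.units_eq_one_or (Equiv.Perm.sign (Equiv.swap 0 i)) with h | h
  · rwa [h, one_smul] at hmem
  · rwa [h, Units.neg_smul, one_smul, neg_mem_iff] at hmem

end SimplexRelations

section Kernel

open Filter Topology

variable {X W : Type*} [AddCommGroup W] [Module ℝ W] {d : ℕ} {f : X → W} {U : Submodule ℝ W}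

/-- The function `R` of a linear form `ξ` vanishes for all `ξ` that are zero on `U` and nonzero on
a suitable finite set of vectors outside `U`. -/
def VanishesGenerically (U : Submodule ℝ W) (R : (W →ₗ[ℝ] ℝ) → ℝ) : Prop :=
  ∃ B : Finset W, (∀ b ∈ B, b ∉ U) ∧
    ∀ ξ : W →ₗ[ℝ] ℝ, U ≤ LinearMap.ker ξ → (∀ b ∈ B, ξ b ≠ 0) → R ξ = 0

theorem exists_functional_forall_ne_zero {B : Finset W} (hB : ∀ b ∈ B, b ∉ U) :
    ∃ ξ : W →ₗ[ℝ] ℝ, U ≤ LinearMap.ker ξ ∧ ∀ b ∈ B, ξ b ≠ 0 := by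
  obtain ⟨ξ, hξ⟩ := Module.exists_dual_forall_apply_ne_zero (K := ℝ)
    (fun b : B => U.mkQ b) (fun b => by simpa using hB b b.2)
  exact ⟨ξ ∘ₗ U.mkQ, (U.ker_mkQ).ge.trans (LinearMap.ker_le_ker_comp _ _),
    fun b hb => hξ ⟨b, hb⟩⟩

theorem VanishesGenerically.of_sub_mem_simplexRelations {D : W [⋀^Fin d]→ₗ[ℝ] ℝ}
    (hD : IsTopForm U D) {S : Finset X} (hS : ∀ s ∈ S, f s ∉ U) {c c' : AntisymChains X d}
    (hc : VanishesGenerically U fun ξ => simplexRatio f D ξ c)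
    (hsub : c - c' ∈ simplexRelations (S : Set X) f D) :
    VanishesGenerically U fun ξ => simplexRatio f D ξ c' := by
  classical
  obtain ⟨B, hBU, hB⟩ := hc
  refine ⟨B ∪ S.image f, ?_, fun ξ hU hξ => ?_⟩
  · simpa only [Finset.mem_union, Finset.forall_mem_image, or_imp, forall_and] using ⟨hBU, hS⟩
  · have hsub0 := simplexRatio_eq_zero_of_mem_simplexRelations hD hU
      (fun s hs => hξ _ (Finset.mem_union_right _ (Finset.mem_image_of_mem f hs))) hsub
    have hc0 : simplexRatio f D ξ c = 0 := hB ξ hU fun b hb => hξ b (Finset.mem_union_left _ hb)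
    rwa [map_sub, hc0, zero_sub, neg_eq_zero] at hsub0

theorem tendsto_add_smul_apply (ξ η : W →ₗ[ℝ] ℝ) (b : W) :
    Tendsto (fun t : ℝ => (ξ + t • η) b) (𝓝[≠] 0) (𝓝 (ξ b)) := by
  have h : Continuous fun t : ℝ => (ξ + t • η) b := by
    simp only [LinearMap.add_apply, LinearMap.smul_apply, smul_eq_mul]
    fun_prop
  simpa using (h.tendsto 0).mono_left nhdsWithin_le_nhds

theorem eventually_add_smul_apply_ne_zero {ξ η : W →ₗ[ℝ] ℝ} {b : W} (h : ξ b ≠ 0 ∨ η b ≠ 0) :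
    ∀ᶠ t in 𝓝[≠] (0 : ℝ), (ξ + t • η) b ≠ 0 := by
  by_cases hξ : ξ b = 0
  · filter_upwards [self_mem_nhdsWithin] with t ht
    simpa [hξ] using ⟨ht, h.resolve_left (not_not.2 hξ)⟩
  · exact (tendsto_add_smul_apply ξ η b).eventually_ne hξ

theorem tendsto_simplexRatio {S : Set X} (D : W [⋀^Fin d]→ₗ[ℝ] ℝ) {ξ η : W →ₗ[ℝ] ℝ}
    (hξ : ∀ s ∈ S, ξ (f s) ≠ 0) {c : AntisymChains X d} (hc : c ∈ chainsOn S d) :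
    Tendsto (fun t : ℝ => simplexRatio f D (ξ + t • η) c) (𝓝[≠] 0)
      (𝓝 (simplexRatio f D ξ c)) := by
  refine Submodule.span_induction ?_ (by simp) (fun _ _ _ _ hx hy => by simpa using hx.add hy)
    (fun k _ _ hx => by simpa using hx.const_mul (k : ℝ)) hc
  rintro _ ⟨a, ha, rfl⟩
  simp only [simplexRatio_chainSymbol]
  exact tendsto_const_nhds.div (tendsto_finsetProd _ fun i _ => tendsto_add_smul_apply ξ η _)
    (Finset.prod_ne_zero_iff.2 fun i _ => hξ _ (ha i))

theorem exists_functional_apply_eq_one {v : W} (hv : v ∉ U) :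
    ∃ η : W →ₗ[ℝ] ℝ, U ≤ LinearMap.ker η ∧ η v = 1 := by
  obtain ⟨η, hηv, hηU⟩ := Submodule.exists_le_ker_of_notMem hv
  exact ⟨(η v)⁻¹ • η, fun u hu => by simp [LinearMap.mem_ker.1 (hηU hu)], by simp [hηv]⟩

theorem apply_ne_zero_of_mem_sup_span {η : W →ₗ[ℝ] ℝ} (hU : U ≤ LinearMap.ker η) {v b : W}
    (hv : η v ≠ 0) (hb : b ∈ U ⊔ Submodule.span ℝ {v}) (hbU : b ∉ U) : η b ≠ 0 := by
  obtain ⟨u, hu, y, hy, rfl⟩ := Submodule.mem_sup.1 hb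
  obtain ⟨r, rfl⟩ := Submodule.mem_span_singleton.1 hy
  have hr : r ≠ 0 := by
    rintro rfl
    exact hbU (by simpa using hu)
  simpa [LinearMap.mem_ker.1 (hU hu), hv] using hr

/-- The coefficient of `1 / ξ(v)` is recovered by letting `ξ` tend to a form that vanishes
on `v`. -/
theorem VanishesGenerically.contract {D : W [⋀^Fin (d + 1)]→ₗ[ℝ] ℝ} {v : X} (hv : f v ∉ U)
    {S : Finset X} (hS : ∀ s ∈ S, f s ∉ U ⊔ Submodule.span ℝ {f v})
    {c₀ : AntisymChains X (d + 1)} (hc₀ : c₀ ∈ chainsOn (S : Set X) (d + 1))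
    {c₁ : AntisymChains X d} (hc₁ : c₁ ∈ chainsOn (S : Set X) d)
    (h : VanishesGenerically U fun ξ => simplexRatio f D ξ (c₀ + coneChain v c₁)) :
    VanishesGenerically (U ⊔ Submodule.span ℝ {f v}) fun ξ =>
      simplexRatio f (D.curryLeft (f v)) ξ c₁ := by
  classical
  obtain ⟨B, hBU, hB⟩ := h
  obtain ⟨η, hηU, hηv⟩ := exists_functional_apply_eq_one hv
  refine ⟨{b ∈ B | b ∉ U ⊔ Submodule.span ℝ {f v}} ∪ S.image f, ?_, fun ξ hξU hξ => ?_⟩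
  · simpa only [Finset.mem_union, Finset.forall_mem_image, or_imp, forall_and, Finset.mem_filter,
      and_imp] using ⟨fun _ _ hb => hb, hS⟩
  have hξv : ξ (f v) = 0 := hξU (Submodule.mem_sup_right (Submodule.mem_span_singleton_self _))
  have hξS : ∀ s ∈ (S : Set X), ξ (f s) ≠ 0 := fun s hs =>
    hξ _ (Finset.mem_union_right _ (Finset.mem_image_of_mem f hs))
  have hgen : ∀ᶠ t in 𝓝[≠] (0 : ℝ), ∀ b ∈ B, (ξ + t • η) b ≠ 0 := by
    refine (Filter.eventually_all_finset B).2 fun b hb => eventually_add_smul_apply_ne_zero ?_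
    by_cases hbv : b ∈ U ⊔ Submodule.span ℝ {f v}
    · exact Or.inr (apply_ne_zero_of_mem_sup_span hηU (by simp [hηv]) hbv (hBU b hb))
    · exact Or.inl (hξ b (Finset.mem_union_left _ (Finset.mem_filter.2 ⟨hb, hbv⟩)))
  have hlim := ((tendsto_id.mono_left nhdsWithin_le_nhds).mul
    (tendsto_simplexRatio (η := η) D hξS hc₀)).add
    (tendsto_simplexRatio (η := η) (D.curryLeft (f v)) hξS hc₁)
  rw [zero_mul, zero_add] at hlim
  refine tendsto_nhds_unique hlim (tendsto_const_nhds.congr' ?_)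
  filter_upwards [hgen, self_mem_nhdsWithin] with t ht ht0
  have hU : U ≤ LinearMap.ker (ξ + t • η) := fun u hu => by
    simp [LinearMap.mem_ker.1 (hξU (Submodule.mem_sup_left hu)), LinearMap.mem_ker.1 (hηU hu)]
  have hzero : simplexRatio f D (ξ + t • η) (c₀ + coneChain v c₁) = 0 := hB _ hU ht
  rw [map_add, simplexRatio_coneChain, show (ξ + t • η) (f v) = t by simp [hξv, hηv]] at hzero
  rw [id, ← mul_inv_cancel_left₀ ht0 (simplexRatio f (D.curryLeft (f v)) (ξ + t • η) c₁),
    ← mul_add, hzero, mul_zero]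

theorem mem_simplexRelations_of_simplexRatio_zero {S : Set X} {D : W [⋀^Fin 0]→ₗ[ℝ] ℝ}
    {ξ : W →ₗ[ℝ] ℝ} {c : AntisymChains X 0} (hc : simplexRatio f D ξ c = 0) :
    c ∈ simplexRelations S f D := by
  obtain ⟨k, rfl⟩ : ∃ k : ℤ, k • chainSymbol default = c := by
    obtain ⟨x, rfl⟩ := (antisymRelations X 0).mkQ_surjective c
    refine ⟨x default, ?_⟩
    rw [chainSymbol, ← map_smul, Finsupp.smul_single_one, ← Finsupp.unique_single x]
  rw [map_smul, simplexRatio_chainSymbol, Finset.univ_eq_empty, Finset.prod_empty, div_one,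
    smul_eq_zero] at hc
  rcases hc with rfl | hD
  · simp
  · exact Submodule.smul_mem _ _ (chainSymbol_mem_simplexRelations (fun i => i.elim0) hD)

theorem mem_simplexRelations_of_vanishesGenerically (S : Finset X) {D : W [⋀^Fin d]→ₗ[ℝ] ℝ}
    (hD : IsTopForm U D) (hS : ∀ s ∈ S, f s ∉ U) {c : AntisymChains X d}
    (hc : c ∈ chainsOn (S : Set X) d)
    (hvan : VanishesGenerically U fun ξ => simplexRatio f D ξ c) :
    c ∈ simplexRelations (S : Set X) f D := by
  classical
  induction S using Finset.strongInduction generalizing d U with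
  | H S ih =>
  rcases d with _ | d
  · obtain ⟨B, hBU, hB⟩ := hvan
    obtain ⟨ξ, hξU, hξ⟩ := exists_functional_forall_ne_zero hBU
    exact mem_simplexRelations_of_simplexRatio_zero (hB ξ hξU hξ)
  rcases S.eq_empty_or_nonempty with rfl | ⟨v, hv⟩
  · exact chainsOn_le_iff.2 (fun a ha => absurd (ha 0) (by simp)) hc
  set S₁ := {s ∈ S | f s ∉ U ⊔ Submodule.span ℝ {f v}} with hS₁
  have hvU : f v ∈ U ⊔ Submodule.span ℝ {f v} :=
    Submodule.mem_sup_right (Submodule.mem_span_singleton_self _)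
  have hS₁S : S₁ ⊂ S := Finset.filter_ssubset.2 ⟨v, hv, not_not.2 hvU⟩
  have hsub : (S₁ : Set X) ⊆ S := Finset.coe_subset.2 hS₁S.1
  have hS₁U : ∀ s ∈ S₁, f s ∉ U ⊔ Submodule.span ℝ {f v} := fun s hs => (Finset.mem_filter.1 hs).2
  have hvS₁ : v ∉ (S₁ : Set X) := fun h => hS₁U v h hvU
  have hdec := chainsOn_le_sup (f := f) hD hv hc
  rw [show {x | x ∈ (S : Set X) ∧ f x ∉ U ⊔ Submodule.span ℝ {f v}} = (S₁ : Set X) by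
    simp [hS₁]] at hdec
  obtain ⟨c₀, hc₀, _, hrest, rfl⟩ := Submodule.mem_sup.1 hdec
  obtain ⟨r, hr, _, ⟨c₁, hc₁, rfl⟩, rfl⟩ := Submodule.mem_sup.1 hrest
  have hrel₁ : c₁ ∈ simplexRelations (S₁ : Set X) f (D.curryLeft (f v)) :=
    ih S₁ hS₁S (hD.curryLeft (f v)) hS₁U hc₁ <|
      (hvan.of_sub_mem_simplexRelations hD hS (c' := c₀ + coneChain v c₁)
        (by convert hr using 1; abel)).contract (hS v hv) hS₁U hc₀ hc₁
  obtain ⟨q, hq, e, he, hqe⟩ := Submodule.mem_sup.1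
    (map_coneChain_simplexRelations_le hsub hv hvS₁ D ⟨c₁, hrel₁, rfl⟩)
  rw [← hqe] at hvan ⊢
  have hqr : r + q ∈ simplexRelations (S : Set X) f D := add_mem hr hq
  have hc₀e : c₀ + e ∈ simplexRelations (S₁ : Set X) f D :=
    ih S₁ hS₁S hD (fun s hs => hS s (hS₁S.1 hs)) (add_mem hc₀ he) <|
      hvan.of_sub_mem_simplexRelations hD hS (by convert hqr using 1; abel)
  convert add_mem hqr (simplexRelations_mono hsub D hc₀e) using 1
  abel

end Kernel

section GenericExtension

variable {X W : Type*} [AddCommGroup W] [Module ℝ W] {d : ℕ} {f : X → W}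

open Polynomial Filter Topology

theorem exists_polynomial_eval_eq_prod_pow_mul_simplexRatio (S : Finset X)
    (D : W [⋀^Fin d]→ₗ[ℝ] ℝ) (ξ η : W →ₗ[ℝ] ℝ) {c : AntisymChains X d}
    (hc : c ∈ chainsOn (S : Set X) d) :
    ∃ q : ℝ[X], ∀ t : ℝ, (∀ s ∈ S, (ξ + t • η) (f s) ≠ 0) →
      q.eval t = (∏ s ∈ S, (ξ + t • η) (f s)) ^ d * simplexRatio f D (ξ + t • η) c := by
  classical
  refine Submodule.span_induction ?_ ⟨0, by simp⟩ ?_ ?_ hc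
  · rintro _ ⟨a, ha, rfl⟩
    refine ⟨C (D (f ∘ a)) * ∏ i, ∏ s ∈ S.erase (a i), (C (ξ (f s)) + Polynomial.X * C (η (f s))),
      fun t ht => ?_⟩
    have heval : ∀ s, (C (ξ (f s)) + Polynomial.X * C (η (f s))).eval t = (ξ + t • η) (f s) :=
      fun s => by simp only [eval_add, eval_C, eval_mul, eval_X, LinearMap.add_apply,
        LinearMap.smul_apply, smul_eq_mul]
    have hsplit : (∏ s ∈ S, (ξ + t • η) (f s)) ^ d =
        (∏ i, (ξ + t • η) (f (a i))) * ∏ i, ∏ s ∈ S.erase (a i), (ξ + t • η) (f s) := by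
      rw [← Finset.prod_mul_distrib, Finset.prod_congr rfl fun i _ =>
        Finset.mul_prod_erase S (fun s => (ξ + t • η) (f s)) (ha i)]
      simp
    have hne : ∏ i, (ξ + t • η) (f (a i)) ≠ 0 := Finset.prod_ne_zero_iff.2 fun i _ => ht _ (ha i)
    rw [simplexRatio_chainSymbol, hsplit, eval_mul, eval_C, eval_prod]
    simp only [eval_prod, heval]
    field_simp
  · rintro x y - - ⟨p, hp⟩ ⟨q, hq⟩
    exact ⟨p + q, fun t ht => by rw [eval_add, hp t ht, hq t ht, map_add, mul_add]⟩
  · rintro k x - ⟨p, hp⟩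
    exact ⟨k • p, fun t ht => by rw [eval_smul, hp t ht, map_smul, mul_smul_comm]⟩

theorem simplexRatio_eq_zero_of_eventually {S : Finset X} (D : W [⋀^Fin d]→ₗ[ℝ] ℝ)
    {c : AntisymChains X d} (hc : c ∈ chainsOn (S : Set X) d) {ξ₀ ξ : W →ₗ[ℝ] ℝ}
    (hξ₀ : ∀ s ∈ S, ξ₀ (f s) ≠ 0)
    (h : ∀ᶠ t : ℝ in 𝓝[≠] 0, simplexRatio f D (ξ₀ + t • (ξ - ξ₀)) c = 0)
    (hξ : ∀ s ∈ S, ξ (f s) ≠ 0) : simplexRatio f D ξ c = 0 := by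
  obtain ⟨q, hq⟩ := exists_polynomial_eval_eq_prod_pow_mul_simplexRatio S D ξ₀ (ξ - ξ₀) hc
  have hne : ∀ᶠ t : ℝ in 𝓝[≠] 0, ∀ s ∈ S, (ξ₀ + t • (ξ - ξ₀)) (f s) ≠ 0 :=
    (Filter.eventually_all_finset S).2 fun s hs =>
      eventually_add_smul_apply_ne_zero (Or.inl (hξ₀ s hs))
  have hroot : ∀ᶠ t : ℝ in 𝓝[≠] 0, q.IsRoot t := by
    filter_upwards [h, hne] with t ht hnet
    rw [IsRoot, hq t hnet, ht, mul_zero]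
  have hq0 : q = 0 := q.eq_zero_of_infinite_isRoot fun hfin =>
    infinite_of_mem_nhds 0 (insert_mem_nhds_iff.2 hroot) (hfin.insert 0)
  have h1 : (ξ₀ + (1 : ℝ) • (ξ - ξ₀)) = ξ := by rw [one_smul, add_sub_cancel]
  have hq1 := hq 1 (by rwa [h1])
  rw [hq0, eval_zero, h1] at hq1
  exact (mul_eq_zero.1 hq1.symm).resolve_left (pow_ne_zero _ (Finset.prod_ne_zero_iff.2 hξ))

end GenericExtension

section LaplaceTransform

open MeasureTheory

variable {m : ℕ} {y : Fin m → Fin m → ℝ}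

theorem det_linearCombination (y : Fin m → Fin m → ℝ) :
    LinearMap.det (Fintype.linearCombination ℝ y) = Matrix.detRowAlternating y := by
  have h : Fintype.linearCombination ℝ y = Matrix.toLin' (Matrix.of y).transpose := by
    refine LinearMap.ext fun t => ?_
    rw [Fintype.linearCombination_apply, Matrix.toLin'_apply, Matrix.mulVec_transpose,
      Matrix.vecMul_eq_sum]
    rfl
  rw [h, LinearMap.det_toLin', Matrix.det_transpose]
  rfl

theorem span_nnreal_range_eq_image (y : Fin m → Fin m → ℝ) :
    (Submodule.span NNReal (Set.range y) : Set (Fin m → ℝ)) =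
      Fintype.linearCombination ℝ y '' Set.Ici 0 := by
  ext x
  rw [SetLike.mem_coe, Submodule.mem_span_range_iff_exists_fun]
  constructor
  · rintro ⟨t, rfl⟩
    exact ⟨fun i => t i, fun i => (t i).2, rfl⟩
  · rintro ⟨t, ht, rfl⟩
    exact ⟨fun i => ⟨t i, ht i⟩, rfl⟩

theorem linearCombination_injective (hy : Matrix.detRowAlternating y ≠ 0) :
    Function.Injective (Fintype.linearCombination ℝ y) :=
  (LinearMap.equivOfDetNeZero (Fintype.linearCombination ℝ y)
    (by rwa [det_linearCombination])).injective

theorem measurableSet_span_nnreal_range (hy : Matrix.detRowAlternating y ≠ 0) :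
    MeasurableSet (Submodule.span NNReal (Set.range y) : Set (Fin m → ℝ)) := by
  rw [span_nnreal_range_eq_image]
  exact measurableSet_Ici.image_of_continuousOn_injOn
    (LinearMap.continuous_of_finiteDimensional _).continuousOn
    (linearCombination_injective hy).injOn

theorem integral_Ici_exp_neg_sum {b : Fin m → ℝ} (hb : ∀ i, 0 < b i) :
    ∫ t in Set.Ici (0 : Fin m → ℝ), Real.exp (-∑ i, t i * b i) = (∏ i, b i)⁻¹ := by
  have hprod : (Set.Ici (0 : Fin m → ℝ)).indicator (fun t => Real.exp (-∑ i, t i * b i)) =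
      fun t => ∏ i, (Set.Ici (0 : ℝ)).indicator (fun r => Real.exp (-b i * r)) (t i) := by
    funext t
    by_cases ht : 0 ≤ t
    · rw [Set.indicator_of_mem (Set.mem_Ici.2 ht), ← Finset.sum_neg_distrib, Real.exp_sum]
      refine Finset.prod_congr rfl fun i _ => ?_
      rw [Set.indicator_of_mem (show t i ∈ Set.Ici 0 from ht i), neg_mul, mul_comm]
    · obtain ⟨i, hi⟩ := not_forall.1 ht
      rw [Set.indicator_of_notMem (by simpa using ht)]
      exact (Finset.prod_eq_zero (Finset.mem_univ i) (Set.indicator_of_notMem hi _)).symm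
  rw [← integral_indicator measurableSet_Ici, hprod, integral_fintype_prod_volume_eq_prod
    fun i => (Set.Ici (0 : ℝ)).indicator (fun r => Real.exp (-b i * r)), ← Finset.prod_inv_distrib]
  refine Finset.prod_congr rfl fun i _ => ?_
  rw [integral_indicator measurableSet_Ici, integral_Ici_eq_integral_Ioi,
    integral_exp_mul_Ioi (by simpa using hb i)]
  simp

theorem integral_span_nnreal_range_exp_neg (hy : Matrix.detRowAlternating y ≠ 0)
    {ξ : (Fin m → ℝ) →ₗ[ℝ] ℝ} (hξ : ∀ i, 0 < ξ (y i)) :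
    ∫ x in (Submodule.span NNReal (Set.range y) : Set (Fin m → ℝ)), Real.exp (-ξ x) =
      |Matrix.detRowAlternating y| / ∏ i, ξ (y i) := by
  rw [span_nnreal_range_eq_image, ← LinearMap.coe_toContinuousLinearMap',
    integral_image_eq_integral_abs_det_fderiv_smul volume measurableSet_Ici
      (fun x _ => (ContinuousLinearMap.hasFDerivAt _).hasFDerivWithinAt)
      (linearCombination_injective hy).injOn,
    integral_smul, LinearMap.det_toContinuousLinearMap, det_linearCombination, smul_eq_mul,
    div_eq_mul_inv, ← integral_Ici_exp_neg_sum hξ]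
  simp [Fintype.linearCombination_apply]

theorem integrableOn_span_nnreal_range_exp_neg (hy : Matrix.detRowAlternating y ≠ 0)
    {ξ : (Fin m → ℝ) →ₗ[ℝ] ℝ} (hξ : ∀ i, 0 < ξ (y i)) :
    IntegrableOn (fun x => Real.exp (-ξ x))
      (Submodule.span NNReal (Set.range y) : Set (Fin m → ℝ)) := by
  have hpos : 0 < |Matrix.detRowAlternating y| / ∏ i, ξ (y i) :=
    div_pos (abs_pos.2 hy) (Finset.prod_pos fun i _ => hξ i)
  refine not_imp_comm.1 integral_undef ?_
  rw [integral_span_nnreal_range_exp_neg hy hξ]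
  exact hpos.ne'

end LaplaceTransform

section PositiveSymbols

variable {X : Type*} {d : ℕ} {σ : Finset X} {a : Fin d → X}

theorem det_ne_zero_iff_linearIndependent {w : Fin d → Fin d → ℝ} :
    Matrix.detRowAlternating w ≠ 0 ↔ LinearIndependent ℝ w := by
  rw [← isUnit_iff_ne_zero]
  exact (Matrix.isUnit_iff_isUnit_det (Matrix.of w)).symm.trans
    Matrix.linearIndependent_rows_iff_isUnit.symm

theorem exists_injective_range_eq (hσ : σ.card = d) :
    ∃ a : Fin d → X, Function.Injective a ∧ Set.range a = (σ : Set X) := by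
  refine ⟨fun i => (σ.equivFinOfCardEq hσ).symm i,
    Subtype.val_injective.comp (Equiv.injective _), ?_⟩
  exact ((σ.equivFinOfCardEq hσ).symm.surjective.range_comp _).trans Subtype.range_val

theorem exists_perm_of_range_subset {b : Fin d → X} (ha : Function.Injective a)
    (h : Set.range a ⊆ Set.range b) : ∃ π : Equiv.Perm (Fin d), b = a ∘ π := by
  choose g hg using fun i => h (Set.mem_range_self i)
  have hinj : Function.Injective g := fun i j hij => ha (by rw [← hg i, ← hg j, hij])
  let e : Equiv.Perm (Fin d) := Equiv.ofBijective g (Finite.injective_iff_bijective.1 hinj)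
  refine ⟨e.symm, funext fun j => ?_⟩
  obtain ⟨i, rfl⟩ := e.surjective j
  rw [Function.comp_apply, e.symm_apply_apply]
  exact hg i

theorem card_eq_of_range_eq (ha : Function.Injective a) (hσ : Set.range a = (σ : Set X)) :
    σ.card = d := by
  rw [← Set.ncard_coe_finset, ← hσ, Set.ncard_range_of_injective ha, Nat.card_eq_fintype_card,
    Fintype.card_fin]

open Classical in
/-- The symbol of the points of `σ`, listed in an order in which their images under `f` have
positive determinant. With the sign of the determinant as a coefficient any order can be used; the
value is `0` if `σ` does not have `d` points or if their images are linearly dependent. -/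
noncomputable def positiveSymbol (f : X → Fin d → ℝ) (σ : Finset X) : AntisymChains X d :=
  if hσ : σ.card = d then
    (SignType.sign (Matrix.detRowAlternating (f ∘ (exists_injective_range_eq hσ).choose)) : ℤ) •
      chainSymbol (exists_injective_range_eq hσ).choose
  else 0

theorem sign_det_smul_chainSymbol_comp_perm (f : X → Fin d → ℝ) (a : Fin d → X)
    (π : Equiv.Perm (Fin d)) :
    (SignType.sign (Matrix.detRowAlternating (f ∘ a ∘ π)) : ℤ) • chainSymbol (a ∘ π) =
      (SignType.sign (Matrix.detRowAlternating (f ∘ a)) : ℤ) • chainSymbol a := by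
  rw [chainSymbol_comp_perm, ← Function.comp_assoc, AlternatingMap.map_perm]
  rcases Int.units_eq_one_or (Equiv.Perm.sign π) with h | h <;> rw [h]
  · simp
  · simp [Left.sign_neg]

theorem positiveSymbol_eq (f : X → Fin d → ℝ) (ha : Function.Injective a)
    (hσ : Set.range a = (σ : Set X)) : positiveSymbol f σ =
      (SignType.sign (Matrix.detRowAlternating (f ∘ a)) : ℤ) • chainSymbol a := by
  have hcard := card_eq_of_range_eq ha hσ
  obtain ⟨π, hπ⟩ := exists_perm_of_range_subset ha
    (hσ.trans (exists_injective_range_eq hcard).choose_spec.2.symm).subset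
  rw [positiveSymbol, dif_pos hcard, hπ, sign_det_smul_chainSymbol_comp_perm]

theorem positiveSymbol_eq_chainSymbol {f : X → Fin d → ℝ}
    (hdet : 0 < Matrix.detRowAlternating (f ∘ a)) (hσ : Set.range a = (σ : Set X)) :
    positiveSymbol f σ = chainSymbol a := by
  have ha : Function.Injective a :=
    (det_ne_zero_iff_linearIndependent.1 hdet.ne').injective.of_comp
  rw [positiveSymbol_eq f ha hσ, sign_pos hdet, SignType.coe_one, one_smul]

theorem positiveSymbol_mem_chainsOn (f : X → Fin d → ℝ) {S : Set X} (h : (σ : Set X) ⊆ S) :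
    positiveSymbol f σ ∈ chainsOn S d := by
  rw [positiveSymbol]
  split_ifs with hσ
  · have hrange := (exists_injective_range_eq hσ).choose_spec.2
    exact Submodule.smul_mem _ _ (chainSymbol_mem_chainsOn fun i =>
      h (hrange.le (Set.mem_range_self i)))
  · exact Submodule.zero_mem _

section Laplace

open MeasureTheory

variable {f : X → Fin d → ℝ}

theorem exists_enumeration_det_ne_zero (hσ : σ.card = d) (hf : LinearIndepOn ℝ f σ) :
    ∃ a : Fin d → X, Function.Injective a ∧ Set.range a = (σ : Set X) ∧
      Matrix.detRowAlternating (f ∘ a) ≠ 0 := by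
  obtain ⟨a, ha, hrange⟩ := exists_injective_range_eq hσ
  rw [← hrange, linearIndepOn_range_iff ha] at hf
  exact ⟨a, ha, hrange, det_ne_zero_iff_linearIndependent.2 hf⟩

theorem measurableSet_span_nnreal_image (hσ : σ.card = d) (hf : LinearIndepOn ℝ f σ) :
    MeasurableSet (Submodule.span NNReal (f '' σ) : Set (Fin d → ℝ)) := by
  obtain ⟨a, -, hrange, hdet⟩ := exists_enumeration_det_ne_zero hσ hf
  rw [← hrange, ← Set.range_comp]
  exact measurableSet_span_nnreal_range hdet

theorem integrableOn_span_nnreal_image_exp_neg (hσ : σ.card = d) (hf : LinearIndepOn ℝ f σ)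
    {ξ : (Fin d → ℝ) →ₗ[ℝ] ℝ} (hξ : ∀ x ∈ σ, 0 < ξ (f x)) :
    IntegrableOn (fun x => Real.exp (-ξ x))
      (Submodule.span NNReal (f '' σ) : Set (Fin d → ℝ)) := by
  obtain ⟨a, -, hrange, hdet⟩ := exists_enumeration_det_ne_zero hσ hf
  rw [← hrange, ← Set.range_comp]
  exact integrableOn_span_nnreal_range_exp_neg hdet fun i => hξ _ (hrange.le ⟨i, rfl⟩)

theorem simplexRatio_positiveSymbol (hσ : σ.card = d) (hf : LinearIndepOn ℝ f σ)
    {ξ : (Fin d → ℝ) →ₗ[ℝ] ℝ} (hξ : ∀ x ∈ σ, 0 < ξ (f x)) :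
    simplexRatio f Matrix.detRowAlternating ξ (positiveSymbol f σ) =
      ∫ x in (Submodule.span NNReal (f '' σ) : Set (Fin d → ℝ)), Real.exp (-ξ x) := by
  obtain ⟨a, ha, hrange, hdet⟩ := exists_enumeration_det_ne_zero hσ hf
  rw [positiveSymbol_eq f ha hrange, map_zsmul, simplexRatio_chainSymbol, ← hrange,
    ← Set.range_comp,
    integral_span_nnreal_range_exp_neg hdet fun i => hξ _ (hrange.le ⟨i, rfl⟩),
    zsmul_eq_mul, SignType.intCast_cast, ← mul_div_assoc, sign_mul_self]
  rfl

end Laplace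

end PositiveSymbols

section Homogenization

open Pointwise

variable {V E : Type*} [AddCommGroup V] [Module ℝ V] [AddCommGroup E] [Module ℝ E]

/-- Homogeneous coordinates for `P`: an affine map `f` that is injective on the affine hull of `P`
and maps `P` to the hyperplane `ξ = 1`, which avoids the origin. -/
structure IsHomogenization (P : Set V) (f : V →ᵃ[ℝ] E) (ξ : E →ₗ[ℝ] ℝ) : Prop where
  height : ∀ x ∈ P, ξ (f x) = 1
  eq_zero_of_linear_eq_zero : ∀ x ∈ vectorSpan ℝ P, f.linear x = 0 → x = 0

variable {P : Set V} {f : V →ᵃ[ℝ] E} {ξ : E →ₗ[ℝ] ℝ}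

theorem IsHomogenization.injOn (hf : IsHomogenization P f ξ) : Set.InjOn f P :=
  fun x hx y hy hxy => sub_eq_zero.1 <| hf.eq_zero_of_linear_eq_zero _
    (vsub_mem_vectorSpan ℝ hx hy) <| by
      rw [← vsub_eq_sub, f.linearMap_vsub, vsub_eq_sub, hxy, sub_self]

theorem linear_sum_smul_of_sum_eq_zero (f : V →ᵃ[ℝ] E) {ι : Type*} {s : Finset ι} {w : ι → ℝ}
    (a : ι → V) (hw : ∑ i ∈ s, w i = 0) :
    f.linear (∑ i ∈ s, w i • a i) = ∑ i ∈ s, w i • f (a i) := by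
  have hdecomp : ∀ i, f (a i) = f.linear (a i) + f 0 := fun i => congrFun f.decomp (a i)
  simp only [hdecomp, smul_add, Finset.sum_add_distrib, ← Finset.sum_smul, hw, zero_smul,
    add_zero, map_sum, map_smul]

theorem IsHomogenization.sum_eq_zero (hf : IsHomogenization P f ξ) {ι : Type*} {s : Finset ι}
    {w : ι → ℝ} {a : ι → V} (ha : ∀ i, a i ∈ P) (h : ∑ i ∈ s, w i • f (a i) = 0) :
    ∑ i ∈ s, w i = 0 ∧ ∑ i ∈ s, w i • a i = 0 := by
  have hw : ∑ i ∈ s, w i = 0 := by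
    simpa [map_sum, hf.height _ (ha _)] using congrArg ξ h
  refine ⟨hw, hf.eq_zero_of_linear_eq_zero _ ?_ (by rwa [linear_sum_smul_of_sum_eq_zero f a hw])⟩
  rw [← s.weightedVSub_eq_linear_combination hw]
  exact vectorSpan_mono ℝ (Set.range_subset_iff.2 ha) (weightedVSub_mem_vectorSpan hw a)

theorem IsHomogenization.linearIndependent_iff (hf : IsHomogenization P f ξ) {ι : Type*}
    {a : ι → V} (ha : ∀ i, a i ∈ P) :
    LinearIndependent ℝ (fun i => f (a i)) ↔ AffineIndependent ℝ a := by
  rw [linearIndependent_iff', affineIndependent_iff]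
  refine ⟨fun h s w hw hwa => h s w ?_, fun h s w hwa => ?_⟩
  · rw [← linear_sum_smul_of_sum_eq_zero f a hw, hwa, map_zero]
  · exact h s w (hf.sum_eq_zero ha hwa).1 (hf.sum_eq_zero ha hwa).2

theorem span_nnreal_eq_smul_convexHull {S : Set E} (hS : S.Nonempty) :
    (Submodule.span NNReal S : Set E) = (Set.univ : Set NNReal) • convexHull ℝ S := by
  refine Set.Subset.antisymm (fun x hx => ?_) ?_
  · induction hx using Submodule.span_induction with
    | mem x hx => exact ⟨1, trivial, x, subset_convexHull ℝ S hx, one_smul _ x⟩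
    | zero => exact ⟨0, trivial, _, subset_convexHull ℝ S hS.some_mem, zero_smul _ _⟩
    | smul c x _ hx =>
      obtain ⟨r, -, p, hp, rfl⟩ := hx
      exact ⟨c * r, trivial, p, hp, mul_smul c r p⟩
    | add x y _ _ hx hy =>
      obtain ⟨r, -, p, hp, rfl⟩ := hx
      obtain ⟨s, -, q, hq, rfl⟩ := hy
      rcases eq_or_ne (r + s) 0 with h0 | h0
      · obtain ⟨rfl, rfl⟩ := add_eq_zero.1 h0
        exact ⟨0, trivial, p, hp, by simp⟩
      · refine ⟨r + s, trivial, ((r / (r + s) : NNReal) : ℝ) • p + ((s / (r + s) : NNReal) : ℝ) • q,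
          convex_convexHull ℝ S hp hq NNReal.zero_le_coe NNReal.zero_le_coe ?_, ?_⟩
        · rw [← NNReal.coe_add, ← add_div, div_self h0, NNReal.coe_one]
        · simp only [← NNReal.smul_def, smul_add, smul_smul, mul_div_cancel₀ _ h0]
  · rintro _ ⟨r, -, p, hp, rfl⟩
    have hconv : Convex ℝ (Submodule.span NNReal S : Set E) := fun x hx y hy a b ha hb _ =>
      add_mem (Submodule.smul_mem _ (⟨a, ha⟩ : NNReal) hx) (Submodule.smul_mem _ ⟨b, hb⟩ hy)
    exact Submodule.smul_mem _ r (convexHull_min Submodule.subset_span hconv hp)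

theorem span_nnreal_image_eq_smul_image_convexHull (f : V →ᵃ[ℝ] E) {S : Set V}
    (hS : S.Nonempty) : (Submodule.span NNReal (f '' S) : Set E) =
      (Set.univ : Set NNReal) • f '' convexHull ℝ S := by
  rw [span_nnreal_eq_smul_convexHull (hS.image f), f.image_convexHull]

end Homogenization

section TriangulationCones

open Pointwise MeasureTheory

variable {V E : Type*} [AddCommGroup V] [Module ℝ V] [AddCommGroup E] [Module ℝ E] {P : Set V}
  {T : Finset (Finset V)} {σ τ : Finset V}

theorem IsTriangulation.subset (hT : IsTriangulation P T) (hσ : σ ∈ T) : (σ : Set V) ⊆ P :=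
  (hT.vertices σ hσ).trans extremePoints_subset

theorem IsTriangulation.nonempty (hT : IsTriangulation P T) (hσ : σ ∈ T) : σ.Nonempty :=
  Finset.card_pos.1 (by rw [hT.card_eq σ hσ]; exact Nat.succ_pos _)

theorem IsTriangulation.convexHull_subset (hT : IsTriangulation P T) (hσ : σ ∈ T) :
    convexHull ℝ (σ : Set V) ⊆ P :=
  hT.cover ▸ Set.subset_biUnion_of_mem (u := fun σ : Finset V => convexHull ℝ (σ : Set V)) hσ

theorem IsTriangulation.iUnion_span_nnreal_image (hT : IsTriangulation P T) (f : V →ᵃ[ℝ] E) :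
    (⋃ σ ∈ T, (Submodule.span NNReal (f '' σ) : Set E)) = (Set.univ : Set NNReal) • f '' P := by
  conv_rhs => rw [← hT.cover]
  rw [Set.image_iUnion₂, Set.smul_iUnion₂]
  exact Set.iUnion₂_congr fun σ hσ =>
    span_nnreal_image_eq_smul_image_convexHull f (hT.nonempty hσ)

theorem IsTriangulation.span_nnreal_image_inter_subset {f : V →ᵃ[ℝ] E} {ξ : E →ₗ[ℝ] ℝ}
    (hT : IsTriangulation P T) (hf : IsHomogenization P f ξ) (hσ : σ ∈ T) (hτ : τ ∈ T)
    (hne : σ ≠ τ) :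
    (Submodule.span NNReal (f '' σ) : Set E) ∩ Submodule.span NNReal (f '' τ) ⊆
      Submodule.span ℝ (f '' ((σ : Set V) ∩ τ)) := by
  rw [span_nnreal_image_eq_smul_image_convexHull f (hT.nonempty hσ),
    span_nnreal_image_eq_smul_image_convexHull f (hT.nonempty hτ)]
  rintro _ ⟨⟨r, -, _, ⟨p, hp, rfl⟩, rfl⟩, s, -, _, ⟨q, hq, rfl⟩, hqp⟩
  have hpP := hT.convexHull_subset hσ hp
  have hqP := hT.convexHull_subset hτ hq
  simp only [NNReal.smul_def] at hqp ⊢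
  have hrs : (s : ℝ) = r := by
    simpa [hf.height _ hpP, hf.height _ hqP] using congrArg ξ hqp
  rcases eq_or_ne (r : ℝ) 0 with h0 | h0
  · rw [h0, zero_smul]
    exact Submodule.zero_mem _
  obtain rfl : q = p := hf.injOn hqP hpP (by rwa [hrs, smul_right_inj h0] at hqp)
  have hmem : q ∈ convexHull ℝ ((σ : Set V) ∩ τ) := hT.inter σ hσ τ hτ hne ▸ ⟨hp, hq⟩
  have himage : f q ∈ convexHull ℝ (f '' ((σ : Set V) ∩ τ)) :=
    f.image_convexHull _ ▸ Set.mem_image_of_mem f hmem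
  exact Submodule.smul_mem _ _ (convexHull_min Submodule.subset_span (Submodule.convex _) himage)

theorem IsTriangulation.linearIndepOn {f : V →ᵃ[ℝ] E} {ξ : E →ₗ[ℝ] ℝ}
    (hT : IsTriangulation P T) (hf : IsHomogenization P f ξ) (hσ : σ ∈ T) :
    LinearIndepOn ℝ f (σ : Set V) :=
  (hf.linearIndependent_iff fun x : σ => hT.subset hσ x.2).2 (hT.indep σ hσ)

variable {d : ℕ} {f : V →ᵃ[ℝ] Fin d → ℝ}
  {ξ : (Fin d → ℝ) →ₗ[ℝ] ℝ}

theorem IsTriangulation.aedisjoint_span_nnreal_image (hT : IsTriangulation P T)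
    (hd : finrank ℝ (vectorSpan ℝ P) + 1 = d)
    (hf : IsHomogenization P f ξ) (hσ : σ ∈ T) (hτ : τ ∈ T) (hne : σ ≠ τ) :
    AEDisjoint volume (Submodule.span NNReal (f '' (σ : Set V)) : Set (Fin d → ℝ))
      (Submodule.span NNReal (f '' (τ : Set V)) : Set (Fin d → ℝ)) := by
  classical
  refine measure_mono_null (hT.span_nnreal_image_inter_subset hf hσ hτ hne)
    (Measure.addHaar_submodule volume _ fun htop => ?_)
  have hlt : (σ ∩ τ).card < σ.card := Finset.card_lt_card
    (Finset.inter_subset_left.ssubset_of_ne fun h => hne (Finset.eq_of_subset_of_card_le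
      (Finset.inter_eq_left.1 h) (by rw [hT.card_eq σ hσ, hT.card_eq τ hτ])))
  have hle := (finrank_span_finset_le_card (R := ℝ) ((σ ∩ τ).image f)).trans Finset.card_image_le
  rw [Set.finrank, Finset.coe_image, Finset.coe_inter, htop, finrank_top, finrank_fin_fun] at hle
  rw [hT.card_eq σ hσ, hd] at hlt
  exact hlt.not_ge hle

theorem IsTriangulation.simplexRatio_sum_positiveSymbol (hT : IsTriangulation P T)
    (hd : finrank ℝ (vectorSpan ℝ P) + 1 = d)
    (hf : IsHomogenization P f ξ) {η : (Fin d → ℝ) →ₗ[ℝ] ℝ}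
    (hη : ∀ σ ∈ T, ∀ x ∈ σ, 0 < η (f x)) :
    simplexRatio f Matrix.detRowAlternating η (∑ σ ∈ T, positiveSymbol f σ) =
      ∫ x in (Set.univ : Set NNReal) • f '' P, Real.exp (-η x) := by
  rw [← hT.iUnion_span_nnreal_image f, ← Finset.set_biUnion_coe, Set.biUnion_eq_iUnion,
    integral_iUnion_ae, tsum_fintype, map_sum, ← Finset.sum_coe_sort]
  · exact Finset.sum_congr rfl fun σ _ => simplexRatio_positiveSymbol ((hT.card_eq σ σ.2).trans hd)
      (hT.linearIndepOn hf σ.2) (hη σ σ.2)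
  · exact fun σ => (measurableSet_span_nnreal_image ((hT.card_eq σ σ.2).trans hd)
      (hT.linearIndepOn hf σ.2)).nullMeasurableSet
  · exact fun σ τ hne =>
      hT.aedisjoint_span_nnreal_image hd hf σ.2 τ.2 (Subtype.coe_injective.ne hne)
  · exact integrableOn_finite_iUnion.2 fun σ =>
      integrableOn_span_nnreal_image_exp_neg ((hT.card_eq σ σ.2).trans hd) (hT.linearIndepOn hf σ.2)
        (hη σ σ.2)

open Filter Topology in
theorem IsTriangulation.sum_positiveSymbol_sub_mem {T' : Finset (Finset V)}
    (hT : IsTriangulation P T) (hT' : IsTriangulation P T')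
    (hd : finrank ℝ (vectorSpan ℝ P) + 1 = d) (hf : IsHomogenization P f ξ) :
    ∑ σ ∈ T, positiveSymbol f σ - ∑ σ ∈ T', positiveSymbol f σ ∈
      simplexRelations (P.extremePoints ℝ) f Matrix.detRowAlternating := by
  classical
  set S : Finset V := (T ∪ T').biUnion id with hS
  have hST : ∀ σ ∈ T, σ ⊆ S := fun σ hσ =>
    Finset.subset_biUnion_of_mem id (Finset.mem_union_left T' hσ)
  have hST' : ∀ σ ∈ T', σ ⊆ S := fun σ hσ =>
    Finset.subset_biUnion_of_mem id (Finset.mem_union_right T hσ)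
  have hSP : (S : Set V) ⊆ P.extremePoints ℝ := by
    simp only [hS, Finset.coe_biUnion, Set.iUnion₂_subset_iff, Finset.mem_coe, Finset.mem_union]
    rintro σ (hσ | hσ)
    exacts [hT.vertices σ hσ, hT'.vertices σ hσ]
  have hξS : ∀ s ∈ S, ξ (f s) = 1 := fun s hs => hf.height s (hSP hs).1
  have hchain : ∑ σ ∈ T, positiveSymbol f σ - ∑ σ ∈ T', positiveSymbol f σ ∈
      chainsOn (S : Set V) d :=
    sub_mem (sum_mem fun σ hσ => positiveSymbol_mem_chainsOn _ (Finset.coe_subset.2 (hST σ hσ)))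
      (sum_mem fun σ hσ => positiveSymbol_mem_chainsOn _ (Finset.coe_subset.2 (hST' σ hσ)))
  have hS0 : ∀ s ∈ S, f s ∉ (⊥ : Submodule ℝ (Fin d → ℝ)) :=
    fun s hs h0 => zero_ne_one (α := ℝ) <| by
      rw [← hξS s hs, (Submodule.mem_bot ℝ).1 h0, map_zero]
  refine simplexRelations_mono hSP _ (mem_simplexRelations_of_vanishesGenerically S isTopForm_det
    hS0 hchain ⟨S.image f, Finset.forall_mem_image.2 hS0, fun η _ hη => ?_⟩)
  refine simplexRatio_eq_zero_of_eventually _ hchain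
    (fun s hs => (hξS s hs).trans_ne one_ne_zero) ?_ fun s hs => hη _ (Finset.mem_image_of_mem f hs)
  have hpos : ∀ᶠ t : ℝ in 𝓝[≠] 0, ∀ s ∈ S, 0 < (ξ + t • (η - ξ)) (f s) := by
    refine (Filter.eventually_all_finset S).2 fun s hs => ?_
    exact (tendsto_add_smul_apply ξ (η - ξ) (f s)).eventually_const_lt
      (by rw [hξS s hs]; exact one_pos)
  filter_upwards [hpos] with t ht
  rw [map_sub, hT.simplexRatio_sum_positiveSymbol hd hf fun σ hσ x hx => ht x (hST σ hσ hx),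
    hT'.simplexRatio_sum_positiveSymbol hd hf fun σ hσ x hx => ht x (hST' σ hσ hx), sub_self]

end TriangulationCones

section Circuits

variable {V : Type*} [AddCommGroup V] [Module ℝ V] {P : Set V}

theorem IsCircuit.three_le_card {Z : Finset V} (h : IsCircuit (Z : Set V)) : 3 ≤ Z.card := by
  classical
  by_contra! hlt
  refine h.1 ?_
  rcases Nat.lt_succ_iff_lt_or_eq.1 hlt with h1 | h2
  · have : Subsingleton {x // x ∈ (Z : Set V)} :=
      Set.subsingleton_coe _ |>.2 (Finset.card_le_one_iff_subsingleton.1 (by omega))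
    exact affineIndependent_of_subsingleton ℝ _
  · obtain ⟨x, y, hxy, rfl⟩ := Finset.card_eq_two.1 h2
    have := (affineIndependent_of_ne ℝ hxy).range
    rwa [Matrix.range_cons_cons_empty, ← Finset.coe_pair] at this

theorem IsCircuit.three_le {r p : ℕ} {v : Fin r → V} (h : IsCircuit (v '' {i | (i : ℕ) < p})) :
    3 ≤ p := by
  classical
  have hcoe : v '' {i | (i : ℕ) < p} =
      ((Finset.univ.filter fun i : Fin r => (i : ℕ) < p).image v : Finset V) := by
    ext x; simp
  rw [hcoe] at h
  exact h.three_le_card.trans <| Finset.card_image_le.trans <|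
    (Fin.card_filter_val_lt (n := r) (m := p)).le.trans (min_le_right _ _)

/-- A tuple of distinct vertices of `P`, the first `p` of which form a circuit. -/
structure IsFlipTuple (P : Set V) (p : ℕ) {r : ℕ} (v : Fin (r + 1) → V) : Prop where
  injective : Function.Injective v
  mem_extremePoints : ∀ i, v i ∈ P.extremePoints ℝ
  le_length : p ≤ r + 1
  isCircuit : IsCircuit (v '' {i | (i : ℕ) < p})

theorem image_comp_perm_eq_image {X : Type*} {r : ℕ} (w : Fin r → X) {τ : Equiv.Perm (Fin r)}
    {A : Finset (Fin r)} {p : ℕ} (hτ : ∀ i, τ i ∈ A ↔ (i : ℕ) < p) :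
    (w ∘ τ) '' {i | (i : ℕ) < p} = w '' A := by
  rw [Set.image_comp]
  congr 1
  ext i
  simp [Equiv.image_eq_preimage_symm, ← hτ]

theorem IsFlipTuple.exists_partialBoundary_eq_neg {p r : ℕ} {v : Fin (r + 1) → V}
    (h : IsFlipTuple P p v) :
    ∃ v' : Fin (r + 1) → V, IsFlipTuple P p v' ∧ partialBoundary p v' = -partialBoundary p v := by
  have hp : 3 ≤ p := h.isCircuit.three_le
  have hr : p ≤ r + 1 := h.le_length
  let τ : Equiv.Perm (Fin (r + 1)) := Equiv.swap ⟨0, by omega⟩ ⟨1, by omega⟩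
  have hτ : ∀ i, τ i ∈ Finset.univ.filter (fun i : Fin (r + 1) => (i : ℕ) < p) ↔ (i : ℕ) < p := by
    intro i
    rw [Finset.mem_filter, Equiv.swap_apply_def]
    grind
  refine ⟨v ∘ τ, ⟨h.injective.comp τ.injective, fun i => h.mem_extremePoints _, hr, ?_⟩, ?_⟩
  · rw [image_comp_perm_eq_image v hτ]
    simpa using h.isCircuit
  · rw [partialBoundary_comp_perm v hτ, ← partialBoundary_eq_sum_signedFace,
      Equiv.Perm.sign_swap (by simp), Units.neg_smul, one_smul]

/-- The partial boundaries over the circuits contained in tuples of `r + 1` vertices of `P`. -/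
def flipChains (P : Set V) (r : ℕ) : Set (AntisymChains V r) :=
  {x | ∃ (p : ℕ) (v : Fin (r + 1) → V), IsFlipTuple P p v ∧ partialBoundary p v = x}

theorem neg_mem_flipChains {r : ℕ} {x : AntisymChains V r} (hx : x ∈ flipChains P r) :
    -x ∈ flipChains P r := by
  obtain ⟨p, v, hv, rfl⟩ := hx
  exact ⟨p, hv.exists_partialBoundary_eq_neg⟩

theorem exists_sum_partialBoundary_of_mem_closure {r : ℕ} {x : AntisymChains V r}
    (hx : x ∈ AddSubgroup.closure (flipChains P r)) :
    ∃ (k : ℕ) (p : Fin k → ℕ) (v : Fin k → Fin (r + 1) → V),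
      (∀ α, IsFlipTuple P (p α) (v α)) ∧ ∑ α, partialBoundary (p α) (v α) = x := by
  rw [← AddSubgroup.mem_toAddSubmonoid, AddSubgroup.closure_toAddSubmonoid] at hx
  obtain ⟨L, hL, rfl⟩ := AddSubmonoid.exists_list_of_mem_closure hx
  have hL' : ∀ α : Fin L.length, L[α] ∈ flipChains P r := fun α =>
    (hL _ (List.getElem_mem α.2)).elim id fun h => neg_neg L[α] ▸ neg_mem_flipChains h
  choose p v hv hpv using hL'
  refine ⟨L.length, p, v, hv, ?_⟩
  simp only [hpv, Fin.getElem_fin, Fin.sum_univ_getElem]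

end Circuits

section NondegeneratePart

variable {X : Type*} {d : ℕ}

open Classical in
/-- The endomorphism of the chain group that kills the symbols of determinant zero and fixes the
others. -/
noncomputable def nondegeneratePart (f : X → Fin d → ℝ) :
    AntisymChains X d →ₗ[ℤ] AntisymChains X d :=
  chainLift (fun a => if Matrix.detRowAlternating (f ∘ a) = 0 then 0 else chainSymbol a)
    fun a π => by
      simp only [← Function.comp_assoc, AlternatingMap.map_perm, smul_eq_zero_iff_eq,
        chainSymbol_comp_perm, smul_ite, smul_zero]

theorem nondegeneratePart_chainSymbol_of_eq_zero {f : X → Fin d → ℝ} {a : Fin d → X}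
    (ha : Matrix.detRowAlternating (f ∘ a) = 0) : nondegeneratePart f (chainSymbol a) = 0 := by
  rw [nondegeneratePart, chainLift_chainSymbol, if_pos ha]

theorem nondegeneratePart_chainSymbol_of_ne_zero {f : X → Fin d → ℝ} {a : Fin d → X}
    (ha : Matrix.detRowAlternating (f ∘ a) ≠ 0) :
    nondegeneratePart f (chainSymbol a) = chainSymbol a := by
  rw [nondegeneratePart, chainLift_chainSymbol, if_neg ha]

theorem nondegeneratePart_positiveSymbol (f : X → Fin d → ℝ) {σ : Finset X} (hσ : σ.card = d) :
    nondegeneratePart f (positiveSymbol f σ) = positiveSymbol f σ := by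
  obtain ⟨a, ha, haσ⟩ := exists_injective_range_eq hσ
  rw [positiveSymbol_eq f ha haσ, map_zsmul]
  rcases eq_or_ne (Matrix.detRowAlternating (f ∘ a)) 0 with h0 | h0
  · rw [h0, sign_zero, SignType.coe_zero, zero_smul, zero_smul]
  · rw [nondegeneratePart_chainSymbol_of_ne_zero h0]

theorem nondegeneratePart_boundary {f : X → Fin d → ℝ} {w : Fin (d + 1) → X}
    {A : Finset (Fin (d + 1))}
    (hA : ∀ i, i ∈ A ↔ Matrix.detRowAlternating (f ∘ w ∘ i.succAbove) ≠ 0) :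
    nondegeneratePart f (boundary w) = ∑ i ∈ A, signedFace w i := by
  rw [boundary, map_sum, ← Finset.sum_subset A.subset_univ]
  · refine Finset.sum_congr rfl fun i hi => ?_
    rw [signedFace, map_zsmul, nondegeneratePart_chainSymbol_of_ne_zero ((hA i).1 hi)]
  · intro i _ hi
    rw [signedFace, map_zsmul, nondegeneratePart_chainSymbol_of_eq_zero
      (not_not.1 fun h => hi ((hA i).2 h)), smul_zero]

end NondegeneratePart

section FlipRelations

variable {V : Type*} [AddCommGroup V] [Module ℝ V] {d : ℕ} {P : Set V}
  {f : V →ᵃ[ℝ] (Fin d → ℝ)} {ξ : (Fin d → ℝ) →ₗ[ℝ] ℝ} {T T' : Finset (Finset V)}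

theorem IsHomogenization.det_ne_zero_iff (hf : IsHomogenization P f ξ) {a : Fin d → V}
    (ha : ∀ i, a i ∈ P) :
    Matrix.detRowAlternating (f ∘ a) ≠ 0 ↔ AffineIndependent ℝ a :=
  det_ne_zero_iff_linearIndependent.trans (hf.linearIndependent_iff ha)

theorem IsHomogenization.not_affineIndependent_image (hf : IsHomogenization P f ξ)
    {w : Fin (d + 1) → V} (hw : ∀ i, w i ∈ P) (hinj : Function.Injective w)
    {A : Finset (Fin (d + 1))}
    (hA : ∀ i, i ∈ A ↔ Matrix.detRowAlternating (f ∘ w ∘ i.succAbove) ≠ 0) (hne : A.Nonempty) :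
    ¬ AffineIndependent ℝ (Subtype.val : {x : V // x ∈ w '' A} → V) := by
  intro hind
  let c : Fin (d + 1) → ℝ := fun i =>
    (-1) ^ (i : ℕ) * Matrix.detRowAlternating (f ∘ w ∘ i.succAbove)
  have hc : ∀ i, i ∉ A → c i = 0 := fun i hi => by simp [c, not_not.1 fun h => hi ((hA i).2 h)]
  obtain ⟨hsum, hcomb⟩ := hf.sum_eq_zero (s := Finset.univ) (w := c) hw
    (sum_det_succAbove_smul_eq_zero (f ∘ w))
  have hind' : AffineIndependent ℝ fun i : A => w i :=
    (affineIndependent_equiv (Equiv.Set.image w (A : Set (Fin (d + 1))) hinj)).2 hind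
  obtain ⟨j, hj⟩ := hne
  refine mul_ne_zero (pow_ne_zero _ (by norm_num)) ((hA j).1 hj)
    (affineIndependent_iff.1 hind' Finset.univ (fun i => c i) ?_ ?_ ⟨j, hj⟩ (Finset.mem_univ _))
  · rw [← hsum, Finset.sum_coe_sort A c]
    exact Finset.sum_subset (Finset.subset_univ _) fun i _ hi => hc i hi
  · rw [← hcomb, Finset.sum_coe_sort A fun i => c i • w i]
    exact Finset.sum_subset (Finset.subset_univ _) fun i _ hi => by rw [hc i hi, zero_smul]

theorem IsHomogenization.isCircuit (hf : IsHomogenization P f ξ) {w : Fin (d + 1) → V}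
    (hw : ∀ i, w i ∈ P) (hinj : Function.Injective w) {A : Finset (Fin (d + 1))}
    (hA : ∀ i, i ∈ A ↔ Matrix.detRowAlternating (f ∘ w ∘ i.succAbove) ≠ 0) (hne : A.Nonempty) :
    IsCircuit (w '' A) := by
  refine ⟨hf.not_affineIndependent_image hw hinj hA hne, ?_⟩
  rintro _ ⟨j, hj, rfl⟩
  have hface : AffineIndependent ℝ (w ∘ j.succAbove) :=
    (hf.det_ne_zero_iff fun i => hw _).1 ((hA j).1 hj)
  refine hface.range.mono ?_
  rintro _ ⟨⟨i, -, rfl⟩, hij⟩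
  obtain ⟨k, rfl⟩ := Fin.exists_succAbove_eq (x := i) (y := j) fun h => hij (congrArg w h)
  exact ⟨k, rfl⟩

theorem IsHomogenization.nondegeneratePart_boundary_mem (hf : IsHomogenization P f ξ)
    {w : Fin (d + 1) → V} (hw : ∀ i, w i ∈ P.extremePoints ℝ) (hinj : Function.Injective w) :
    nondegeneratePart f (boundary w) ∈ AddSubgroup.closure (flipChains P d) := by
  classical
  set A : Finset (Fin (d + 1)) :=
    Finset.univ.filter fun i => Matrix.detRowAlternating (f ∘ w ∘ i.succAbove) ≠ 0 with hAdef
  have hA : ∀ i, i ∈ A ↔ Matrix.detRowAlternating (f ∘ w ∘ i.succAbove) ≠ 0 := by simp [hAdef]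
  rw [nondegeneratePart_boundary hA]
  rcases A.eq_empty_or_nonempty with hempty | hne
  · rw [hempty, Finset.sum_empty]
    exact zero_mem _
  obtain ⟨τ, hτ⟩ := exists_perm_mem_iff_lt_card A
  have hflip : IsFlipTuple P A.card (w ∘ τ) :=
    ⟨hinj.comp τ.injective, fun i => hw _, by simpa using A.card_le_univ,
      image_comp_perm_eq_image w hτ ▸ hf.isCircuit (fun i => (hw i).1) hinj hA hne⟩
  have hmem : partialBoundary A.card (w ∘ τ) ∈ AddSubgroup.closure (flipChains P d) :=
    AddSubgroup.subset_closure ⟨_, _, hflip, rfl⟩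
  rw [partialBoundary_comp_perm w hτ] at hmem
  rcases Int.units_eq_one_or (Equiv.Perm.sign τ) with hs | hs
  · rwa [hs, one_smul] at hmem
  · rwa [hs, Units.neg_smul, one_smul, neg_mem_iff] at hmem

theorem IsHomogenization.nondegeneratePart_mem_closure (hf : IsHomogenization P f ξ)
    {x : AntisymChains V d}
    (hx : x ∈ simplexRelations (P.extremePoints ℝ) f Matrix.detRowAlternating) :
    nondegeneratePart f x ∈ AddSubgroup.closure (flipChains P d) := by
  have hle : simplexRelations (P.extremePoints ℝ) f Matrix.detRowAlternating ≤
      (AddSubgroup.closure (flipChains P d)).toIntSubmodule.comap (nondegeneratePart f) := by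
    refine simplexRelations_le_iff.2 ⟨fun a _ ha => ?_, fun w hw hinj => ?_⟩
    · rw [Submodule.mem_comap, nondegeneratePart_chainSymbol_of_eq_zero ha]
      exact zero_mem _
    · exact hf.nondegeneratePart_boundary_mem hw hinj
  exact hle hx

theorem IsTriangulation.exists_flipTuples (hT : IsTriangulation P T) (hT' : IsTriangulation P T')
    (hd : finrank ℝ (vectorSpan ℝ P) + 1 = d) (hf : IsHomogenization P f ξ) :
    ∃ (k : ℕ) (p : Fin k → ℕ) (v : Fin k → Fin (d + 1) → V),
      (∀ α, IsFlipTuple P (p α) (v α)) ∧ ∑ α, partialBoundary (p α) (v α) =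
        ∑ σ ∈ T, positiveSymbol f σ - ∑ σ ∈ T', positiveSymbol f σ := by
  have hmem := hf.nondegeneratePart_mem_closure (hT.sum_positiveSymbol_sub_mem hT' hd hf)
  rw [map_sub, map_sum, map_sum,
    Finset.sum_congr rfl fun σ hσ => nondegeneratePart_positiveSymbol f (hT.card_eq σ hσ ▸ hd),
    Finset.sum_congr rfl fun σ hσ => nondegeneratePart_positiveSymbol f (hT'.card_eq σ hσ ▸ hd)]
    at hmem
  exact exists_sum_partialBoundary_of_mem_closure hmem

end FlipRelations

section Orientation

variable {V : Type*} [AddCommGroup V] [Module ℝ V] {W : Submodule ℝ V} {n : ℕ}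

/-- The homogeneous coordinates `(1, x_1, …, x_n)` attached to a basis of the direction `W`, where
`q` is a projection onto `W`. -/
noncomputable def homogenization (b : Basis (Fin n) ℝ W) (q : V →ₗ[ℝ] W) :
    V →ᵃ[ℝ] (Fin (n + 1) → ℝ) where
  toFun x := Fin.cons 1 (b.equivFun (q x))
  linear :=
    { toFun := fun x => Fin.cons 0 (b.equivFun (q x))
      map_add' := fun x y => by
        funext i; refine Fin.cases ?_ (fun j => ?_) i <;> simp
      map_smul' := fun c x => by
        funext i; refine Fin.cases ?_ (fun j => ?_) i <;> simp }
  map_vadd' x y := by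
    funext i; refine Fin.cases ?_ (fun j => ?_) i <;> simp

theorem isHomogenization_homogenization {P : Set V} (hP : vectorSpan ℝ P ≤ W)
    (b : Basis (Fin n) ℝ W) {q : V →ₗ[ℝ] W} (hq : ∀ x : W, q x = x) :
    IsHomogenization P (homogenization b q) (LinearMap.proj 0) where
  height x _ := by simp [homogenization]
  eq_zero_of_linear_eq_zero x hx h := by
    have hcoord : b.equivFun (q x) = 0 := funext fun i => congrFun h i.succ
    have hqx : q x = 0 := b.equivFun.map_eq_zero_iff.1 hcoord
    simpa [hqx] using congrArg Subtype.val (hq ⟨x, hP hx⟩).symm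

theorem det_homogenization (b : Basis (Fin n) ℝ W) {q : V →ₗ[ℝ] W} (hq : ∀ x : W, q x = x)
    {a : Fin (n + 1) → V} {c : Fin n → W} (hc : ∀ i, (c i : V) = a i.succ - a 0) :
    Matrix.detRowAlternating (homogenization b q ∘ a) = b.det c := by
  have hsub : ∀ i, c i = q (a i.succ) - q (a 0) := fun i => by rw [← map_sub, ← hc, hq]
  have hrows : Matrix.det (Matrix.of (homogenization b q ∘ a)) = Matrix.det (Matrix.of
      (Fin.cons (homogenization b q (a 0)) (fun i => Fin.cons 0 (b.equivFun (c i))) :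
        Fin (n + 1) → Fin (n + 1) → ℝ)) := by
    refine Matrix.det_eq_of_forall_row_eq_smul_add_const (Fin.cons 0 fun _ => 1) 0 (by simp) ?_
    intro i j
    refine Fin.cases (by simp) (fun i => ?_) i
    refine Fin.cases ?_ (fun j => ?_) j <;> simp [homogenization, hsub]
  change Matrix.det (Matrix.of (homogenization b q ∘ a)) = _
  rw [hrows, Matrix.det_succ_column_zero, Fin.sum_univ_succ, Finset.sum_eq_zero (by simp),
    add_zero, Basis.det_apply, ← Matrix.det_transpose (b.toMatrix c)]
  simp only [Fin.val_zero, pow_zero, one_mul, Matrix.of_apply, Fin.cons_zero, homogenization,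
    AffineMap.coe_mk]
  congr 1

theorem exists_projection (W : Submodule ℝ V) : ∃ q : V →ₗ[ℝ] W, ∀ x : W, q x = x := by
  obtain ⟨q, hq⟩ := (LinearMap.id : W →ₗ[ℝ] W).exists_extend
  exact ⟨q, fun x => LinearMap.congr_fun hq x⟩

theorem exists_basis_orientation_eq (b : Basis (Fin n) ℝ W) {c : Fin n → W} (hc : 0 < b.det c) :
    ∃ b' : Basis (Fin n) ℝ W, b'.orientation = b.orientation ∧ b' = c := by
  obtain ⟨hli, hspan⟩ := (Module.Basis.is_basis_iff_det b).2 (isUnit_iff_ne_zero.2 hc.ne')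
  refine ⟨Basis.mk hli hspan.ge, ((Basis.orientation_eq_iff_det_pos b _).2 ?_).symm,
    Basis.coe_mk hli hspan.ge⟩
  rwa [Basis.coe_mk]

theorem inducesOrientation_iff (b : Basis (Fin n) ℝ W) {q : V →ₗ[ℝ] W} (hq : ∀ x : W, q x = x)
    {a : Fin (n + 1) → V} (ha : ∀ i, a i - a 0 ∈ W) :
    InducesOrientation b.orientation a ↔
      0 < Matrix.detRowAlternating (homogenization b q ∘ a) := by
  let c : Fin n → W := fun i => ⟨a i.succ - a 0, ha _⟩
  rw [det_homogenization b hq (c := c) fun i => rfl]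
  constructor
  · rintro ⟨b', hb', hbc⟩
    have hc : c = b' := funext fun i => Subtype.ext (hbc i).symm
    rw [hc]
    exact (Basis.orientation_eq_iff_det_pos b b').1 hb'.symm
  · intro h
    obtain ⟨b', hb', hbc⟩ := exists_basis_orientation_eq b h
    exact ⟨b', hb', fun i => by rw [hbc]⟩

theorem exists_perm_det_pos (b : Basis (Fin n) ℝ W) {q : V →ₗ[ℝ] W} (hq : ∀ x : W, q x = x)
    {a : Fin (n + 1) → V} (ha : ∀ i, a i - a 0 ∈ W)
    (hdet : Matrix.detRowAlternating (homogenization b q ∘ a) ≠ 0) :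
    ∃ π : Equiv.Perm (Fin (n + 1)),
      0 < Matrix.detRowAlternating (homogenization b q ∘ a ∘ π) := by
  rcases lt_or_gt_of_ne hdet with hneg | hpos
  · cases n with
    | zero =>
      rw [det_homogenization b hq (c := fun i => ⟨a i.succ - a 0, ha _⟩) fun i => rfl,
        Basis.det_isEmpty, AlternatingMap.constOfIsEmpty_apply] at hneg
      exact absurd hneg (by norm_num)
    | succ n =>
      refine ⟨Equiv.swap 0 1, ?_⟩
      rw [← Function.comp_assoc, AlternatingMap.map_swap _ _ (by simp)]
      exact neg_pos.2 hneg
  · exact ⟨1, hpos⟩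

theorem orientedSymbol_eq_positiveSymbol (b : Basis (Fin n) ℝ W) {q : V →ₗ[ℝ] W}
    (hq : ∀ x : W, q x = x) {σ : Finset V} (hcard : σ.card = n + 1)
    (hσ : ∀ x ∈ σ, ∀ y ∈ σ, x - y ∈ W) :
    orientedSymbol b.orientation σ = positiveSymbol (homogenization b q) σ := by
  have hdiff {a : Fin (n + 1) → V} (ha : Set.range a = σ) (i : Fin (n + 1)) : a i - a 0 ∈ W :=
    hσ _ (Finset.mem_coe.1 (ha ▸ ⟨i, rfl⟩)) _ (Finset.mem_coe.1 (ha ▸ ⟨0, rfl⟩))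
  rw [orientedSymbol]
  split_ifs with h
  · obtain ⟨hrange, hpos⟩ := h.choose_spec
    rw [inducesOrientation_iff b hq (hdiff hrange)] at hpos
    exact (positiveSymbol_eq_chainSymbol hpos hrange).symm
  · obtain ⟨a, ha, hrange⟩ := exists_injective_range_eq hcard
    have hdet : Matrix.detRowAlternating (homogenization b q ∘ a) = 0 := by
      by_contra hdet
      obtain ⟨π, hπ⟩ := exists_perm_det_pos b hq (hdiff hrange) hdet
      have hrange' : Set.range (a ∘ π) = σ := by rw [π.surjective.range_comp, hrange]
      exact h ⟨a ∘ π, hrange', (inducesOrientation_iff b hq (hdiff hrange')).2 hπ⟩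
    rw [positiveSymbol_eq _ ha hrange, hdet, sign_zero, SignType.coe_zero, zero_smul]

theorem orientedSymbol_eq_zero {o : Orientation ℝ W (Fin n)}
    (ho : ∀ b : Basis (Fin n) ℝ W, b.orientation ≠ o) (σ : Finset V) : orientedSymbol o σ = 0 :=
  dif_neg fun ⟨_, _, b, hb, _⟩ => ho b hb

end Orientation

section FlipTuples

variable {V : Type*} [AddCommGroup V] [Module ℝ V] {n : ℕ} {P : Set V} {T T' : Finset (Finset V)}

theorem vectorSpan_convexHull (S : Set V) : vectorSpan ℝ (convexHull ℝ S) = vectorSpan ℝ S := by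
  rw [← direction_affineSpan, affineSpan_convexHull, direction_affineSpan]

theorem IsTriangulation.orientedSymbol_eq_positiveSymbol (hT : IsTriangulation P T)
    (hn : finrank ℝ (vectorSpan ℝ P) = n) (b : Basis (Fin n) ℝ (vectorSpan ℝ P))
    {q : V →ₗ[ℝ] vectorSpan ℝ P} (hq : ∀ x : vectorSpan ℝ P, q x = x) {σ : Finset V}
    (hσ : σ ∈ T) : orientedSymbol b.orientation σ = positiveSymbol (homogenization b q) σ :=
  _root_.orientedSymbol_eq_positiveSymbol b hq (hn ▸ hT.card_eq σ hσ) fun _ hx _ hy =>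
    vsub_mem_vectorSpan ℝ (hT.subset hσ hx) (hT.subset hσ hy)

theorem IsTriangulation.exists_flipTuples_of_orientation (hT : IsTriangulation P T)
    (hT' : IsTriangulation P T') (hn : finrank ℝ (vectorSpan ℝ P) = n)
    (o : Orientation ℝ (vectorSpan ℝ P) (Fin n)) :
    ∃ (k : ℕ) (p : Fin k → ℕ) (v : Fin k → Fin (n + 2) → V),
      (∀ α, IsFlipTuple P (p α) (v α)) ∧ ∑ α, partialBoundary (p α) (v α) =
        ∑ w ∈ T, orientedSymbol o w - ∑ y ∈ T', orientedSymbol o y := by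
  by_cases ho : ∃ b : Basis (Fin n) ℝ (vectorSpan ℝ P), b.orientation = o
  · obtain ⟨b, rfl⟩ := ho
    obtain ⟨q, hq⟩ := exists_projection (vectorSpan ℝ P)
    rw [Finset.sum_congr rfl fun σ hσ => hT.orientedSymbol_eq_positiveSymbol hn b hq hσ,
      Finset.sum_congr rfl fun σ hσ => hT'.orientedSymbol_eq_positiveSymbol hn b hq hσ]
    exact hT.exists_flipTuples hT' (congrArg (· + 1) hn)
      (isHomogenization_homogenization le_rfl b hq)
  · exact ⟨0, Fin.elim0, Fin.elim0, fun α => α.elim0, by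
      simp [orientedSymbol_eq_zero (not_exists.1 ho)]⟩

end FlipTuples

section CircuitCombinatorics

variable {V : Type*} [DecidableEq V] {Z F : Finset V} {w : V → ℝ}

/-- The simplices opposite to the points of `Z` at which `w` is positive. If `w` is a dependency of
a circuit `Z`, they triangulate the convex hull of `Z`, and `-w` gives the other triangulation. -/
noncomputable def circuitTriangulation (Z : Finset V) (w : V → ℝ) : Finset (Finset V) :=
  (Z.filter fun z => 0 < w z).image Z.erase

theorem mem_circuitTriangulation {I : Finset V} :
    I ∈ circuitTriangulation Z w ↔ ∃ z ∈ Z, 0 < w z ∧ Z.erase z = I := by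
  simp only [circuitTriangulation, Finset.mem_image, Finset.mem_filter, and_assoc]

theorem mem_circuitSimplices {T : Finset (Finset V)} {I : Finset V} :
    I ∈ circuitSimplices Z T ↔ (∃ z ∈ Z, Z.erase z = I) ∧ ∃ σ ∈ T, I ⊆ σ := by
  simp only [circuitSimplices, Finset.mem_filter, Finset.mem_image]

theorem exists_pos_weight {y : V} (hy : y ∈ Z) (hZ : (Z.erase y).Nonempty) :
    ∃ u : V → ℝ, u y = 0 ∧ (∀ z ≠ y, 0 < u z) ∧ ∑ z ∈ Z, u z = 1 := by
  have hcard : (0 : ℝ) < (Z.erase y).card := by exact_mod_cast hZ.card_pos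
  refine ⟨fun z => if z = y then 0 else ((Z.erase y).card : ℝ)⁻¹, if_pos rfl, fun z hz => ?_, ?_⟩
  · simpa only [if_neg hz] using inv_pos.2 hcard
  · rw [← Finset.add_sum_erase _ _ hy, if_pos rfl, zero_add,
      Finset.sum_congr rfl fun z hz => if_neg (Finset.ne_of_mem_erase hz), Finset.sum_const,
      nsmul_eq_mul, mul_inv_cancel₀ hcard.ne']

end CircuitCombinatorics

section CircuitTriangulations

variable {V : Type*} [AddCommGroup V] [Module ℝ V] {Z : Finset V} {w : V → ℝ}

/-- An affine dependency of the points of `Z` none of whose coefficients vanishes. A circuit has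
such a dependency, and it is unique up to scaling. -/
structure IsCircuitWeight (Z : Finset V) (w : V → ℝ) : Prop where
  sum_eq : ∑ x ∈ Z, w x = 0
  sum_smul_eq : ∑ x ∈ Z, w x • x = 0
  ne_zero : ∀ x ∈ Z, w x ≠ 0

theorem IsCircuitWeight.neg (hw : IsCircuitWeight Z w) : IsCircuitWeight Z (-w) where
  sum_eq := by simp [hw.sum_eq]
  sum_smul_eq := by simp [hw.sum_smul_eq]
  ne_zero x hx := neg_ne_zero.2 (hw.ne_zero x hx)

theorem weight_eq_zero_of_affineIndependent {σ : Finset V}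
    (hσ : AffineIndependent ℝ (Subtype.val : {x : V // x ∈ σ} → V)) (hw : ∑ x ∈ σ, w x = 0)
    (hw' : ∑ x ∈ σ, w x • x = 0) {x : V} (hx : x ∈ σ) : w x = 0 :=
  affineIndependent_iff.1 hσ σ.attach (fun x => w x) ((σ.sum_attach w).trans hw)
    ((σ.sum_attach fun x => w x • x).trans hw') ⟨x, hx⟩ (σ.mem_attach _)

theorem IsCircuit.nonempty (hZ : IsCircuit (Z : Set V)) : Z.Nonempty :=
  Finset.card_pos.1 (by have := hZ.three_le_card; omega)

theorem IsCircuit.affineIndependent_erase [DecidableEq V] (hZ : IsCircuit (Z : Set V)) {z : V}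
    (hz : z ∈ Z) : AffineIndependent ℝ (Subtype.val : {x : V // x ∈ Z.erase z} → V) := by
  have h := hZ.2 z hz
  rwa [← Finset.coe_erase] at h

theorem IsCircuit.weight_eq_zero (hZ : IsCircuit (Z : Set V)) (hw : ∑ x ∈ Z, w x = 0)
    (hw' : ∑ x ∈ Z, w x • x = 0) {z : V} (hz : z ∈ Z) (hwz : w z = 0) {x : V} (hx : x ∈ Z) :
    w x = 0 := by
  classical
  rcases eq_or_ne x z with rfl | hxz
  · exact hwz
  refine weight_eq_zero_of_affineIndependent (hZ.affineIndependent_erase hz) ?_ ?_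
    (Finset.mem_erase.2 ⟨hxz, hx⟩)
  · rwa [Finset.sum_erase Z hwz]
  · rwa [Finset.sum_erase Z (by rw [hwz, zero_smul])]

theorem IsCircuit.exists_weight (hZ : IsCircuit (Z : Set V)) {x : V} (hx : x ∈ Z) :
    ∃ w, IsCircuitWeight Z w ∧ 0 < w x := by
  obtain ⟨w, hw', hw, y, hy, hwy⟩ := exists_nontrivial_relation_sum_zero_of_not_affine_ind hZ.1
  have h : IsCircuitWeight Z w :=
    ⟨hw, hw', fun z hz hwz => hwy (hZ.weight_eq_zero hw hw' hz hwz hy)⟩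
  rcases (h.ne_zero x hx).lt_or_gt with hneg | hpos
  · exact ⟨-w, h.neg, neg_pos.2 hneg⟩
  · exact ⟨w, h, hpos⟩

theorem IsCircuitWeight.exists_eq_mul (hw : IsCircuitWeight Z w) (hZ : IsCircuit (Z : Set V))
    {u : V → ℝ} (hu : ∑ x ∈ Z, u x = 0) (hu' : ∑ x ∈ Z, u x • x = 0) :
    ∃ t : ℝ, ∀ x ∈ Z, u x = t * w x := by
  obtain ⟨z, hz⟩ := hZ.nonempty
  refine ⟨u z / w z, fun x hx => sub_eq_zero.1 ?_⟩
  refine hZ.weight_eq_zero (w := fun x => u x - u z / w z * w x) ?_ ?_ hz ?_ hx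
  · rw [Finset.sum_sub_distrib, ← Finset.mul_sum, hu, hw.sum_eq, mul_zero, sub_zero]
  · simp only [sub_smul, mul_smul]
    rw [Finset.sum_sub_distrib, ← Finset.smul_sum, hu', hw.sum_smul_eq, smul_zero, sub_zero]
  · rw [div_mul_cancel₀ _ (hw.ne_zero z hz), sub_self]

theorem IsCircuitWeight.filter_not_pos_eq (hw : IsCircuitWeight Z w) :
    (Z.filter fun z => ¬ 0 < w z) = Z.filter fun z => w z < 0 :=
  Finset.filter_congr fun z hz => not_lt.trans (hw.ne_zero z hz).le_iff_lt

theorem IsCircuitWeight.sum_pos_add_sum_neg {M : Type*} [AddCommMonoid M]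
    (hw : IsCircuitWeight Z w) (g : V → M) :
    ∑ z ∈ Z with 0 < w z, g z + ∑ z ∈ Z with w z < 0, g z = ∑ z ∈ Z, g z := by
  rw [← hw.filter_not_pos_eq, Finset.sum_filter_add_sum_filter_not]

theorem IsCircuitWeight.exists_mem_convexHull_pos_neg (hw : IsCircuitWeight Z w) {x : V}
    (hx : x ∈ Z) (hwx : 0 < w x) :
    ∃ r ∈ convexHull ℝ (Z.filter fun z => 0 < w z : Set V),
      r ∈ convexHull ℝ (Z.filter fun z => w z < 0 : Set V) := by
  have hsum := (hw.sum_pos_add_sum_neg w).trans hw.sum_eq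
  have hsum_smul := (hw.sum_pos_add_sum_neg fun z => w z • z).trans hw.sum_smul_eq
  have hpos : 0 < ∑ z ∈ Z with 0 < w z, w z :=
    Finset.sum_pos (fun z hz => (Finset.mem_filter.1 hz).2) ⟨x, Finset.mem_filter.2 ⟨hx, hwx⟩⟩
  refine ⟨(Z.filter fun z => 0 < w z).centerMass w id,
    Finset.centerMass_mem_convexHull _ (fun z hz => (Finset.mem_filter.1 hz).2.le) hpos
      fun z hz => hz, ?_⟩
  rw [Finset.centerMass_of_sum_add_sum_eq_zero (z := id) hsum hsum_smul]
  exact Finset.centerMass_mem_convexHull_of_nonpos _ (fun z hz => (Finset.mem_filter.1 hz).2.le)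
    (by linarith) fun z hz => hz

variable {P : Set V} {T : Finset (Finset V)}

theorem IsTriangulation.not_subset (hT : IsTriangulation P T) (hZ : IsCircuit (Z : Set V))
    {σ : Finset V} (hσ : σ ∈ T) : ¬ Z ⊆ σ := fun h =>
  hZ.1 (AffineIndependent.mono (s := (Z : Set V)) (t := (σ : Set V)) (hT.indep σ hσ) h)

/-- The Radon point of the dependency would lie in the common face of the two simplices, hence in
two disjoint faces of it. -/
theorem IsTriangulation.not_subset_of_sign (hT : IsTriangulation P T)
    (hw : IsCircuitWeight Z w) {x : V} (hx : x ∈ Z) (hwx : 0 < w x) {σ τ : Finset V} (hσ : σ ∈ T)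
    (hτ : τ ∈ T) (hσ_neg : (Z.filter fun z => w z < 0) ⊆ σ) :
    ¬ (Z.filter fun z => 0 < w z) ⊆ τ := by
  classical
  intro hτ_pos
  obtain ⟨r, hr_pos, hr_neg⟩ := hw.exists_mem_convexHull_pos_neg hx hwx
  have hrστ : r ∈ convexHull ℝ ((σ ∩ τ : Finset V) : Set V) := by
    rw [Finset.coe_inter]
    rcases eq_or_ne σ τ with rfl | hne
    · rw [Set.inter_self]
      exact convexHull_mono (Finset.coe_subset.2 hσ_neg) hr_neg
    · rw [← hT.inter σ hσ τ hτ hne]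
      exact ⟨convexHull_mono (Finset.coe_subset.2 hσ_neg) hr_neg,
        convexHull_mono (Finset.coe_subset.2 hτ_pos) hr_pos⟩
  have hr_face : r ∈ convexHull ℝ ((σ ∩ τ ∩ Z.filter fun z => 0 < w z : Finset V) : Set V) := by
    rw [Finset.coe_inter,
      AffineIndependent.convexHull_inter (hT.indep τ hτ) Finset.inter_subset_right hτ_pos]
    exact ⟨hrστ, hr_pos⟩
  have hr_empty := (AffineIndependent.convexHull_inter (hT.indep σ hσ)
    (Finset.inter_subset_left.trans Finset.inter_subset_left) hσ_neg).superset ⟨hr_face, hr_neg⟩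
  obtain ⟨z, hz_pos, hz_neg⟩ := convexHull_nonempty_iff.1 ⟨r, hr_empty⟩
  exact lt_asymm (Finset.mem_filter.1 (Finset.mem_inter.1 hz_pos).2).2
    (Finset.mem_filter.1 hz_neg).2

theorem IsCircuit.finrank_vectorSpan_add_two (hZ : IsCircuit (Z : Set V)) :
    finrank ℝ (vectorSpan ℝ (Z : Set V)) + 2 = Z.card := by
  classical
  obtain ⟨m, hm⟩ : ∃ m, Z.card = m + 2 := ⟨Z.card - 2, by have := hZ.three_le_card; omega⟩
  obtain ⟨z, hz⟩ := hZ.nonempty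
  have hfin : FiniteDimensional ℝ (vectorSpan ℝ (Z : Set V)) :=
    finiteDimensional_vectorSpan_of_finite ℝ Z.finite_toSet
  have hle := (finrank_vectorSpan_le_iff_not_affineIndependent ℝ
    (Subtype.val : {x : V // x ∈ Z} → V) ((Fintype.card_coe Z).trans hm)).2 hZ.1
  have hface := (hZ.affineIndependent_erase hz).finrank_vectorSpan (n := m) (by
    rw [Fintype.card_coe, Finset.card_erase_of_mem hz]; omega)
  have hspan (s : Finset V) :
      finrank ℝ (vectorSpan ℝ (Set.range (Subtype.val : {x // x ∈ s} → V))) =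
        finrank ℝ (vectorSpan ℝ (s : Set V)) :=
    congrArg (fun t : Set V => finrank ℝ (vectorSpan ℝ t)) Subtype.range_coe
  rw [hspan] at hle hface
  have hmono := Submodule.finrank_mono (vectorSpan_mono ℝ (Finset.coe_subset.2 (Z.erase_subset z)))
  exact (congrArg (· + 2) (le_antisymm hle (hface.ge.trans hmono))).trans hm.symm

variable [DecidableEq V]

theorem IsTriangulation.exists_eq_erase (hT : IsTriangulation (convexHull ℝ (Z : Set V)) T)
    (hZ : IsCircuit (Z : Set V)) {σ : Finset V} (hσ : σ ∈ T) : ∃ z ∈ Z, Z.erase z = σ := by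
  have hsub : σ ⊆ Z := fun x hx => extremePoints_convexHull_subset (hT.vertices σ hσ hx)
  have hcard := hT.card_eq σ hσ
  rw [vectorSpan_convexHull] at hcard
  have hsdiff : (Z \ σ).card = 1 := by
    rw [Finset.card_sdiff_of_subset hsub, ← hZ.finrank_vectorSpan_add_two]
    omega
  obtain ⟨z, hz, rfl⟩ :=
    (Finset.covBy_iff_card_sdiff_eq_one.2 ⟨hsub, hsdiff⟩).exists_finset_insert
  exact ⟨z, by simp, Finset.erase_insert hz⟩

theorem exists_weight_of_mem_convexHull_erase {r y : V} (hy : y ∈ Z)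
    (hr : r ∈ convexHull ℝ (Z.erase y : Set V)) :
    ∃ u : V → ℝ, (∀ z ∈ Z, 0 ≤ u z) ∧ u y = 0 ∧ ∑ z ∈ Z, u z = 1 ∧ ∑ z ∈ Z, u z • z = r := by
  obtain ⟨u, hu, hu_sum, hu_smul⟩ := Finset.mem_convexHull'.1 hr
  have hu_ne {z : V} (hz : z ∈ Z.erase y) : Function.update u y 0 z = u z :=
    Function.update_of_ne (Finset.ne_of_mem_erase hz) _ _
  refine ⟨Function.update u y 0, fun z hz => ?_, Function.update_self .., ?_, ?_⟩
  · rcases eq_or_ne z y with rfl | hzy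
    · rw [Function.update_self]
    · rw [hu_ne (Finset.mem_erase.2 ⟨hzy, hz⟩)]
      exact hu z (Finset.mem_erase.2 ⟨hzy, hz⟩)
  · rw [← Finset.add_sum_erase _ _ hy, Function.update_self, zero_add, ← hu_sum]
    exact Finset.sum_congr rfl fun z hz => hu_ne hz
  · rw [← Finset.add_sum_erase _ _ hy, Function.update_self, zero_smul, zero_add, ← hu_smul]
    exact Finset.sum_congr rfl fun z hz => by rw [hu_ne hz]

theorem IsCircuitWeight.notMem_convexHull_erase (hw : IsCircuitWeight Z w)
    (hZ : IsCircuit (Z : Set V)) {x y : V} (hx : x ∈ Z) (hy : y ∈ Z) (hwx : 0 < w x) (hwy : 0 < w y)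
    {u : V → ℝ} (hu : ∑ z ∈ Z, u z = 1) (hux : 0 < u x) (huy : u y = 0) :
    ∑ z ∈ Z, u z • z ∉ convexHull ℝ (Z.erase x : Set V) := by
  intro hmem
  obtain ⟨u', hu'_nonneg, hu'x, hu'_sum, hu'_smul⟩ := exists_weight_of_mem_convexHull_erase hx hmem
  obtain ⟨t, ht⟩ := hw.exists_eq_mul hZ (u := fun z => u z - u' z)
    (by rw [Finset.sum_sub_distrib, hu, hu'_sum, sub_self])
    (by simp only [sub_smul, Finset.sum_sub_distrib, hu'_smul, sub_self])
  have htx : u x - u' x = t * w x := ht x hx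
  have hty : u y - u' y = t * w y := ht y hy
  have ht_pos : 0 < t := by
    rw [hu'x, sub_zero] at htx
    exact pos_of_mul_pos_left (htx ▸ hux) hwx.le
  have := mul_pos ht_pos hwy
  linarith [hu'_nonneg y hy]

theorem IsTriangulation.weight_pos_of_erase_subset (hT : IsTriangulation P T)
    (hw : IsCircuitWeight Z w) {x y : V} (hx : x ∈ Z) (hwx : 0 < w x) {σ τ : Finset V}
    (hσ : σ ∈ T) (hτ : τ ∈ T) (hxσ : Z.erase x ⊆ σ) (hyτ : Z.erase y ⊆ τ) : 0 < w y := by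
  by_contra hwy
  refine hT.not_subset_of_sign hw hx hwx hσ hτ (Finset.Subset.trans (fun z hz => ?_) hxσ)
    (Finset.Subset.trans (fun z hz => ?_) hyτ) <;> obtain ⟨hz, hwz⟩ := Finset.mem_filter.1 hz
  · exact Finset.mem_erase.2 ⟨fun h => lt_asymm hwx (h ▸ hwz), hz⟩
  · exact Finset.mem_erase.2 ⟨fun h => hwy (h ▸ hwz), hz⟩

/-- The barycentre of a simplex opposite to a point of positive weight lies in no other such
simplex. -/
theorem IsCircuitWeight.triangulation_eq (hw : IsCircuitWeight Z w) (hZ : IsCircuit (Z : Set V))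
    (hT : IsTriangulation (convexHull ℝ (Z : Set V)) T) {x : V} (hx : x ∈ Z) (hwx : 0 < w x)
    (hxT : Z.erase x ∈ T) : T = circuitTriangulation Z w := by
  have hpos {y : V} (hyT : Z.erase y ∈ T) : 0 < w y :=
    hT.weight_pos_of_erase_subset hw hx hwx hxT hyT subset_rfl subset_rfl
  ext σ
  rw [mem_circuitTriangulation]
  constructor
  · intro hσ
    obtain ⟨y, hy, rfl⟩ := hT.exists_eq_erase hZ hσ
    exact ⟨y, hy, hpos hσ, rfl⟩
  · rintro ⟨y, hy, hwy, rfl⟩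
    have hZy : (Z.erase y).Nonempty := Finset.card_pos.1 (by
      have := hZ.three_le_card
      rw [Finset.card_erase_of_mem hy]
      omega)
    obtain ⟨u, huy, hu_pos, hu_sum⟩ := exists_pos_weight hy hZy
    have hu_nonneg (z : V) : 0 ≤ u z := by
      rcases eq_or_ne z y with rfl | hz
      exacts [huy.ge, (hu_pos z hz).le]
    have hmem : ∑ z ∈ Z, u z • z ∈ convexHull ℝ (Z : Set V) :=
      (convex_convexHull ℝ _).sum_mem (fun z _ => hu_nonneg z) hu_sum fun z hz =>
        subset_convexHull ℝ _ hz
    rw [← hT.cover] at hmem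
    obtain ⟨σ, hσ, hmem⟩ := Set.mem_iUnion₂.1 hmem
    obtain ⟨y', hy', rfl⟩ := hT.exists_eq_erase hZ hσ
    rcases eq_or_ne y' y with rfl | hne
    · exact hσ
    · exact absurd hmem
        (hw.notMem_convexHull_erase hZ hy' hy (hpos hσ) hwy hu_sum (hu_pos y' hne) huy)

end CircuitTriangulations

section Flips

variable {V : Type*} [DecidableEq V] {Z F I J : Finset V} {w : V → ℝ}

theorem subset_of_mem_circuitTriangulation (hI : I ∈ circuitTriangulation Z w) : I ⊆ Z := by
  obtain ⟨z, -, -, rfl⟩ := mem_circuitTriangulation.1 hI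
  exact Z.erase_subset z

theorem card_of_mem_circuitTriangulation (hI : I ∈ circuitTriangulation Z w) :
    I.card + 1 = Z.card := by
  obtain ⟨z, hz, -, rfl⟩ := mem_circuitTriangulation.1 hI
  exact Finset.card_erase_add_one hz

theorem disjoint_circuitTriangulation_neg (Z : Finset V) (w : V → ℝ) :
    Disjoint (circuitTriangulation Z w) (circuitTriangulation Z (-w)) := by
  refine Finset.disjoint_left.2 fun I hI hI' => ?_
  obtain ⟨z, hz, hwz, rfl⟩ := mem_circuitTriangulation.1 hI
  obtain ⟨y, hy, hwy, hyz⟩ := mem_circuitTriangulation.1 hI'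
  obtain rfl := Z.erase_injOn hy hz hyz
  exact lt_asymm hwz (neg_pos.1 hwy)

theorem circuitTriangulation_union_neg (hw : ∀ z ∈ Z, w z ≠ 0) :
    circuitTriangulation Z w ∪ circuitTriangulation Z (-w) = Z.image Z.erase := by
  rw [circuitTriangulation, circuitTriangulation, ← Finset.image_union, ← Finset.filter_or,
    Finset.filter_true_of_mem fun z hz => ?_]
  exact (hw z hz).lt_or_gt.symm.imp_right neg_pos.2

theorem sum_circuitTriangulation_sub {M : Type*} [AddCommGroup M] (hw : ∀ z ∈ Z, w z ≠ 0)
    (g : Finset V → M) :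
    ∑ I ∈ circuitTriangulation Z w, g I - ∑ J ∈ circuitTriangulation Z (-w), g J =
      ∑ z ∈ Z, (SignType.sign (w z) : ℤ) • g (Z.erase z) := by
  have hsum (u : V → ℝ) :
      ∑ I ∈ circuitTriangulation Z u, g I = ∑ z ∈ Z, if 0 < u z then g (Z.erase z) else 0 := by
    rw [circuitTriangulation, Finset.sum_image, Finset.sum_filter]
    exact Z.erase_injOn.mono fun z hz => (Finset.mem_filter.1 hz).1
  rw [hsum, hsum, ← Finset.sum_sub_distrib]
  refine Finset.sum_congr rfl fun z hz => ?_
  rcases (hw z hz).lt_or_gt with h | h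
  · simp [h, h.le]
  · simp [h, h.le]

theorem union_sdiff_eq_right (hI : I ⊆ Z) (hF : Disjoint F Z) : (I ∪ F) \ Z = F := by
  rw [Finset.union_sdiff_distrib, Finset.sdiff_eq_empty_iff_subset.2 hI, Finset.empty_union,
    Finset.sdiff_eq_self_of_disjoint hF]

theorem union_inter_eq_left (hI : I ⊆ Z) (hF : Disjoint F Z) : (I ∪ F) ∩ Z = I := by
  rw [Finset.union_inter_distrib_right, Finset.inter_eq_left.2 hI,
    Finset.disjoint_iff_inter_eq_empty.1 hF, Finset.union_empty]

theorem union_erase_of_disjoint (hF : Disjoint F Z) {z : V} (hz : z ∈ Z) :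
    (Z ∪ F).erase z = Z.erase z ∪ F := by
  rw [Finset.erase_union_distrib, Finset.erase_eq_of_notMem (Finset.disjoint_right.1 hF hz)]

theorem injOn_union_right (hF : Disjoint F Z) :
    Set.InjOn (· ∪ F) (circuitTriangulation Z w : Set (Finset V)) := fun I hI J hJ hIJ => by
  replace hIJ : I ∪ F = J ∪ F := hIJ
  rw [← union_inter_eq_left (subset_of_mem_circuitTriangulation hI) hF, hIJ,
    union_inter_eq_left (subset_of_mem_circuitTriangulation hJ) hF]

variable [AddCommGroup V] [Module ℝ V] {P : Set V} {T T₁ T₂ : Finset (Finset V)}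

theorem IsCircuitWeight.exists_mem_circuitTriangulation (hw : IsCircuitWeight Z w)
    (hZ : Z.Nonempty) : ∃ I, I ∈ circuitTriangulation Z w := by
  obtain ⟨x, hx⟩ := hZ
  obtain ⟨z, hz, hwz⟩ :=
    Finset.exists_pos_of_sum_zero_of_exists_nonzero w hw.sum_eq ⟨x, hx, hw.ne_zero x hx⟩
  exact ⟨Z.erase z, mem_circuitTriangulation.2 ⟨z, hz, hwz, rfl⟩⟩

theorem IsTriangulation.union_sdiff_eq_self (hT : IsTriangulation P T)
    (hZ : IsCircuit (Z : Set V)) (hI : I ∈ circuitTriangulation Z w) {σ : Finset V} (hσ : σ ∈ T)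
    (hIσ : I ⊆ σ) : I ∪ (σ \ Z) = σ := by
  obtain ⟨z, hz, -, rfl⟩ := mem_circuitTriangulation.1 hI
  have hzσ : z ∉ σ := fun hzσ =>
    hT.not_subset hZ hσ (Finset.insert_erase hz ▸ Finset.insert_subset hzσ hIσ)
  refine (Finset.union_subset hIσ Finset.sdiff_subset).antisymm fun y hy => ?_
  by_cases hyZ : y ∈ Z
  · exact Finset.mem_union_left _ (Finset.mem_erase.2 ⟨ne_of_mem_of_not_mem hy hzσ, hyZ⟩)
  · exact Finset.mem_union_right _ (Finset.mem_sdiff.2 ⟨hy, hyZ⟩)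

theorem IsTriangulation.circuitSimplices_eq (hT : IsTriangulation P T)
    (hZ : Z.Nonempty) (hw : IsCircuitWeight Z w)
    (hsub : ∀ I ∈ circuitTriangulation Z w, ∃ σ ∈ T, I ⊆ σ) :
    circuitSimplices Z T = circuitTriangulation Z w := by
  ext I
  rw [mem_circuitSimplices, mem_circuitTriangulation]
  constructor
  · rintro ⟨⟨z, hz, rfl⟩, τ, hτ, hzτ⟩
    obtain ⟨I, hI⟩ := hw.exists_mem_circuitTriangulation hZ
    obtain ⟨σ, hσ, hIσ⟩ := hsub I hI
    obtain ⟨x, hx, hwx, rfl⟩ := mem_circuitTriangulation.1 hI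
    exact ⟨z, hz, hT.weight_pos_of_erase_subset hw hx hwx hσ hτ hIσ hzτ, rfl⟩
  · rintro ⟨z, hz, hwz, rfl⟩
    exact ⟨⟨z, hz, rfl⟩, hsub _ (mem_circuitTriangulation.2 ⟨z, hz, hwz, rfl⟩)⟩

/-- A flip from `T₁` to `T₂` along `Z`, the two triangulations of the convex hull of `Z` being
encoded by the signs of an affine dependency `w` of `Z`. -/
structure IsWeightedFlip (T₁ T₂ : Finset (Finset V)) (Z : Finset V) (w : V → ℝ) : Prop where
  circuit : IsCircuit (Z : Set V)
  weight : IsCircuitWeight Z w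
  exists_superset : ∀ I ∈ circuitTriangulation Z w, ∃ σ ∈ T₁, I ⊆ σ
  link : ∀ I ∈ circuitTriangulation Z w, ∀ I' ∈ circuitTriangulation Z w, ∀ F : Finset V,
    Disjoint F Z → I ∪ F ∈ T₁ → I' ∪ F ∈ T₁
  mem_iff : ∀ σ : Finset V, σ ∈ T₂ ↔
    (σ ∈ T₁ ∧ ∀ I ∈ circuitTriangulation Z w, ¬ I ⊆ σ) ∨
    (∃ J ∈ circuitTriangulation Z (-w), ∃ F : Finset V, Disjoint F Z ∧ σ = J ∪ F ∧
      ∃ I ∈ circuitTriangulation Z w, I ∪ F ∈ T₁)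

theorem IsFlip.exists_weightedFlip (h : IsFlip P T₁ T₂ Z) : ∃ w, IsWeightedFlip T₁ T₂ Z w := by
  obtain ⟨hZ, -, Tp, Tm, hTp, hTm, hne, hsub, hlink, hmem⟩ := h
  have hexists {T : Finset (Finset V)} (hT : IsTriangulation (convexHull ℝ (Z : Set V)) T) :
      ∃ z ∈ Z, Z.erase z ∈ T := by
    obtain ⟨x, hx⟩ := hZ.nonempty
    have hxT := subset_convexHull ℝ (Z : Set V) hx
    rw [← hT.cover] at hxT
    obtain ⟨σ, hσ, -⟩ := Set.mem_iUnion₂.1 hxT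
    obtain ⟨z, hz, rfl⟩ := hT.exists_eq_erase hZ hσ
    exact ⟨z, hz, hσ⟩
  obtain ⟨x, hx, hxT⟩ := hexists hTp
  obtain ⟨y, hy, hyT⟩ := hexists hTm
  obtain ⟨w, hw, hwx⟩ := hZ.exists_weight hx
  obtain rfl := hw.triangulation_eq hZ hTp hx hwx hxT
  have hwy : w y < 0 := (hw.ne_zero y hy).lt_or_gt.resolve_right fun hwy =>
    hne (hw.triangulation_eq hZ hTm hy hwy hyT).symm
  obtain rfl := hw.neg.triangulation_eq hZ hTm hy (neg_pos.2 hwy) hyT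
  exact ⟨w, hZ, hw, hsub, hlink, hmem⟩

namespace IsWeightedFlip

theorem circuitSimplices_left (h : IsWeightedFlip T₁ T₂ Z w) (hT₁ : IsTriangulation P T₁) :
    circuitSimplices Z T₁ = circuitTriangulation Z w :=
  hT₁.circuitSimplices_eq h.circuit.nonempty h.weight h.exists_superset

theorem circuitSimplices_right (h : IsWeightedFlip T₁ T₂ Z w) (hT₁ : IsTriangulation P T₁)
    (hT₂ : IsTriangulation P T₂) : circuitSimplices Z T₂ = circuitTriangulation Z (-w) := by
  obtain ⟨I, hI⟩ := h.weight.exists_mem_circuitTriangulation h.circuit.nonempty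
  obtain ⟨σ, hσ, hIσ⟩ := h.exists_superset I hI
  rw [← hT₁.union_sdiff_eq_self h.circuit hI hσ hIσ] at hσ
  exact hT₂.circuitSimplices_eq h.circuit.nonempty h.weight.neg fun J hJ =>
    ⟨J ∪ σ \ Z, (h.mem_iff _).2 (.inr ⟨J, hJ, _, Finset.sdiff_disjoint, rfl, I, hI, hσ⟩),
      Finset.subset_union_left⟩

theorem exists_link (h : IsWeightedFlip T₁ T₂ Z w) (hT₁ : IsTriangulation P T₁)
    {σ : Finset V} (hσ : σ ∈ T₁ \ T₂) :
    ∃ I ∈ circuitTriangulation Z w, I ∪ (σ \ Z) = σ := by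
  obtain ⟨hσ₁, hσ₂⟩ := Finset.mem_sdiff.1 hσ
  obtain ⟨I, hI, hIσ⟩ : ∃ I ∈ circuitTriangulation Z w, I ⊆ σ := by
    by_contra! hcon
    exact hσ₂ ((h.mem_iff σ).2 (.inl ⟨hσ₁, hcon⟩))
  exact ⟨I, hI, hT₁.union_sdiff_eq_self h.circuit hI hσ₁ hIσ⟩

theorem filter_removed_eq (h : IsWeightedFlip T₁ T₂ Z w) (hT₁ : IsTriangulation P T₁)
    (hF : Disjoint F Z) (hI : I ∈ circuitTriangulation Z w) (hIF : I ∪ F ∈ T₁) :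
    {s ∈ T₁ \ T₂ | s \ Z = F} = (circuitTriangulation Z w).image (· ∪ F) := by
  ext σ
  rw [Finset.mem_filter, Finset.mem_image]
  constructor
  · rintro ⟨hσ, rfl⟩
    exact h.exists_link hT₁ hσ
  · rintro ⟨I', hI', rfl⟩
    have hI'Z := subset_of_mem_circuitTriangulation hI'
    refine ⟨Finset.mem_sdiff.2 ⟨h.link I hI I' hI' F hF hIF, fun hmem => ?_⟩,
      union_sdiff_eq_right hI'Z hF⟩
    rcases (h.mem_iff _).1 hmem with ⟨-, hnot⟩ | ⟨J, hJ, F', hF', hIJ, -⟩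
    · exact hnot I' hI' Finset.subset_union_left
    · have : I' = J := by
        rw [← union_inter_eq_left hI'Z hF, hIJ,
          union_inter_eq_left (subset_of_mem_circuitTriangulation hJ) hF']
      exact Finset.disjoint_left.1 (disjoint_circuitTriangulation_neg Z w) hI' (this ▸ hJ)

theorem filter_added_eq (h : IsWeightedFlip T₁ T₂ Z w) (hT₁ : IsTriangulation P T₁)
    (hF : Disjoint F Z) (hI : I ∈ circuitTriangulation Z w) (hIF : I ∪ F ∈ T₁) :
    {s ∈ T₂ \ T₁ | s \ Z = F} = (circuitTriangulation Z (-w)).image (· ∪ F) := by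
  ext σ
  rw [Finset.mem_filter, Finset.mem_sdiff, Finset.mem_image]
  constructor
  · rintro ⟨⟨hσ₂, hσ₁⟩, rfl⟩
    rcases (h.mem_iff σ).1 hσ₂ with ⟨hσ, -⟩ | ⟨J, hJ, F', hF', rfl, -⟩
    · exact absurd hσ hσ₁
    · exact ⟨J, hJ, by rw [union_sdiff_eq_right (subset_of_mem_circuitTriangulation hJ) hF']⟩
  · rintro ⟨J, hJ, rfl⟩
    refine ⟨⟨(h.mem_iff _).2 (.inr ⟨J, hJ, F, hF, rfl, I, hI, hIF⟩), fun hmem => ?_⟩,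
      union_sdiff_eq_right (subset_of_mem_circuitTriangulation hJ) hF⟩
    obtain ⟨x, hx, hwx, rfl⟩ := mem_circuitTriangulation.1 hI
    obtain ⟨y, -, hwy, rfl⟩ := mem_circuitTriangulation.1 hJ
    exact lt_asymm (neg_pos.1 hwy) (hT₁.weight_pos_of_erase_subset h.weight hx hwx hIF hmem
      Finset.subset_union_left Finset.subset_union_left)

theorem disjoint_circuitSimplices (h : IsWeightedFlip T₁ T₂ Z w) (hT₁ : IsTriangulation P T₁)
    (hT₂ : IsTriangulation P T₂) : Disjoint (circuitSimplices Z T₁) (circuitSimplices Z T₂) := by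
  rw [h.circuitSimplices_left hT₁, h.circuitSimplices_right hT₁ hT₂]
  exact disjoint_circuitTriangulation_neg Z w

theorem circuitSimplices_union (h : IsWeightedFlip T₁ T₂ Z w) (hT₁ : IsTriangulation P T₁)
    (hT₂ : IsTriangulation P T₂) :
    circuitSimplices Z T₁ ∪ circuitSimplices Z T₂ = Z.image Z.erase := by
  rw [h.circuitSimplices_left hT₁, h.circuitSimplices_right hT₁ hT₂]
  exact circuitTriangulation_union_neg h.weight.ne_zero

theorem circuitSimplices_eq_sdiff (h : IsWeightedFlip T₁ T₂ Z w) (hT₁ : IsTriangulation P T₁)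
    (hT₂ : IsTriangulation P T₂) (hZ : Z.card = finrank ℝ (vectorSpan ℝ P) + 2) :
    circuitSimplices Z T₁ = T₁ \ T₂ ∧ circuitSimplices Z T₂ = T₂ \ T₁ := by
  have heq_empty {T : Finset (Finset V)} (hT : IsTriangulation P T) {u : V → ℝ} {I F : Finset V}
      (hI : I ∈ circuitTriangulation Z u) (hF : Disjoint F Z) (hIF : I ∪ F ∈ T) : F = ∅ := by
    have hcard := hT.card_eq _ hIF
    rw [Finset.card_union_of_disjoint
      (hF.symm.mono_left (subset_of_mem_circuitTriangulation hI))] at hcard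
    exact Finset.card_eq_zero.1 (by have := card_of_mem_circuitTriangulation hI; omega)
  obtain ⟨I, hI⟩ := h.weight.exists_mem_circuitTriangulation h.circuit.nonempty
  obtain ⟨σ, hσ, hIσ⟩ := h.exists_superset I hI
  rw [← hT₁.union_sdiff_eq_self h.circuit hI hσ hIσ] at hσ
  have hIT : I ∪ ∅ ∈ T₁ := heq_empty hT₁ hI Finset.sdiff_disjoint hσ ▸ hσ
  have hremoved := h.filter_removed_eq hT₁ (Finset.disjoint_empty_left Z) hI hIT
  have hadded := h.filter_added_eq hT₁ (Finset.disjoint_empty_left Z) hI hIT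
  simp only [Finset.union_empty, Finset.image_id'] at hremoved hadded
  rw [h.circuitSimplices_left hT₁, h.circuitSimplices_right hT₁ hT₂, ← hremoved, ← hadded]
  refine ⟨Finset.filter_true_of_mem fun τ hτ => ?_, Finset.filter_true_of_mem fun τ hτ => ?_⟩
  · obtain ⟨I', hI', hτ_eq⟩ := h.exists_link hT₁ hτ
    exact heq_empty hT₁ hI' Finset.sdiff_disjoint 
      (by rw [hτ_eq]; exact (Finset.mem_sdiff.1 hτ).1)
  · obtain ⟨hτ₂, hτ₁⟩ := Finset.mem_sdiff.1 hτ
    rcases (h.mem_iff τ).1 hτ₂ with ⟨hτ, -⟩ | ⟨J, hJ, F, hF, rfl, -⟩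
    · exact absurd hτ hτ₁
    · rw [union_sdiff_eq_right (subset_of_mem_circuitTriangulation hJ) hF]
      exact heq_empty hT₂ hJ hF hτ₂

end IsWeightedFlip

end Flips

section FlipFormulas

theorem exists_det_succAbove_eq_mul {d : ℕ} {y : Fin (d + 1) → Fin d → ℝ} {μ : Fin (d + 1) → ℝ}
    (hμ : ∑ i, μ i • y i = 0) {j : Fin (d + 1)} (hμj : μ j ≠ 0)
    (hdet : Matrix.detRowAlternating (y ∘ j.succAbove) ≠ 0) :
    ∃ c ≠ 0, ∀ i : Fin (d + 1),
      (-1 : ℝ) ^ (i : ℕ) * Matrix.detRowAlternating (y ∘ i.succAbove) = c * μ i := by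
  set δ : Fin (d + 1) → ℝ := fun i => (-1) ^ (i : ℕ) * Matrix.detRowAlternating (y ∘ i.succAbove)
  have hδ : ∑ i, δ i • y i = 0 := sum_det_succAbove_smul_eq_zero y
  have hδj : δ j ≠ 0 := mul_ne_zero (pow_ne_zero _ (by norm_num)) hdet
  refine ⟨δ j / μ j, div_ne_zero hδj hμj, fun i => sub_eq_zero.1 ?_⟩
  have hj : δ j - δ j / μ j * μ j = 0 := by rw [div_mul_cancel₀ _ hμj, sub_self]
  rcases Fin.eq_self_or_eq_succAbove j i with rfl | ⟨k, rfl⟩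
  · exact hj
  refine Fintype.linearIndependent_iff.1 (det_ne_zero_iff_linearIndependent.1 hdet)
    (fun k => δ (j.succAbove k) - δ j / μ j * μ (j.succAbove k)) ?_ k
  have hsum : ∑ i, (δ i - δ j / μ j * μ i) • y i = 0 := by
    simp only [sub_smul, mul_smul]
    rw [Finset.sum_sub_distrib, ← Finset.smul_sum, hδ, hμ, smul_zero, sub_zero]
  rwa [Fin.sum_univ_succAbove _ j, hj, zero_smul, zero_add] at hsum

variable {V : Type*} [DecidableEq V] {d n : ℕ} {Z F : Finset V} {w : V → ℝ}

theorem range_comp_succAbove {v : Fin (d + 1) → V} (hv : Function.Injective v) {R : Finset V}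
    (hR : Set.range v = R) (i : Fin (d + 1)) :
    Set.range (v ∘ i.succAbove) = (R.erase (v i) : Set V) := by
  rw [Set.range_comp, Fin.range_succAbove, Finset.coe_erase, ← hR, Set.compl_eq_univ_sdiff,
    Set.image_sdiff hv, Set.image_univ, Set.image_singleton]

theorem sum_filter_mem_comp {ι M : Type*} [Fintype ι] [AddCommMonoid M] {v : ι → V}
    (hv : Function.Injective v) (hZ : (Z : Set V) ⊆ Set.range v) (g : V → M) :
    ∑ i with v i ∈ Z, g (v i) = ∑ z ∈ Z, g z :=
  Finset.sum_nbij v (fun i hi => (Finset.mem_filter.1 hi).2) hv.injOn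
    (fun z hz => by obtain ⟨i, rfl⟩ := hZ hz; exact ⟨i, by simpa using hz, rfl⟩) fun _ _ => rfl

theorem exists_unit_mul_eq_sign_mul_sign_det {y : Fin (d + 1) → Fin d → ℝ}
    {μ : Fin (d + 1) → ℝ} (hμ : ∑ i, μ i • y i = 0) {j : Fin (d + 1)} (hμj : μ j ≠ 0)
    (hdet : Matrix.detRowAlternating (y ∘ j.succAbove) ≠ 0) :
    ∃ e : ℤˣ, ∀ i : Fin (d + 1), μ i ≠ 0 →
      (e : ℤ) * (-1) ^ ((i : ℕ) + 1) = (SignType.sign (μ i) : ℤ) *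
        (SignType.sign (Matrix.detRowAlternating (y ∘ i.succAbove)) : ℤ) := by
  obtain ⟨c, hc, hcμ⟩ := exists_det_succAbove_eq_mul hμ hμj hdet
  obtain ⟨e, he⟩ : ∃ e : ℤˣ, (e : ℤ) = -(SignType.sign c : ℤ) := by
    rcases hc.lt_or_gt with h | h
    · exact ⟨1, by simp [h]⟩
    · exact ⟨-1, by simp [h]⟩
  refine ⟨e, fun i hi => ?_⟩
  have hsq_sign : (SignType.sign (μ i) : ℤ) * SignType.sign (μ i) = 1 := by
    rcases hi.lt_or_gt with h | h <;> simp [h]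
  have hsq_pow : ((-1 : ℤ) ^ (i : ℕ)) * (-1) ^ (i : ℕ) = 1 := by
    rw [← mul_pow, neg_one_mul, neg_neg, one_pow]
  have hsign := congr_arg (fun x : ℝ => (SignType.sign x : ℤ)) (hcμ i)
  simp only [sign_mul, SignType.coe_mul, sign_pow, SignType.coe_pow, Left.sign_neg, sign_one,
    SignType.coe_neg, SignType.coe_one] at hsign
  rw [he, pow_succ]
  linear_combination -((-1) ^ (i : ℕ) * (SignType.sign (μ i) : ℤ)) * hsign -
    (-1) ^ (i : ℕ) * (SignType.sign c : ℤ) * hsq_sign + (SignType.sign (μ i) : ℤ) *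
      (SignType.sign (Matrix.detRowAlternating (y ∘ i.succAbove)) : ℤ) * hsq_pow

theorem exists_smul_sum_signedFace_eq_sum_positiveSymbol {f : V → Fin d → ℝ} {v : Fin (d + 1) → V}
    (hv : Function.Injective v) {R : Finset V} (hR : Set.range v = R) (hZR : Z ⊆ R)
    (hw : ∑ z ∈ Z, w z • f z = 0) (hw_ne : ∀ z ∈ Z, w z ≠ 0) {z₀ : V} (hz₀ : z₀ ∈ Z)
    (hindep : LinearIndepOn ℝ f (R.erase z₀ : Finset V)) :
    ∃ e : ℤˣ, (e : ℤ) • ∑ i with v i ∈ Z, signedFace v i =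
      ∑ z ∈ Z, (SignType.sign (w z) : ℤ) • positiveSymbol f (R.erase z) := by
  have hZv : (Z : Set V) ⊆ Set.range v := hR ▸ Finset.coe_subset.2 hZR
  obtain ⟨j, rfl⟩ := hZv hz₀
  have hdependency : ∑ i, (if v i ∈ Z then w (v i) else 0) • (f ∘ v) i = 0 := by
    simp only [ite_smul, zero_smul, Function.comp_apply]
    rw [← Finset.sum_filter, sum_filter_mem_comp hv hZv fun z => w z • f z, hw]
  have hinj (i : Fin (d + 1)) : Function.Injective (v ∘ i.succAbove) :=
    hv.comp Fin.succAbove_right_injective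
  have hdet : Matrix.detRowAlternating ((f ∘ v) ∘ j.succAbove) ≠ 0 := by
    rw [← range_comp_succAbove hv hR, linearIndepOn_range_iff (hinj j)] at hindep
    exact det_ne_zero_iff_linearIndependent.2 hindep
  obtain ⟨e, he⟩ := exists_unit_mul_eq_sign_mul_sign_det hdependency (j := j)
    (by rw [if_pos hz₀]; exact hw_ne _ hz₀) hdet
  refine ⟨e, ?_⟩
  rw [Finset.smul_sum, ← sum_filter_mem_comp hv hZv]
  refine Finset.sum_congr rfl fun i hi => ?_
  have hiZ := (Finset.mem_filter.1 hi).2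
  have hsign := he i (by rw [if_pos hiZ]; exact hw_ne _ hiZ)
  rw [if_pos hiZ] at hsign
  rw [positiveSymbol_eq f (hinj i) (range_comp_succAbove hv hR i), signedFace, smul_smul, smul_smul,
    hsign]
  rfl

variable [AddCommGroup V] [Module ℝ V] {P Q : Set V} {T₁ T₂ : Finset (Finset V)}

theorem IsCircuitWeight.exists_smul_sum_signedFace_eq (hw : IsCircuitWeight Z w)
    (hcard : 3 ≤ Z.card) (hF : Disjoint F Z) (hQ : ((Z ∪ F : Finset V) : Set V) ⊆ Q)
    (hn : finrank ℝ (vectorSpan ℝ Q) = n) (o : Orientation ℝ (vectorSpan ℝ Q) (Fin n))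
    {v : Fin (n + 2) → V} (hv : Function.Injective v)
    (hvR : Set.range v = (Z ∪ F : Finset V)) {z₀ : V} (hz₀ : z₀ ∈ Z)
    (hindep : AffineIndependent ℝ
      (Subtype.val : {x : V // x ∈ Z.erase z₀ ∪ F} → V)) :
    ∃ e : ℤˣ, (e : ℤ) • ∑ i with v i ∈ Z, signedFace v i =
      ∑ I ∈ circuitTriangulation Z w, orientedSymbol o (I ∪ F) -
        ∑ J ∈ circuitTriangulation Z (-w), orientedSymbol o (J ∪ F) := by
  have hpos : 0 < n := by
    have hle := Finset.card_le_card (Finset.subset_union_left : Z ⊆ Z ∪ F)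
    rw [card_eq_of_range_eq hv hvR] at hle
    omega
  have : FiniteDimensional ℝ (vectorSpan ℝ Q) := Module.finite_of_finrank_pos (hn ▸ hpos)
  have : Nonempty (Fin n) := ⟨⟨0, hpos⟩⟩
  obtain ⟨b, rfl⟩ : ∃ b : Basis (Fin n) ℝ (vectorSpan ℝ Q), b.orientation = o :=
    ⟨o.someBasis (by rw [hn, Fintype.card_fin]), o.someBasis_orientation _⟩
  obtain ⟨q, hq⟩ := exists_projection (vectorSpan ℝ Q)
  have hsymbol (z : V) (hz : z ∈ Z) : orientedSymbol b.orientation (Z.erase z ∪ F) =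
      positiveSymbol (homogenization b q) ((Z ∪ F).erase z) := by
    rw [← union_erase_of_disjoint hF hz]
    refine orientedSymbol_eq_positiveSymbol b hq ?_ fun x hx y hy => vsub_mem_vectorSpan ℝ
      (hQ (Finset.mem_of_mem_erase hx)) (hQ (Finset.mem_of_mem_erase hy))
    rw [Finset.card_erase_of_mem (Finset.mem_union_left F hz), card_eq_of_range_eq hv hvR]
    rfl
  rw [sum_circuitTriangulation_sub hw.ne_zero fun I => orientedSymbol b.orientation (I ∪ F),
    Finset.sum_congr (rfl : Z = Z) fun z hz => by rw [hsymbol z hz]]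
  refine exists_smul_sum_signedFace_eq_sum_positiveSymbol hv hvR Finset.subset_union_left ?_
    hw.ne_zero hz₀ ?_
  · rw [← linear_sum_smul_of_sum_eq_zero _ (fun z => z) hw.sum_eq, hw.sum_smul_eq, map_zero]
  · have hf := isHomogenization_homogenization (le_refl (vectorSpan ℝ Q)) b hq
    rw [← union_erase_of_disjoint hF hz₀] at hindep
    exact (hf.linearIndependent_iff fun x => hQ (Finset.mem_of_mem_erase x.2)).2 hindep

namespace IsWeightedFlip

theorem circuit_formula (h : IsWeightedFlip T₁ T₂ Z w) (hT₁ : IsTriangulation P T₁)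
    (hT₂ : IsTriangulation P T₂) {m : ℕ} {z : Fin (m + 2) → V} (hz : Function.Injective z)
    (hzZ : Set.range z = Z) (o : Orientation ℝ (vectorSpan ℝ (Z : Set V)) (Fin m)) :
    ∃ e : ℤˣ, (e : ℤ) • ∑ i : Fin (m + 2), (-1 : ℤ) ^ ((i : ℕ) + 1) •
        chainSymbol (z ∘ i.succAbove) =
      ∑ s ∈ circuitSimplices Z T₁, orientedSymbol o s -
        ∑ u ∈ circuitSimplices Z T₂, orientedSymbol o u := by
  obtain ⟨z₀, hz₀⟩ := h.circuit.nonempty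
  have hm : finrank ℝ (vectorSpan ℝ (Z : Set V)) = m := by
    have := h.circuit.finrank_vectorSpan_add_two
    have := card_eq_of_range_eq hz hzZ
    omega
  have hmem (i : Fin (m + 2)) : z i ∈ Z := Finset.mem_coe.1 (hzZ ▸ Set.mem_range_self i)
  have hformula := h.weight.exists_smul_sum_signedFace_eq h.circuit.three_le_card
    (Finset.disjoint_empty_left Z) (by rw [Finset.union_empty]) hm o hz
    (by rw [hzZ, Finset.union_empty]) hz₀
    (by rw [Finset.union_empty]; exact h.circuit.affineIndependent_erase hz₀)
  simp only [hmem, Finset.filter_true, Finset.union_empty] at hformula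
  rw [h.circuitSimplices_left hT₁, h.circuitSimplices_right hT₁ hT₂]
  exact hformula

theorem link_formula (h : IsWeightedFlip T₁ T₂ Z w) (hn : finrank ℝ (vectorSpan ℝ P) = n)
    (hT₁ : IsTriangulation P T₁) (hZP : (Z : Set V) ⊆ P)
    (o : Orientation ℝ (vectorSpan ℝ P) (Fin n)) {σ₀ : Finset V} (hσ₀ : σ₀ ∈ T₁ \ T₂) {p : ℕ}
    {v : Fin (n + 2) → V} (hv : Function.Injective v)
    (hvZ : v '' {i | (i : ℕ) < p} = (Z : Set V))
    (hvF : v '' {i | p ≤ (i : ℕ)} = ((σ₀ \ Z : Finset V) : Set V)) :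
    ∃ e : ℤˣ, (e : ℤ) • partialBoundary p v =
      ∑ s ∈ T₁ \ T₂ with s \ Z = σ₀ \ Z, orientedSymbol o s -
        ∑ u ∈ T₂ \ T₁ with u \ Z = σ₀ \ Z, orientedSymbol o u := by
  have hσ₁ := (Finset.mem_sdiff.1 hσ₀).1
  have hF : Disjoint (σ₀ \ Z) Z := Finset.sdiff_disjoint
  obtain ⟨I, hI, hIσ⟩ := h.exists_link hT₁ hσ₀
  have hIF : I ∪ (σ₀ \ Z) ∈ T₁ := hIσ.symm ▸ hσ₁
  obtain ⟨z₀, hz₀, -, rfl⟩ := mem_circuitTriangulation.1 hI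
  have hrange : Set.range v = (Z ∪ (σ₀ \ Z) : Finset V) := by
    rw [Finset.coe_union, ← hvZ, ← hvF, ← Set.image_union, ← Set.image_univ]
    exact congr_arg _ (Set.eq_univ_of_forall fun i : Fin (n + 2) => lt_or_ge (i : ℕ) p).symm
  have hP : ((Z ∪ (σ₀ \ Z) : Finset V) : Set V) ⊆ P := by
    rw [Finset.coe_union]
    exact Set.union_subset hZP ((Finset.coe_subset.2 Finset.sdiff_subset).trans (hT₁.subset hσ₁))
  obtain ⟨e, he⟩ := h.weight.exists_smul_sum_signedFace_eq h.circuit.three_le_card hF hP hn o hv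
    hrange hz₀ (hT₁.indep _ hIF)
  have hfilter : ({i | v i ∈ Z} : Finset (Fin (n + 2))) =
      ({i | (i : ℕ) < p} : Finset (Fin (n + 2))) :=
    Finset.filter_congr fun i _ => by
      rw [← Finset.mem_coe, ← hvZ]
      exact hv.mem_set_image
  refine ⟨e, ?_⟩
  rw [partialBoundary_eq_sum_signedFace, ← hfilter, he, h.filter_removed_eq hT₁ hF hI hIF,
    h.filter_added_eq hT₁ hF hI hIF, Finset.sum_image (injOn_union_right hF),
    Finset.sum_image (injOn_union_right hF)]

end IsWeightedFlip

end FlipFormulas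

section ConvexCones

variable {V : Type*} [AddCommGroup V] [Module ℝ V] {S : Set V} {l : V →ₗ[ℝ] ℝ}

theorem span_nnreal_image_smul {ι : Type*} {s : Set ι} {c : ι → ℝ} (hc : ∀ i ∈ s, 0 < c i)
    (g : ι → V) : Submodule.span NNReal ((fun i => c i • g i) '' s) =
      Submodule.span NNReal (g '' s) := by
  refine le_antisymm (Submodule.span_le.2 ?_) (Submodule.span_le.2 ?_)
  · rintro _ ⟨i, hi, rfl⟩
    exact Submodule.smul_mem _ (⟨c i, (hc i hi).le⟩ : NNReal)
      (Submodule.subset_span (Set.mem_image_of_mem g hi))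
  · rintro _ ⟨i, hi, rfl⟩
    have hmem : (c i)⁻¹ • c i • g i ∈ Submodule.span NNReal ((fun i => c i • g i) '' s) :=
      Submodule.smul_mem _ (⟨(c i)⁻¹, inv_nonneg.2 (hc i hi).le⟩ : NNReal)
        (Submodule.subset_span (Set.mem_image_of_mem _ hi))
    rwa [inv_smul_smul₀ (hc i hi).ne'] at hmem

theorem span_nnreal_inter_eq_convexHull (hS : ∀ x ∈ S, l x = 1) :
    (Submodule.span NNReal S : Set V) ∩ {x | l x = 1} = convexHull ℝ S := by
  have hhull : convexHull ℝ S ⊆ {x | l x = 1} :=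
    convexHull_min hS (convex_hyperplane l.isLinear 1)
  rcases S.eq_empty_or_nonempty with rfl | hne
  · ext x
    simp +contextual [Submodule.span_empty]
  rw [span_nnreal_eq_smul_convexHull hne]
  refine Set.Subset.antisymm ?_ fun x hx => ⟨⟨1, trivial, x, hx, one_smul _ x⟩, hhull hx⟩
  rintro _ ⟨⟨c, -, x, hx, rfl⟩, hcx⟩
  have hc : (c : ℝ) = 1 := by simpa [NNReal.smul_def, Set.mem_ofPred_eq ▸ hhull hx] using hcx
  simpa [NNReal.smul_def, hc] using hx

theorem span_nnreal_inter_ker {φ : V →ₗ[ℝ] ℝ} (hφ : ∀ x ∈ S, 0 ≤ φ x) :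
    (Submodule.span NNReal S : Set V) ∩ {x | φ x = 0} =
      Submodule.span NNReal (S ∩ {x | φ x = 0}) := by
  have hnonneg : ∀ x ∈ Submodule.span NNReal S, 0 ≤ φ x := fun x hx => by
    induction hx using Submodule.span_induction with
    | mem x hx => exact hφ x hx
    | zero => simp
    | add x y _ _ hx hy => simpa using add_nonneg hx hy
    | smul c x _ hx => simpa [NNReal.smul_def] using mul_nonneg c.2 hx
  refine Set.Subset.antisymm ?_ fun x hx => ⟨Submodule.span_mono Set.inter_subset_left hx, ?_⟩
  · rintro x ⟨hx, hx0⟩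
    induction hx using Submodule.span_induction with
    | mem x hx => exact Submodule.subset_span ⟨hx, hx0⟩
    | zero => exact zero_mem _
    | add x y hxS hyS hx hy =>
      obtain ⟨hx0, hy0⟩ := (add_eq_zero_iff_of_nonneg (hnonneg x hxS) (hnonneg y hyS)).1
        ((map_add φ x y).symm.trans hx0)
      exact add_mem (hx hx0) (hy hy0)
    | smul c x _ hx =>
      rcases eq_or_ne c 0 with rfl | hc
      · simp
      · refine Submodule.smul_mem _ c (hx ?_)
        simpa [NNReal.smul_def, hc] using hx0
  · have hle : Submodule.span NNReal (S ∩ {x | φ x = 0}) ≤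
        (LinearMap.ker φ).restrictScalars NNReal := Submodule.span_le.2 fun x hx => hx.2
    exact hle hx

theorem vectorSpan_eq_span_inf_ker (hS : ∀ x ∈ S, l x = 1) :
    vectorSpan ℝ S = Submodule.span ℝ S ⊓ LinearMap.ker l := by
  refine le_antisymm ?_ ?_
  · rw [vectorSpan_def, Submodule.span_le]
    rintro _ ⟨x, hx, y, hy, rfl⟩
    exact ⟨sub_mem (Submodule.subset_span hx) (Submodule.subset_span hy),
      by simp [hS x hx, hS y hy]⟩
  rintro x ⟨hx, hlx⟩
  rcases S.eq_empty_or_nonempty with rfl | ⟨p, hp⟩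
  · simpa using hx
  suffices h : x - l x • p ∈ vectorSpan ℝ S by simpa [LinearMap.mem_ker.1 hlx] using h
  clear hlx
  induction hx using Submodule.span_induction with
  | mem y hy => simpa [hS y hy] using vsub_mem_vectorSpan ℝ hy hp
  | zero => simp
  | add y z _ _ hy hz =>
    rw [map_add, add_smul, add_sub_add_comm]
    exact add_mem hy hz
  | smul c y _ hy =>
    rw [map_smul, smul_assoc, ← smul_sub]
    exact Submodule.smul_mem _ c hy

theorem finrank_vectorSpan_add_one [FiniteDimensional ℝ V] (hS : ∀ x ∈ S, l x = 1)
    (hne : S.Nonempty) : finrank ℝ (vectorSpan ℝ S) + 1 = finrank ℝ (Submodule.span ℝ S) := by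
  obtain ⟨p, hp⟩ := hne
  have hrange : LinearMap.range (l ∘ₗ (Submodule.span ℝ S).subtype) = ⊤ :=
    LinearMap.range_eq_top.2 fun r => ⟨r • ⟨p, Submodule.subset_span hp⟩, by simp [hS p hp]⟩
  have hrank := LinearMap.finrank_range_add_finrank_ker (l ∘ₗ (Submodule.span ℝ S).subtype)
  rw [hrange, finrank_top, finrank_self, LinearMap.ker_comp, ← Submodule.finrank_map_subtype_eq,
    Submodule.map_comap_subtype, ← vectorSpan_eq_span_inf_ker hS] at hrank
  rw [← hrank, add_comm]

theorem subset_extremePoints_convexHull {σ : Finset V}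
    (hσ : AffineIndependent ℝ (Subtype.val : {x : V // x ∈ σ} → V)) :
    (σ : Set V) ⊆ (convexHull ℝ (σ : Set V)).extremePoints ℝ := by
  classical
  refine fun x hx => mem_extremePoints_iff_left.2 ⟨subset_convexHull ℝ _ hx, ?_⟩
  rintro y hy z hz ⟨s, t, hs, ht, hst, hxyz⟩
  obtain ⟨w, hw, hw1, rfl⟩ := Finset.mem_convexHull'.1 hy
  obtain ⟨u, hu, hu1, rfl⟩ := Finset.mem_convexHull'.1 hz
  have hcoeff : ∀ p ∈ σ, s * w p + t * u p = if p = x then 1 else 0 := fun p hp => by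
    have hzero := (affineIndependent_iff.1 hσ) Finset.univ
      (fun p => s * w p + t * u p - if (p : V) = x then 1 else 0) ?_ ?_ ⟨p, hp⟩
      (Finset.mem_univ _)
    · exact sub_eq_zero.1 hzero
    · rw [Finset.sum_coe_sort σ fun p => s * w p + t * u p - if p = x then 1 else 0]
      rw [Finset.sum_sub_distrib, Finset.sum_add_distrib, ← Finset.mul_sum, ← Finset.mul_sum,
        hw1, hu1, Finset.sum_ite_eq' σ x, if_pos (Finset.mem_coe.1 hx)]
      linarith
    · rw [Finset.sum_coe_sort σ fun p => (s * w p + t * u p - if p = x then 1 else 0) • p]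
      simp only [sub_smul, add_smul, mul_smul, ite_smul, one_smul, zero_smul,
        Finset.sum_sub_distrib, Finset.sum_add_distrib, ← Finset.smul_sum]
      rw [hxyz, Finset.sum_ite_eq' σ x, if_pos (Finset.mem_coe.1 hx), sub_self]
  have hoff : ∀ p ∈ σ, p ≠ x → w p = 0 := fun p hp hpx => by
    have hsum := hcoeff p hp
    rw [if_neg hpx] at hsum
    exact (mul_eq_zero.1 ((add_eq_zero_iff_of_nonneg (mul_nonneg hs.le (hw p hp))
      (mul_nonneg ht.le (hu p hp))).1 hsum).1).resolve_left hs.ne'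
  rw [Finset.sum_eq_single_of_mem x hx hoff] at hw1
  rw [Finset.sum_eq_single_of_mem x hx fun p hp hpx => by rw [hoff p hp hpx, zero_smul], hw1,
    one_smul]

theorem subset_of_convexHull_eq {σ : Finset V}
    (hσ : AffineIndependent ℝ (Subtype.val : {x : V // x ∈ σ} → V))
    (h : convexHull ℝ S = convexHull ℝ (σ : Set V)) : (σ : Set V) ⊆ S :=
  (subset_extremePoints_convexHull hσ).trans (h ▸ extremePoints_convexHull_subset)

end ConvexCones

section Sharblies

variable {n r : ℕ}

theorem basicSharbly_comp_perm (v : Fin r → QVec n) (π : Equiv.Perm (Fin r)) :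
    basicSharbly (v ∘ π) = Equiv.Perm.sign π • basicSharbly v := by
  rw [Units.smul_def, ← Int.cast_smul_eq_zsmul ℚ, basicSharbly, basicSharbly, ← map_smul,
    Finsupp.smul_single, smul_eq_mul, mul_one]
  exact (Submodule.Quotient.eq _).2 (Submodule.subset_span (Or.inl (Or.inl ⟨v, π, rfl⟩)))

theorem basicSharbly_eq_of_eq_smul_apply {v w : Fin r → QVec n} (j : Fin r) {c : ℚ} (hc : c ≠ 0)
    (hj : (w j : Fin n → ℚ) = c • (v j : Fin n → ℚ)) (hne : ∀ i, i ≠ j → w i = v i) :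
    basicSharbly w = basicSharbly v := by
  have : NeZero r := NeZero.of_pos j.pos
  have hswap : basicSharbly (v ∘ Equiv.swap 0 j) = basicSharbly (w ∘ Equiv.swap 0 j) := by
    refine (Submodule.Quotient.eq _).2 (Submodule.subset_span
      (Or.inr ⟨_, _, c, hc, fun i hi => ?_, fun i hi => hne _ fun hij => hi ?_, rfl⟩))
    · obtain rfl : i = 0 := Fin.ext hi
      simpa only [Function.comp_apply, Equiv.swap_apply_left] using hj
    · simpa using congrArg (Equiv.swap 0 j) hij
  rw [basicSharbly_comp_perm, basicSharbly_comp_perm] at hswap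
  exact (smul_left_cancel _ hswap).symm

theorem basicSharbly_eq_of_forall_eq_smul {v w : Fin r → QVec n}
    (h : ∀ i, ∃ c : ℚ, c ≠ 0 ∧ (w i : Fin n → ℚ) = c • (v i : Fin n → ℚ)) :
    basicSharbly w = basicSharbly v := by
  classical
  have hpiecewise : ∀ s : Finset (Fin r), basicSharbly (s.piecewise w v) = basicSharbly v := by
    intro s
    induction s using Finset.induction_on with
    | empty => simp only [Finset.piecewise_empty]
    | insert j s hj ih =>
      obtain ⟨c, hc, hcj⟩ := h j
      rw [← ih]
      refine basicSharbly_eq_of_eq_smul_apply j hc ?_ fun i hi =>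
        Finset.piecewise_insert_of_ne s w v hi
      rwa [Finset.piecewise_insert_self, Finset.piecewise_eq_of_notMem _ _ _ hj]
  simpa only [Finset.piecewise_univ] using hpiecewise Finset.univ

/-- The homomorphism from chains to sharblies induced by a choice of a rational vector for each
point. -/
noncomputable def chainToSharbly {X : Type*} (ρ : X → QVec n) :
    AntisymChains X r →ₗ[ℤ] Sharbly n r :=
  chainLift (fun a => basicSharbly (ρ ∘ a)) fun a π => basicSharbly_comp_perm (ρ ∘ a) π

@[simp]
theorem chainToSharbly_chainSymbol {X : Type*} (ρ : X → QVec n) (a : Fin r → X) :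
    chainToSharbly ρ (chainSymbol a) = basicSharbly (ρ ∘ a) :=
  chainLift_chainSymbol _ _ a

theorem chainToSharbly_partialBoundary {X : Type*} (ρ : X → QVec n) (p : ℕ)
    (v : Fin (r + 1) → X) :
    chainToSharbly ρ (partialBoundary p v) = partialSharblyBoundary p (ρ ∘ v) := by
  simp only [partialBoundary, partialSharblyBoundary, map_sum, map_smul,
    chainToSharbly_chainSymbol, Function.comp_assoc]

end Sharblies

section RankOneMatrices

variable {n : ℕ} {l : Matrix (Fin n) (Fin n) ℝ →ₗ[ℝ] ℝ}

theorem rankOne_mem_symmetricMatrices (v : QVec n) : rankOne v ∈ symmetricMatrices n :=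
  Matrix.transpose_vecMulVec _ _

theorem finrank_symmetricMatrices (n : ℕ) :
    finrank ℝ (symmetricMatrices n) = n * (n + 1) / 2 := by
  let e : symmetricMatrices n ≃ₗ[ℝ] (Sym2 (Fin n) → ℝ) :=
    { toFun := fun A => Sym2.lift ⟨fun i j => A.1 i j, fun i j => (A.2.apply i j).symm⟩
      map_add' := fun A B => by funext s; induction s using Sym2.ind; rfl
      map_smul' := fun c A => by funext s; induction s using Sym2.ind; rfl
      invFun := fun g => ⟨Matrix.of fun i j => g s(i, j), by ext i j; simp [Sym2.eq_swap]⟩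
      left_inv := fun A => rfl
      right_inv := fun g => by funext s; induction s using Sym2.ind; rfl }
  rw [e.finrank_eq, finrank_fintype_fun_eq_card, Sym2.card, Fintype.card_fin,
    Nat.choose_two_right, Nat.add_sub_cancel, mul_comm]

theorem exists_eq_smul_of_rankOne_eq_smul {v v' : QVec n} {c : ℝ} (hc : c ≠ 0)
    (h : rankOne v = c • rankOne v') :
    ∃ r : ℚ, r ≠ 0 ∧ (v : Fin n → ℚ) = r • (v' : Fin n → ℚ) := by
  obtain ⟨j, hj⟩ := Function.ne_iff.1 v'.2
  have hj' : (v'.1 j : ℝ) ≠ 0 := Rat.cast_ne_zero.2 hj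
  have hentry : ∀ i k, (v.1 i : ℝ) * v.1 k = c * (v'.1 i * v'.1 k) := fun i k => by
    simpa [rankOne, Matrix.vecMulVec_apply] using congrFun (congrFun h i) k
  have hvj : (v.1 j : ℝ) ≠ 0 :=
    left_ne_zero_of_mul (hentry j j ▸ mul_ne_zero hc (mul_ne_zero hj' hj'))
  refine ⟨v.1 j / v'.1 j, div_ne_zero (Rat.cast_ne_zero.1 hvj) hj, funext fun i => ?_⟩
  have hcoord : (v.1 i : ℝ) = v.1 j / v'.1 j * v'.1 i := by
    rw [div_mul_eq_mul_div, eq_div_iff hj']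
    refine mul_right_cancel₀ hvj ?_
    linear_combination (v'.1 j : ℝ) * hentry i j - (v'.1 i : ℝ) * hentry j j
  rw [Pi.smul_apply, smul_eq_mul]
  exact_mod_cast hcoord

theorem rankOne_eq_smul_sectionPoint (hl : IsTransversal l) (v : QVec n) :
    rankOne v = l (rankOne v) • sectionPoint l v :=
  (smul_inv_smul₀ (hl v).ne' _).symm

theorem exists_eq_smul_of_sectionPoint_eq (hl : IsTransversal l) {v v' : QVec n}
    (h : sectionPoint l v = sectionPoint l v') :
    ∃ r : ℚ, r ≠ 0 ∧ (v : Fin n → ℚ) = r • (v' : Fin n → ℚ) := by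
  refine exists_eq_smul_of_rankOne_eq_smul
    (mul_ne_zero (hl v).ne' (inv_ne_zero (hl v').ne')) ?_
  rw [mul_smul, ← sectionPoint, ← h, ← rankOne_eq_smul_sectionPoint hl]

theorem apply_sectionPoint (hl : IsTransversal l) (v : QVec n) : l (sectionPoint l v) = 1 := by
  rw [sectionPoint, map_smul, smul_eq_mul, inv_mul_cancel₀ (hl v).ne']

theorem coneHull_image_sectionPoint (hl : IsTransversal l) (M : Set (QVec n)) :
    coneHull (sectionPoint l '' M) = coneHull (rankOne '' M) :=
  congrArg SetLike.coe (span_nnreal_image_smul (fun v _ => inv_pos.2 (hl v)) rankOne)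

theorem coneHull_range_sectionPoint (hl : IsTransversal l) {ι : Type*} (v : ι → QVec n) :
    coneHull (Set.range fun i => sectionPoint l (v i)) =
      coneHull (Set.range fun i => rankOne (v i)) := by
  have h := coneHull_image_sectionPoint hl (Set.range v)
  rwa [← Set.range_comp, ← Set.range_comp] at h

theorem coneHull_inter_eq_convexHull (hl : IsTransversal l) (M : Set (QVec n)) :
    coneHull (rankOne '' M) ∩ {A | l A = 1} = convexHull ℝ (sectionPoint l '' M) := by
  rw [← coneHull_image_sectionPoint hl]
  exact span_nnreal_inter_eq_convexHull
    (Set.forall_mem_image.2 fun v _ => apply_sectionPoint hl v)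

theorem span_coneHull (S : Set (Matrix (Fin n) (Fin n) ℝ)) :
    Submodule.span ℝ (coneHull S) = Submodule.span ℝ S :=
  Submodule.span_span_of_tower NNReal ℝ S

theorem isFlipon_of_mem {d : ℕ} {M : Set (QVec n)} {ψ : Matrix (Fin n) (Fin n) ℝ →ₗ[ℝ] ℝ}
    (hψ : ∀ v ∈ M, ψ (rankOne v) = 1) (hne : M.Nonempty)
    (hd : finrank ℝ (Submodule.span ℝ (rankOne '' M)) + 1 = d) {v : Fin d → QVec n}
    (hv : ∀ i, v i ∈ M) : IsFlipon v := by
  refine ⟨affineSpan ℝ (rankOne '' M), ?_, ?_,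
    fun i => subset_affineSpan ℝ _ (Set.mem_image_of_mem _ (hv i))⟩
  · refine affineSpan_le (Q := (symmetricMatrices n).toAffineSubspace).2 ?_
    exact Set.image_subset_iff.2 fun v _ => rankOne_mem_symmetricMatrices v
  · rw [direction_affineSpan, ← hd, ← finrank_vectorSpan_add_one (Set.forall_mem_image.2 hψ)
      (hne.image _)]

end RankOneMatrices

section TileFacets

variable {n : ℕ}

/-- The inner product of symmetric matrices with a fixed form `Q`, the linear functional whose
value at `v'` is `Q(v)`. -/
noncomputable def formPairing (Q : Matrix (Fin n) (Fin n) ℝ) : Matrix (Fin n) (Fin n) ℝ →ₗ[ℝ] ℝ :=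
  Matrix.traceLinearMap (Fin n) ℝ ℝ ∘ₗ LinearMap.mulLeft ℝ Q

theorem formPairing_rankOne (Q : Matrix (Fin n) (Fin n) ℝ) (v : QVec n) :
    formPairing Q (rankOne v) = quadValue Q v.1 := by
  simp only [formPairing, rankOne, quadValue, LinearMap.comp_apply, LinearMap.mulLeft_apply,
    Matrix.traceLinearMap_apply, Matrix.mul_vecMulVec, Matrix.trace_vecMulVec, dotProduct_comm]

theorem quadValue_pos {Q : Matrix (Fin n) (Fin n) ℝ} (hQ : Q.PosDef) (v : QVec n) :
    0 < quadValue Q v.1 := by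
  obtain ⟨j, hj⟩ := Function.ne_iff.1 v.2
  have hne : (fun i => (v.1 i : ℝ)) ≠ 0 := Function.ne_iff.2 ⟨j, Rat.cast_ne_zero.2 hj⟩
  simpa only [quadValue, star_trivial] using hQ.dotProduct_mulVec_pos hne

variable {F : Set (Matrix (Fin n) (Fin n) ℝ)}

theorem IsTileFacet.finrank_span_add_one (hF : IsTileFacet F) :
    finrank ℝ (Submodule.span ℝ F) + 1 = n * (n + 1) / 2 := by
  obtain ⟨Q, -, φ, -, -, hdim⟩ := hF
  rw [hdim, finrank_symmetricMatrices]

theorem IsTileFacet.two_le {k : ℕ} (hF : IsTileFacet F) (hn : 2 ≤ n)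
    (hk : finrank ℝ (Submodule.span ℝ F) = k) : 2 ≤ k := by
  have hd : 2 * 3 / 2 ≤ n * (n + 1) / 2 := Nat.div_le_div_right (Nat.mul_le_mul hn (by omega))
  have := hF.finrank_span_add_one
  omega

/-- A cone generated by rank one matrices that lie on a common affine hyperplane avoiding the
origin. It stands in for a facet of a tile, whose generators have this property. -/
def IsLevelCone (F : Set (Matrix (Fin n) (Fin n) ℝ)) : Prop :=
  ∃ (M : Set (QVec n)) (ψ : Matrix (Fin n) (Fin n) ℝ →ₗ[ℝ] ℝ),
    F = coneHull (rankOne '' M) ∧ ∀ v ∈ M, ψ (rankOne v) = 1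

/-- The perfect form takes the same value at all its minimal vectors. -/
theorem IsTileFacet.isLevelCone (hF : IsTileFacet F) : IsLevelCone F := by
  obtain ⟨Q, ⟨hQ, -⟩, φ, hφ, hFQ, -⟩ := hF
  let M : Set (QVec n) := minimalVectors Q ∩ rankOne ⁻¹' {A | φ A = 0}
  have hFM : F = coneHull (rankOne '' M) := by
    rw [Set.image_inter_preimage]
    exact hFQ.trans (span_nnreal_inter_ker fun A hA => hφ A (Submodule.subset_span hA))
  rcases M.eq_empty_or_nonempty with hM | ⟨v₀, hv₀, -⟩
  · exact ⟨M, 0, hFM, by simp [hM]⟩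
  refine ⟨M, (quadValue Q v₀.1)⁻¹ • formPairing Q, hFM, fun v hv => ?_⟩
  have hmin : quadValue Q v.1 = quadValue Q v₀.1 :=
    le_antisymm (hv.1.2 v₀ hv₀.1) (hv₀.2 v hv.1.1)
  rw [LinearMap.smul_apply, formPairing_rankOne, hmin, smul_eq_mul,
    inv_mul_cancel₀ (quadValue_pos hQ v₀).ne']

end TileFacets

section BasisCoordinates

variable {V : Type*} [AddCommGroup V] [Module ℝ V] {W : Submodule ℝ V} {d : ℕ}

/-- The coordinates with respect to a basis of `W`, extended to the ambient space along a
projection `q` onto `W`. They are homogeneous coordinates for a subset of `W` that lies on an affine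
hyperplane avoiding the origin. -/
noncomputable def basisCoordinates (B : Basis (Fin d) ℝ W) (q : V →ₗ[ℝ] W) : V →ᵃ[ℝ] (Fin d → ℝ) :=
  (B.equivFun.toLinearMap ∘ₗ q).toAffineMap

theorem isHomogenization_basisCoordinates (B : Basis (Fin d) ℝ W) {q : V →ₗ[ℝ] W}
    (hq : ∀ x : W, q x = x) {P : Set V} (hP : P ⊆ W) {l : V →ₗ[ℝ] ℝ} (hl : ∀ x ∈ P, l x = 1) :
    IsHomogenization P (basisCoordinates B q)
      (l ∘ₗ W.subtype ∘ₗ B.equivFun.symm.toLinearMap) where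
  height x hx := by
    simpa [basisCoordinates, hq ⟨x, hP hx⟩] using hl x hx
  eq_zero_of_linear_eq_zero x hx h := by
    have hxW : x ∈ W := by
      rw [vectorSpan_def] at hx
      refine Submodule.span_le.2 ?_ hx
      rintro _ ⟨y, hy, z, hz, rfl⟩
      exact W.sub_mem (hP hy) (hP hz)
    have hqx : q x = 0 := B.equivFun.map_eq_zero_iff.1 h
    exact congrArg Subtype.val ((hq ⟨x, hxW⟩).symm.trans hqx)

theorem det_basisCoordinates (B : Basis (Fin d) ℝ W) {q : V →ₗ[ℝ] W} (hq : ∀ x : W, q x = x)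
    (c : Fin d → W) :
    Matrix.detRowAlternating (basisCoordinates B q ∘ fun i => (c i : V)) = B.det c := by
  rw [Basis.det_apply, ← Matrix.det_transpose]
  refine congrArg Matrix.det (Matrix.ext fun i j => ?_)
  simp [basisCoordinates, hq, Basis.toMatrix_apply]

variable {ι : Type*} [Fintype ι] [DecidableEq ι]

theorem det_smul_eq_prod_mul (B : Basis ι ℝ W) (c : ι → ℝ) (w : ι → W) :
    B.det (fun i => c i • w i) = (∏ i, c i) * B.det w :=
  B.det.toMultilinearMap.map_smul_univ c w

theorem sign_eq_one_of_orientation_eq {b b' : Basis ι ℝ W} (ho : b'.orientation = b.orientation)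
    {c : ι → ℝ} (hc : ∀ i, 0 < c i) {π : Equiv.Perm ι} (h : ∀ i, b' i = c i • b (π i)) :
    Equiv.Perm.sign π = 1 := by
  have hdet : b.det b' = (∏ i, c i) * (Equiv.Perm.sign π : ℤ) := by
    rw [funext h, det_smul_eq_prod_mul b c fun i => b (π i)]
    exact congrArg _ ((b.det.map_perm b π).trans
      (by rw [Basis.det_self, Units.smul_def, zsmul_one]))
  have hpos := (Basis.orientation_eq_iff_det_pos b b').1 ho.symm
  rw [hdet, mul_pos_iff_of_pos_left (Finset.prod_pos fun i _ => hc i), Int.cast_pos] at hpos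
  exact (Int.units_eq_one_or _).resolve_right fun hneg => by simp [hneg] at hpos

end BasisCoordinates

theorem exists_enumeration_det_pos {X : Type*} {d : ℕ} {f : X → Fin d → ℝ} {σ : Finset X}
    (hd : 2 ≤ d) (hσ : σ.card = d) (hf : LinearIndepOn ℝ f σ) :
    ∃ a : Fin d → X, Set.range a = (σ : Set X) ∧ 0 < Matrix.detRowAlternating (f ∘ a) := by
  obtain ⟨a, -, hrange, hdet⟩ := exists_enumeration_det_ne_zero hσ hf
  rcases lt_or_gt_of_ne hdet with hneg | hpos
  · have : Nontrivial (Fin d) := Fin.nontrivial_iff_two_le.2 hd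
    obtain ⟨i, j, hij⟩ := exists_pair_ne (Fin d)
    refine ⟨a ∘ Equiv.swap i j, ((Equiv.swap i j).surjective.range_comp a).trans hrange, ?_⟩
    rw [← Function.comp_assoc, AlternatingMap.map_swap _ _ hij]
    exact neg_pos.2 hneg
  · exact ⟨a, hrange, hpos⟩

section ConeSharblies

variable {n k : ℕ} {l : Matrix (Fin n) (Fin n) ℝ →ₗ[ℝ] ℝ}
  {W : Submodule ℝ (Matrix (Fin n) (Fin n) ℝ)}

theorem exists_perm_sectionPoint_eq (hl : IsTransversal l) {v v' : Fin k → QVec n}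
    (hv : LinearIndependent ℝ fun i => rankOne (v i))
    (h : coneHull (Set.range fun i => rankOne (v' i)) =
      coneHull (Set.range fun i => rankOne (v i))) :
    ∃ π : Equiv.Perm (Fin k), ∀ i, sectionPoint l (v' i) = sectionPoint l (v (π i)) := by
  classical
  have hsection : LinearIndependent ℝ fun i => sectionPoint l (v i) :=
    hv.units_smul fun i => (Units.mk0 (l (rankOne (v i))) (hl _).ne')⁻¹
  have hinter : ∀ u : Fin k → QVec n, convexHull ℝ (Set.range fun i => sectionPoint l (u i)) =
      coneHull (Set.range fun i => rankOne (u i)) ∩ {A | l A = 1} := fun u => by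
    rw [← coneHull_range_sectionPoint hl]
    exact (span_nnreal_inter_eq_convexHull
      (Set.forall_mem_range.2 fun i => apply_sectionPoint hl (u i))).symm
  obtain ⟨σ, hσ⟩ := (Set.finite_range fun i => sectionPoint l (v i)).exists_finset_coe
  have hindep : AffineIndependent ℝ (Subtype.val : {x // x ∈ σ} → Matrix (Fin n) (Fin n) ℝ) := by
    have hrange := hsection.affineIndependent.range
    rwa [← hσ] at hrange
  have hsub := subset_of_convexHull_eq hindep ((hinter v').trans (by rw [h, ← hinter, hσ]))
  obtain ⟨π, hπ⟩ := exists_perm_of_range_subset hsection.injective (hσ ▸ hsub)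
  exact ⟨π, congrFun hπ⟩

theorem basicSharbly_eq_of_coneHull_eq (hl : IsTransversal l) {b b' : Basis (Fin k) ℝ W}
    (ho : b'.orientation = b.orientation) {v v' : Fin k → QVec n}
    (hb : ∀ i, (b i : Matrix (Fin n) (Fin n) ℝ) = rankOne (v i))
    (hb' : ∀ i, (b' i : Matrix (Fin n) (Fin n) ℝ) = rankOne (v' i))
    (h : coneHull (Set.range fun i => rankOne (v' i)) =
      coneHull (Set.range fun i => rankOne (v i))) :
    basicSharbly v' = basicSharbly v := by
  have hv : LinearIndependent ℝ fun i => rankOne (v i) := by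
    simpa only [Function.comp_def, Submodule.subtype_apply, hb] using
      b.linearIndependent.map' W.subtype W.ker_subtype
  obtain ⟨π, hπ⟩ := exists_perm_sectionPoint_eq hl hv h
  have hsign : Equiv.Perm.sign π = 1 := by
    refine sign_eq_one_of_orientation_eq ho
      (c := fun i => l (rankOne (v' i)) * (l (rankOne (v (π i))))⁻¹)
      (fun i => mul_pos (hl _) (inv_pos.2 (hl _))) fun i => Subtype.ext ?_
    rw [Submodule.coe_smul, hb, hb', mul_smul, ← sectionPoint, ← hπ,
      ← rankOne_eq_smul_sectionPoint hl]
  calc basicSharbly v' = basicSharbly (v ∘ π) :=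
        basicSharbly_eq_of_forall_eq_smul fun i => exists_eq_smul_of_sectionPoint_eq hl (hπ i)
    _ = basicSharbly v := by rw [basicSharbly_comp_perm, hsign, one_smul]

theorem coneSharbly_coneHull_range (hl : IsTransversal l) {b : Basis (Fin k) ℝ W}
    {v : Fin k → QVec n} (hb : ∀ i, (b i : Matrix (Fin n) (Fin n) ℝ) = rankOne (v i)) :
    coneSharbly b.orientation (coneHull (Set.range fun i => rankOne (v i))) = basicSharbly v := by
  have hex : ∃ v' : Fin k → QVec n, coneHull (Set.range fun i => rankOne (v i)) =
      coneHull (Set.range fun i => rankOne (v' i)) ∧ ∃ b' : Basis (Fin k) ℝ W,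
        b'.orientation = b.orientation ∧
          ∀ i, (b' i : Matrix (Fin n) (Fin n) ℝ) = rankOne (v' i) := ⟨v, rfl, b, rfl, hb⟩
  rw [coneSharbly, dif_pos hex]
  obtain ⟨hcone, b', ho, hb'⟩ := hex.choose_spec
  exact basicSharbly_eq_of_coneHull_eq hl ho hb hb' hcone.symm

theorem coneSharbly_coneHull_eq_chainToSharbly (hl : IsTransversal l) (hk : 2 ≤ k)
    (B : Basis (Fin k) ℝ W) {q : Matrix (Fin n) (Fin n) ℝ →ₗ[ℝ] W} (hq : ∀ x : W, q x = x)
    {σ : Finset (Matrix (Fin n) (Fin n) ℝ)} (hcard : σ.card = k)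
    (hσW : (σ : Set (Matrix (Fin n) (Fin n) ℝ)) ⊆ W)
    (hσ : LinearIndepOn ℝ (basisCoordinates B q) (σ : Set (Matrix (Fin n) (Fin n) ℝ)))
    {ρ : Matrix (Fin n) (Fin n) ℝ → QVec n} (hρ : ∀ x ∈ σ, sectionPoint l (ρ x) = x) :
    coneSharbly B.orientation (coneHull (σ : Set (Matrix (Fin n) (Fin n) ℝ))) =
      chainToSharbly ρ (positiveSymbol (basisCoordinates B q) σ) := by
  obtain ⟨a, ha, hdet⟩ := exists_enumeration_det_pos hk hcard hσ
  have haσ : ∀ i, a i ∈ σ := fun i => ha.le (Set.mem_range_self i)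
  let c : Fin k → W := fun i => l (rankOne (ρ (a i))) • ⟨a i, hσW (haσ i)⟩
  have hc : ∀ i, (c i : Matrix (Fin n) (Fin n) ℝ) = rankOne (ρ (a i)) := fun i => by
    rw [rankOne_eq_smul_sectionPoint hl, hρ _ (haσ i), Submodule.coe_smul]
  have hpos : 0 < B.det c := by
    rw [det_smul_eq_prod_mul, ← det_basisCoordinates B hq]
    exact mul_pos (Finset.prod_pos fun i _ => hl _) hdet
  obtain ⟨b, hb, hbc⟩ := exists_basis_orientation_eq B hpos
  have hcone : coneHull (σ : Set (Matrix (Fin n) (Fin n) ℝ)) =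
      coneHull (Set.range fun i => rankOne (ρ (a i))) := by
    rw [← coneHull_range_sectionPoint hl, ← ha]
    exact congrArg (fun u => coneHull (Set.range u)) (funext fun i => (hρ _ (haσ i)).symm)
  rw [positiveSymbol_eq_chainSymbol hdet ha, chainToSharbly_chainSymbol, hcone, ← hb]
  exact coneSharbly_coneHull_range hl fun i => by rw [hbc, hc]

end ConeSharblies

section ConeTriangulations

variable {n k : ℕ} {l : Matrix (Fin n) (Fin n) ℝ →ₗ[ℝ] ℝ}

/-- A finite set of simplicial cones triangulates the cone `X` if it consists of the cones over the
simplices of a triangulation of the section of `X` by the hyperplane `{l = 1}`. -/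
def IsConeTriangulation (l : Matrix (Fin n) (Fin n) ℝ →ₗ[ℝ] ℝ)
    (X : Set (Matrix (Fin n) (Fin n) ℝ)) (𝒯 : Finset (Set (Matrix (Fin n) (Fin n) ℝ))) : Prop :=
  ∃ T : Finset (Finset (Matrix (Fin n) (Fin n) ℝ)),
    IsTriangulation (X ∩ {A | l A = 1}) T ∧
    (𝒯 : Set (Set (Matrix (Fin n) (Fin n) ℝ))) =
      (fun σ : Finset (Matrix (Fin n) (Fin n) ℝ) => coneHull (σ : Set _)) '' T

theorem IsRegularConeTriangulation.isConeTriangulation {X : Set (Matrix (Fin n) (Fin n) ℝ)}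
    {𝒯 : Finset (Set (Matrix (Fin n) (Fin n) ℝ))} (h : IsRegularConeTriangulation l X 𝒯) :
    IsConeTriangulation l X 𝒯 :=
  h.imp fun _ hT => ⟨hT.1.1, hT.2⟩

variable {P : Set (Matrix (Fin n) (Fin n) ℝ)} {T : Finset (Finset (Matrix (Fin n) (Fin n) ℝ))}

theorem IsTriangulation.coneHull_injOn (hT : IsTriangulation P T) (hP : ∀ x ∈ P, l x = 1) :
    Set.InjOn (fun σ : Finset (Matrix (Fin n) (Fin n) ℝ) =>
      coneHull (σ : Set (Matrix (Fin n) (Fin n) ℝ))) T := by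
  have hinter : ∀ σ ∈ T, coneHull (σ : Set (Matrix (Fin n) (Fin n) ℝ)) ∩ {A | l A = 1} =
      convexHull ℝ (σ : Set (Matrix (Fin n) (Fin n) ℝ)) := fun σ hσ =>
    span_nnreal_inter_eq_convexHull fun x hx => hP x (hT.subset hσ hx)
  refine fun σ hσ τ hτ h => Finset.eq_of_subset_of_card_le ?_
    (by rw [hT.card_eq σ hσ, hT.card_eq τ hτ])
  refine Finset.coe_subset.1 (subset_of_convexHull_eq (hT.indep σ hσ) ?_)
  rw [← hinter σ hσ, ← hinter τ hτ]
  exact congrArg (· ∩ {A | l A = 1}) h.symm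

theorem IsTriangulation.sum_cones {A : Type*} [AddCommMonoid A] (hT : IsTriangulation P T)
    (hP : ∀ x ∈ P, l x = 1) {𝒯 : Finset (Set (Matrix (Fin n) (Fin n) ℝ))}
    (h𝒯 : (𝒯 : Set (Set (Matrix (Fin n) (Fin n) ℝ))) =
      (fun σ : Finset (Matrix (Fin n) (Fin n) ℝ) => coneHull (σ : Set _)) '' T)
    (g : Set (Matrix (Fin n) (Fin n) ℝ) → A) :
    ∑ s ∈ 𝒯, g s = ∑ σ ∈ T, g (coneHull (σ : Set (Matrix (Fin n) (Fin n) ℝ))) := by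
  classical
  rw [← Finset.coe_image, Finset.coe_inj] at h𝒯
  rw [h𝒯, Finset.sum_image (hT.coneHull_injOn hP)]

theorem finrank_vectorSpan_coneHull_inter (hl : IsTransversal l) {M : Set (QVec n)}
    (hM : M.Nonempty) :
    finrank ℝ (vectorSpan ℝ (coneHull (rankOne '' M) ∩ {A | l A = 1})) + 1 =
      finrank ℝ (Submodule.span ℝ (coneHull (rankOne '' M))) := by
  rw [coneHull_inter_eq_convexHull hl, vectorSpan_convexHull,
    finrank_vectorSpan_add_one (Set.forall_mem_image.2 fun v _ => apply_sectionPoint hl v)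
      (hM.image _), ← span_coneHull, coneHull_image_sectionPoint hl]

theorem exists_rationalVectors (hl : IsTransversal l) {M : Set (QVec n)} (hM : M.Nonempty) :
    ∃ ρ : Matrix (Fin n) (Fin n) ℝ → QVec n, (∀ x, ρ x ∈ M) ∧
      ∀ x ∈ (coneHull (rankOne '' M) ∩ {A | l A = 1}).extremePoints ℝ,
        sectionPoint l (ρ x) = x := by
  have hex : ∀ x, ∃ v ∈ M, x ∈ (coneHull (rankOne '' M) ∩ {A | l A = 1}).extremePoints ℝ →
      sectionPoint l v = x := fun x => by
    by_cases hx : x ∈ (coneHull (rankOne '' M) ∩ {A | l A = 1}).extremePoints ℝ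
    · have himage := hx
      rw [coneHull_inter_eq_convexHull hl] at himage
      obtain ⟨v, hv, hvx⟩ := extremePoints_convexHull_subset himage
      exact ⟨v, hv, fun _ => hvx⟩
    · exact hM.imp fun v hv => ⟨hv, fun h => absurd h hx⟩
  choose ρ hρM hρ using hex
  exact ⟨ρ, hρM, hρ⟩

theorem IsTriangulation.sum_coneSharbly (hT : IsTriangulation P T) (hP : ∀ x ∈ P, l x = 1)
    (hl : IsTransversal l) (hk : 2 ≤ k) (hd : finrank ℝ (vectorSpan ℝ P) + 1 = k)
    {W : Submodule ℝ (Matrix (Fin n) (Fin n) ℝ)} (hPW : P ⊆ W) (B : Basis (Fin k) ℝ W)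
    {q : Matrix (Fin n) (Fin n) ℝ →ₗ[ℝ] W} (hq : ∀ x : W, q x = x)
    {ρ : Matrix (Fin n) (Fin n) ℝ → QVec n} (hρ : ∀ x ∈ P.extremePoints ℝ, sectionPoint l (ρ x) = x)
    {𝒯 : Finset (Set (Matrix (Fin n) (Fin n) ℝ))}
    (h𝒯 : (𝒯 : Set (Set (Matrix (Fin n) (Fin n) ℝ))) =
      (fun σ : Finset (Matrix (Fin n) (Fin n) ℝ) => coneHull (σ : Set _)) '' T) :
    ∑ s ∈ 𝒯, coneSharbly B.orientation s =
      chainToSharbly ρ (∑ σ ∈ T, positiveSymbol (basisCoordinates B q) σ) := by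
  rw [hT.sum_cones hP h𝒯, map_sum]
  refine Finset.sum_congr rfl fun σ hσ => coneSharbly_coneHull_eq_chainToSharbly hl hk B hq
    ((hT.card_eq σ hσ).trans hd) ((hT.subset hσ).trans hPW) ?_
    fun x hx => hρ x (hT.vertices σ hσ hx)
  exact hT.linearIndepOn (isHomogenization_basisCoordinates B hq hPW hP) hσ

theorem exists_flipons (hl : IsTransversal l) {M : Set (QVec n)}
    {ψ : Matrix (Fin n) (Fin n) ℝ →ₗ[ℝ] ℝ} (hψ : ∀ v ∈ M, ψ (rankOne v) = 1) (hk : 2 ≤ k)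
    (hrank : finrank ℝ (Submodule.span ℝ (coneHull (rankOne '' M))) = k)
    (o : Orientation ℝ (Submodule.span ℝ (coneHull (rankOne '' M))) (Fin k))
    {𝒲 𝒴 : Finset (Set (Matrix (Fin n) (Fin n) ℝ))}
    (h𝒲 : IsConeTriangulation l (coneHull (rankOne '' M)) 𝒲)
    (h𝒴 : IsConeTriangulation l (coneHull (rankOne '' M)) 𝒴) :
    ∃ (N : ℕ) (p : Fin N → ℕ) (v : Fin N → Fin (k + 1) → QVec n),
      (∀ α, IsFlipon (v α) ∧ IsFlipTuple (coneHull (rankOne '' M) ∩ {A | l A = 1}) (p α)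
        fun i => sectionPoint l (v α i)) ∧
      ∑ α, partialSharblyBoundary (p α) (v α) =
        ∑ w ∈ 𝒲, coneSharbly o w - ∑ y ∈ 𝒴, coneSharbly o y := by
  obtain ⟨T, hT, hT𝒲⟩ := h𝒲
  obtain ⟨T', hT', hT𝒴⟩ := h𝒴
  have hM : M.Nonempty := by
    rw [Set.nonempty_iff_ne_empty]
    rintro rfl
    rw [span_coneHull, Set.image_empty, Submodule.span_empty, finrank_bot] at hrank
    omega
  have : Nonempty (Fin k) := ⟨⟨0, by omega⟩⟩
  obtain ⟨B, rfl⟩ : ∃ B : Basis (Fin k) ℝ (Submodule.span ℝ (coneHull (rankOne '' M))),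
      B.orientation = o := ⟨o.someBasis (by simpa using hrank.symm), o.someBasis_orientation _⟩
  obtain ⟨q, hq⟩ := exists_projection (Submodule.span ℝ (coneHull (rankOne '' M)))
  obtain ⟨ρ, hρM, hρ⟩ := exists_rationalVectors hl hM
  have hPW : coneHull (rankOne '' M) ∩ {A | l A = 1} ⊆
      Submodule.span ℝ (coneHull (rankOne '' M)) := fun x hx => Submodule.subset_span hx.1
  have hd := (finrank_vectorSpan_coneHull_inter hl hM).trans hrank
  obtain ⟨N, p, v, hv, hsum⟩ := hT.exists_flipTuples hT' hd
    (isHomogenization_basisCoordinates B hq hPW fun x hx => hx.2)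
  refine ⟨N, p, fun α => ρ ∘ v α, fun α => ⟨?_, ?_⟩, ?_⟩
  · exact isFlipon_of_mem hψ hM (by rw [← span_coneHull, hrank]) fun i => hρM _
  · have hsection : (fun i => sectionPoint l ((ρ ∘ v α) i)) = v α :=
      funext fun i => hρ _ ((hv α).mem_extremePoints i)
    rw [hsection]
    exact hv α
  · rw [hT.sum_coneSharbly (fun x hx => hx.2) hl hk hd hPW B hq hρ hT𝒲,
      hT'.sum_coneSharbly (fun x hx => hx.2) hl hk hd hPW B hq hρ hT𝒴, ← map_sub, ← hsum, map_sum]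
    simp only [chainToSharbly_partialBoundary]

end ConeTriangulations

theorem mainTheorem6_general :
    (∀ (V : Type*) [AddCommGroup V] [Module ℝ V] [DecidableEq V] (P : Set V) (n : ℕ)
        (T₁ T₂ : Finset (Finset V)),
      finrank ℝ (vectorSpan ℝ P) = n → IsTriangulation P T₁ → IsTriangulation P T₂ →
      (∀ Z : Finset V, IsFlip P T₁ T₂ Z →
        (∀ (m : ℕ) (z : Fin (m + 2) → V), Function.Injective z → Set.range z = (Z : Set V) →
          Disjoint (circuitSimplices Z T₁) (circuitSimplices Z T₂) ∧
          circuitSimplices Z T₁ ∪ circuitSimplices Z T₂ = Z.image (fun w => Z.erase w) ∧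
          (m = n → circuitSimplices Z T₁ = T₁ \ T₂ ∧ circuitSimplices Z T₂ = T₂ \ T₁) ∧
          ∀ o : Orientation ℝ (vectorSpan ℝ (Z : Set V)) (Fin m),
            ∃ e : ℤˣ,
              (e : ℤ) • ∑ i : Fin (m + 2), (-1 : ℤ) ^ ((i : ℕ) + 1) •
                  chainSymbol (z ∘ i.succAbove) =
                ∑ s ∈ circuitSimplices Z T₁, orientedSymbol o s -
                  ∑ u ∈ circuitSimplices Z T₂, orientedSymbol o u) ∧
        (∀ (o : Orientation ℝ (vectorSpan ℝ P) (Fin n)), ∀ σ₀ ∈ T₁ \ T₂,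
          ∀ (p : ℕ) (v : Fin (n + 2) → V), Function.Injective v →
            v '' {i | (i : ℕ) < p} = (Z : Set V) →
            v '' {i | p ≤ (i : ℕ)} = ((σ₀ \ Z : Finset V) : Set V) →
            ∃ e : ℤˣ,
              (e : ℤ) • partialBoundary p v =
                ∑ s ∈ T₁ \ T₂ with s \ Z = σ₀ \ Z, orientedSymbol o s -
                  ∑ u ∈ T₂ \ T₁ with u \ Z = σ₀ \ Z, orientedSymbol o u)) ∧
      (∀ o : Orientation ℝ (vectorSpan ℝ P) (Fin n),
        ∃ (k : ℕ) (p : Fin k → ℕ) (v : Fin k → Fin (n + 2) → V),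
          (∀ α, Function.Injective (v α) ∧ (∀ i, v α i ∈ P.extremePoints ℝ) ∧
            p α ≤ n + 2 ∧ IsCircuit (v α '' {i | (i : ℕ) < p α})) ∧
          ∑ α, partialBoundary (p α) (v α) =
            ∑ w ∈ T₁, orientedSymbol o w - ∑ y ∈ T₂, orientedSymbol o y)) ∧
    (∀ (n k : ℕ), 2 ≤ k →
      ∀ l : Matrix (Fin n) (Fin n) ℝ →ₗ[ℝ] ℝ, IsTransversal l →
      ∀ F : Set (Matrix (Fin n) (Fin n) ℝ), IsLevelCone F → finrank ℝ (Submodule.span ℝ F) = k →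
      ∀ (o : Orientation ℝ (Submodule.span ℝ F) (Fin k))
        (𝒲 𝒴 : Finset (Set (Matrix (Fin n) (Fin n) ℝ))),
        IsConeTriangulation l F 𝒲 → IsConeTriangulation l F 𝒴 →
        ∃ (N : ℕ) (p : Fin N → ℕ) (v : Fin N → Fin (k + 1) → QVec n),
          (∀ α, IsFlipon (v α) ∧ 3 ≤ p α ∧ p α ≤ k + 1 ∧
            (∀ i, sectionPoint l (v α i) ∈ (F ∩ {A | l A = 1}).extremePoints ℝ) ∧
            Function.Injective (fun i => sectionPoint l (v α i)) ∧
            IsCircuit ((fun i => sectionPoint l (v α i)) '' {i | (i : ℕ) < p α})) ∧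
          ∑ α, partialSharblyBoundary (p α) (v α) =
            ∑ w ∈ 𝒲, coneSharbly o w - ∑ y ∈ 𝒴, coneSharbly o y) := by
  refine ⟨fun V _ _ _ P n T₁ T₂ hn hT₁ hT₂ => ⟨fun Z hZ => ?_, fun o => ?_⟩, ?_⟩
  · obtain ⟨w, hw⟩ := hZ.exists_weightedFlip
    refine ⟨fun m z hz hzZ => ⟨hw.disjoint_circuitSimplices hT₁ hT₂,
      hw.circuitSimplices_union hT₁ hT₂, ?_, hw.circuit_formula hT₁ hT₂ hz hzZ⟩, ?_⟩
    · rintro rfl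
      exact hw.circuitSimplices_eq_sdiff hT₁ hT₂ (by rw [card_eq_of_range_eq hz hzZ, hn])
    · exact fun o σ₀ hσ₀ p v hv hvZ hvF =>
        hw.link_formula hn hT₁ (hZ.vertices.trans extremePoints_subset) o hσ₀ hv hvZ hvF
  · obtain ⟨k, p, v, hv, hsum⟩ := hT₁.exists_flipTuples_of_orientation hT₂ hn o
    exact ⟨k, p, v, fun α => ⟨(hv α).injective, (hv α).mem_extremePoints, (hv α).le_length,
      (hv α).isCircuit⟩, hsum⟩
  · rintro n k hk l hl F ⟨M, ψ, rfl, hψ⟩ hrank o 𝒲 𝒴 h𝒲 h𝒴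
    obtain ⟨N, p, v, hv, hsum⟩ := exists_flipons hl hψ hk hrank o h𝒲 h𝒴
    exact ⟨N, p, v, fun α => ⟨(hv α).1, (hv α).2.isCircuit.three_le, (hv α).2.le_length,
      (hv α).2.mem_extremePoints, (hv α).2.injective,
      (hv α).2.isCircuit⟩, hsum⟩

theorem mainTheorem6 :
    -- flips and regular triangulations of an `n`-dimensional polytope
    (∀ (V : Type*) [AddCommGroup V] [Module ℝ V] [DecidableEq V] (P : Set V) (n : ℕ)
        (T₁ T₂ : Finset (Finset V)),
      IsPolytope P → Module.finrank ℝ (vectorSpan ℝ P) = n →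
      IsRegularTriangulation P T₁ → IsRegularTriangulation P T₂ →
      -- `T₁` and `T₂` are connected by a flip along the circuit `Z`
      (∀ Z : Finset V, IsFlip P T₁ T₂ Z →
        -- the identity for the simplices of the circuit `{z_1, …, z_p}`, `p = m + 2`
        (∀ (m : ℕ) (z : Fin (m + 2) → V), Function.Injective z → Set.range z = (Z : Set V) →
          Disjoint (circuitSimplices Z T₁) (circuitSimplices Z T₂) ∧
          circuitSimplices Z T₁ ∪ circuitSimplices Z T₂ = Z.image (fun w => Z.erase w) ∧
          (m = n → circuitSimplices Z T₁ = T₁ \ T₂ ∧ circuitSimplices Z T₂ = T₂ \ T₁) ∧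
          ∀ o : Orientation ℝ (vectorSpan ℝ (Z : Set V)) (Fin m),
            ∃ e : ℤˣ,
              (e : ℤ) • ∑ i : Fin (m + 2), (-1 : ℤ) ^ ((i : ℕ) + 1) •
                  chainSymbol (z ∘ i.succAbove) =
                ∑ s ∈ circuitSimplices Z T₁, orientedSymbol o s -
                  ∑ u ∈ circuitSimplices Z T₂, orientedSymbol o u) ∧
        -- the identity for the maximal simplices of `P` that contain a given face of the link
        (∀ (o : Orientation ℝ (vectorSpan ℝ P) (Fin n)), ∀ σ₀ ∈ T₁ \ T₂,
          ∀ (p : ℕ) (v : Fin (n + 2) → V), Function.Injective v →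
            v '' {i | (i : ℕ) < p} = (Z : Set V) →
            v '' {i | p ≤ (i : ℕ)} = ((σ₀ \ Z : Finset V) : Set V) →
            ∃ e : ℤˣ,
              (e : ℤ) • partialBoundary p v =
                ∑ s ∈ T₁ \ T₂ with s \ Z = σ₀ \ Z, orientedSymbol o s -
                  ∑ u ∈ T₂ \ T₁ with u \ Z = σ₀ \ Z, orientedSymbol o u)) ∧
      -- any two regular triangulations
      (∀ o : Orientation ℝ (vectorSpan ℝ P) (Fin n),
        ∃ (k : ℕ) (p : Fin k → ℕ) (v : Fin k → Fin (n + 2) → V),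
          (∀ α, Function.Injective (v α) ∧ (∀ i, v α i ∈ P.extremePoints ℝ) ∧
            p α ≤ n + 2 ∧ IsCircuit (v α '' {i | (i : ℕ) < p α})) ∧
          ∑ α, partialBoundary (p α) (v α) =
            ∑ w ∈ T₁, orientedSymbol o w - ∑ y ∈ T₂, orientedSymbol o y)) ∧
    -- regular triangulations of a facet of a tile, where `d = k + 1 = n (n + 1) / 2`
    (∀ (n k : ℕ), 2 ≤ n → k + 1 = n * (n + 1) / 2 →
      ∀ l : Matrix (Fin n) (Fin n) ℝ →ₗ[ℝ] ℝ, IsTransversal l →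
      ∀ F : Set (Matrix (Fin n) (Fin n) ℝ), IsTileFacet F →
      ∀ (o : Orientation ℝ (Submodule.span ℝ F) (Fin k))
        (𝒲 𝒴 : Finset (Set (Matrix (Fin n) (Fin n) ℝ))),
        IsRegularConeTriangulation l F 𝒲 → IsRegularConeTriangulation l F 𝒴 →
        ∃ (N : ℕ) (p : Fin N → ℕ) (v : Fin N → Fin (k + 1) → QVec n),
          (∀ α, IsFlipon (v α) ∧ 3 ≤ p α ∧ p α ≤ k + 1 ∧
            (∀ i, sectionPoint l (v α i) ∈ (F ∩ {A | l A = 1}).extremePoints ℝ) ∧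
            Function.Injective (fun i => sectionPoint l (v α i)) ∧
            IsCircuit ((fun i => sectionPoint l (v α i)) '' {i | (i : ℕ) < p α})) ∧
          ∑ α, partialSharblyBoundary (p α) (v α) =
            ∑ w ∈ 𝒲, coneSharbly o w - ∑ y ∈ 𝒴, coneSharbly o y) := by
  obtain ⟨hpolytope, hcone⟩ := mainTheorem6_general
  refine ⟨fun V _ _ _ P n T₁ T₂ _ hn hT₁ hT₂ => hpolytope V P n T₁ T₂ hn hT₁.1 hT₂.1,
    fun n k hn hk l hl F hF o 𝒲 𝒴 h𝒲 h𝒴 => ?_⟩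
  have hrank : finrank ℝ (Submodule.span ℝ F) = k :=
    Nat.add_right_cancel (hF.finrank_span_add_one.trans hk.symm)
  exact hcone n k (hF.two_le hn hrank) l hl F hF.isLevelCone hrank o 𝒲 𝒴
    h𝒲.isConeTriangulation h𝒴.isConeTriangulation
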